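/- \textbf{Definitions.} Let $\Sigma_1,\Sigma_2$ be alphabets, $\Sigma=\Sigma_1\cup\Sigma_2$, and let $\pi_i$ denote the projection of words over $\Sigma$ to $\Sigma_i$, which deletes all letters outside $\Sigma_i$. Let $\mathcal A$ and $\mathcal B$ be nondeterministic B\"uchi automata (NBA), each with a single initial state, over $\Sigma$. In the multi-buffer game with buffer capacities $(\omega,0)$, a configuration $(p,\beta_1,\beta_2,q)$ consists of a state $p$ of $\mathcal A$, contents $\beta_i\in\Sigma_i^*$ of two FIFO buffers (oldest letter first), and a state $q$ of $\mathcal B$. The play starts in the initial states with empty buffers. In each round, Spoiler chooses a transition $p\xrightarrow{a}p'$ of $\mathcal A$; then Duplicator chooses a finite, possibly empty, run of $\mathcal B$ from $q$ to some state $q'$ on a word $v\in\Sigma^*$ such that $\beta_i\,\pi_i(a)=\pi_i(v)\,\beta_i'$ for $i=1,2$, for some $\beta_1'\in\Sigma_1^*$ (of arbitrary length) and $\beta_2'=\varepsilon$. The next configuration is $(p',\beta_1',\beta_2',q')$. A player who cannot move loses. Duplicator wins an infinite play if Spoiler's run is not accepting, or if her run is infinite and accepting and every letter occurs equally often in the two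 words. Write $\mathcal A\sqsubseteq^{(\omega,0)}_{(\Sigma_1,\Sigma_2)}\mathcal B$ if Duplicator has a winning strategy. A \emph{recursive B\"uchi game} (RBG) $G=(V,E,\mathit{Own},\mathit{Fin},v_{\mathsf I})$ consists of a decidable set $V\subseteq\{0,1\}^*$ of nodes, a decidable set $E\subseteq V\times V$ of edges, decidable sets $\mathit{Own},\mathit{Fin}\subseteq V$, and a starting node $v_{\mathsf I}\in V$. It is represented by deterministic Turing machines deciding $V$, $E$, $\mathit{Own}$ and $\mathit{Fin}$, together with the word $v_{\mathsf I}$. A play starts in $v_0=v_{\mathsf I}$; in a node $v_i\in\mathit{Own}$ player $0$, and in a node $v_i\notin\mathit{Own}$ player $1$, chooses $v_{i+1}$ with $(v_i,v_{i+1})\in E$. A player who has no such choice loses, and player $0$ wins an infinite play iff $v_i\in\mathit{Fin}$ for infinitely many $i$. \textbf{Theorem.} From a representation of an RBG $G$ one can effectively construct (by a computable function) a finite alphabet $\Sigma_1$ and two NBA $\mathcal A$ and $\mathcal B$ over $\Sigma_1\cup\Sigma_2$, where $\Sigma_2=\{c\}\cup\{c_x\mid x\in\Sigma_1\}$ is disjoint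 from $\Sigma_1$, such that $$\mathcal A\sqsubseteq^{(\omega,0)}_{(\Sigma_1,\Sigma_2)}\mathcal B\quad\Longleftrightarrow\quad\text{player }0\text{ has a winning strategy for }G.$$ -/

import Mathlib

/-! ### Büchi automata, trace alphabets and the multi-buffer simulation game -/

namespace MultiBuffer

/-- A nondeterministic Büchi automaton with finite state set `Q` over the finite alphabet `α`. -/
structure NBA (α Q : Type) [Finite α] [Finite Q] where
  start : Q
  δ : Q → α → Set Q
  F : Set Q

/-- `A.IsPath q u q'`: the list `u` of pairs (letter, next state) is a finite run
of `A` from `q` to `q'`. -/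
def NBA.IsPath {α Q : Type} [Finite α] [Finite Q] (A : NBA α Q) : Q → List (α × Q) → Q → Prop
  | q, [], q' => q' = q
  | q, (a, r) :: u, q' => r ∈ A.δ q a ∧ A.IsPath r u q'

/-- A trace alphabet `(Σ_i)_i` with `k` component alphabets whose union is `α`. -/
structure TraceAlphabet (α : Type) (k : ℕ) where
  alph : Fin k → Set α
  cover : ∀ a, ∃ i, a ∈ alph i

open Classical in
/-- The projection `π_i`, deleting all letters outside `Σ_i`. -/
noncomputable def TraceAlphabet.proj {α : Type} {k : ℕ} (σ : TraceAlphabet α k) (i : Fin k)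
    (w : List α) : List α :=
  w.filter (fun a => a ∈ σ.alph i)

/-- Configurations `(p, β_1, …, β_k, q)`. The head of a buffer is its oldest letter. -/
structure Config (α P Q : Type) (k : ℕ) where
  p : P
  buf : Fin k → List α
  q : Q

/-- The list `s 0, …, s n`. -/
def hist {X : Type} (s : ℕ → X) (n : ℕ) : List X := (List.range (n + 1)).map s

open Classical in
/-- The number of occurrences of `a` in the finite or infinite word whose prefixes
are `w 0, w 1, …` (each a prefix of the next). -/
noncomputable def occ {α : Type} (a : α) (w : ℕ → List α) : ℕ∞ :=
  ⨆ n, ((w n).count a : ℕ∞)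

section Game

variable {α P Q : Type} [Finite α] [Finite P] [Finite Q] {k : ℕ}

/-- One round of the game: Spoiler reads the letter `m.1` and moves to `m.2`, and the letter is
appended to all buffers of that letter; then Duplicator answers with the finite, possibly empty,
run `u`, removing its letters from the front of the respective buffers. The capacities are
checked after the round. -/
def Round (σ : TraceAlphabet α k) (κ : Fin k → ℕ∞) (A : NBA α P) (B : NBA α Q)
    (c : Config α P Q k) (m : α × P) (u : List (α × Q)) (c' : Config α P Q k) : Prop :=
  m.2 ∈ A.δ c.p m.1 ∧ c'.p = m.2 ∧ B.IsPath c.q u c'.q ∧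
    ∀ i, c.buf i ++ σ.proj i [m.1] = σ.proj i (u.map Prod.fst) ++ c'.buf i ∧
      ((c'.buf i).length : ℕ∞) ≤ κ i

/-- The first `n` rounds of a play: Spoiler's moves are `s 0, s 1, …`, Duplicator answers with the
strategy `θ`, which sees all moves made by Spoiler so far, and `c j` is the configuration before
round `j`. -/
def PlayUpTo (σ : TraceAlphabet α k) (κ : Fin k → ℕ∞) (A : NBA α P) (B : NBA α Q)
    (θ : List (α × P) → List (α × Q)) (s : ℕ → α × P) (c : ℕ → Config α P Q k) (n : ℕ) : Prop :=
  c 0 = ⟨A.start, fun _ => [], B.start⟩ ∧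
    ∀ j < n, Round σ κ A B (c j) (s j) (θ (hist s j)) (c (j + 1))

/-- Duplicator wins with the strategy `θ`: her answers are always legal, and whenever Spoiler
produces an accepting run, then her run is infinite and accepting (it visits accepting states
in infinitely many rounds), and every letter occurs in her word as often as in Spoiler's word. -/
def WinningForDuplicator (σ : TraceAlphabet α k) (κ : Fin k → ℕ∞) (A : NBA α P) (B : NBA α Q)
    (θ : List (α × P) → List (α × Q)) : Prop :=
  (∀ s c n, PlayUpTo σ κ A B θ s c n → (s n).2 ∈ A.δ (c n).p (s n).1 →
    ∃ c', Round σ κ A B (c n) (s n) (θ (hist s n)) c') ∧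
  (∀ s c, (∀ n, PlayUpTo σ κ A B θ s c n) →
    (∃ᶠ n in Filter.atTop, (c n).p ∈ A.F) →
    (∃ᶠ n in Filter.atTop, ∃ x ∈ θ (hist s n), x.2 ∈ B.F) ∧
    ∀ a, occ a (fun n => (List.range n).map (fun j => (s j).1)) =
      occ a (fun n => (List.range n).flatMap (fun j => (θ (hist s j)).map Prod.fst)))

/-- Multi-buffer simulation: Duplicator has a winning strategy. -/
def Simulated (σ : TraceAlphabet α k) (κ : Fin k → ℕ∞) (A : NBA α P) (B : NBA α Q) : Prop :=
  ∃ θ, WinningForDuplicator σ κ A B θ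

end Game

/-! ### The alphabets, and automata given by finite data -/

/-- The union of the disjoint alphabets `Σ_1 = {0, …, m - 1}` and
`Σ_2 = {c} ∪ {c_x | x ∈ Σ_1}`, where `inl x` is the letter `x` of `Σ_1`, `inr none` is `c`
and `inr (some x)` is `c_x`. -/
abbrev Letter (m : ℕ) := Fin m ⊕ Option (Fin m)

/-- The trace alphabet `(Σ_1, Σ_2)`. -/
def sigma12 (m : ℕ) : TraceAlphabet (Letter m) 2 where
  alph := ![Set.range Sum.inl, Set.range Sum.inr]
  cover := by
    rintro (x | y)
    · exact ⟨0, by simp⟩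
    · exact ⟨1, by simp⟩

/-- Finite description of an NBA with states `0, …, lastState` and initial state `0`
through the lists of its transitions and of its accepting states. -/
structure NBACode where
  lastState : ℕ
  trans : List (ℕ × (ℕ ⊕ Option ℕ) × ℕ)
  acc : List ℕ

/-- An `NBACode` as a tuple of lists and numbers. -/
def NBACode.equiv : NBACode ≃ ℕ × List (ℕ × (ℕ ⊕ Option ℕ) × ℕ) × List ℕ where
  toFun d := (d.lastState, d.trans, d.acc)
  invFun t := ⟨t.1, t.2.1, t.2.2⟩
  left_inv _ := rfl
  right_inv _ := rfl

instance : Primcodable NBACode := Primcodable.ofEquiv _ NBACode.equiv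

/-- The automaton described by an `NBACode`, over the alphabet `Letter m`. -/
def NBACode.toNBA (m : ℕ) (d : NBACode) : NBA (Letter m) (Fin (d.lastState + 1)) where
  start := 0
  δ p a := {q | ((p : ℕ), Sum.map Fin.val (Option.map Fin.val) a, (q : ℕ)) ∈ d.trans}
  F := {q | (q : ℕ) ∈ d.acc}

/-! ### Recursive Büchi games -/

/-- A Büchi game whose nodes are words over `{0,1}`. -/
structure BuchiGame where
  V : Set (List Bool)
  E : Set (List Bool × List Bool)
  Own : Set (List Bool)
  Final : Set (List Bool)
  start : List Bool
  edge_mem : E ⊆ V ×ˢ V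
  own_mem : Own ⊆ V
  final_mem : Final ⊆ V
  start_mem : start ∈ V

/-- The play `v` follows the rules, and the strategy `s` of player 0, for its first `n` moves.
The strategy sees all nodes visited so far. -/
def BuchiGame.PlayUpTo (G : BuchiGame) (s : List (List Bool) → List Bool) (v : ℕ → List Bool)
    (n : ℕ) : Prop :=
  v 0 = G.start ∧ ∀ i < n, (v i, v (i + 1)) ∈ G.E ∧ (v i ∈ G.Own → v (i + 1) = s (hist v i))

/-- Player 0 has a winning strategy: one that always makes a legal move, and with which
all infinite plays visit `Final` infinitely often. -/
def BuchiGame.Player0Wins (G : BuchiGame) : Prop :=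
  ∃ s : List (List Bool) → List Bool,
    (∀ v n, G.PlayUpTo s v n → v n ∈ G.Own → (v n, s (hist v n)) ∈ G.E) ∧
    (∀ v, (∀ n, G.PlayUpTo s v n) → ∃ᶠ n in Filter.atTop, v n ∈ G.Final)

/-- The finite table of a deterministic single-tape Turing machine. States and tape symbols are
numbers. A row `((q, a), q', x)` says that, in state `q` reading `a`, the machine goes to state `q'`
and moves left (`x = inl false`), moves right (`x = inl true`) or writes `b` (`x = inr b`). -/
abbrev TMTable := List ((ℕ × ℕ) × ℕ × (Bool ⊕ ℕ))

/-- The machine given by a table. The first matching row applies; without such a row, the machine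
halts. The initial state and the blank symbol are both `0`. -/
def TMTable.toMachine (T : TMTable) : Turing.TM0.Machine ℕ ℕ := fun q a =>
  (T.find? (fun r => r.1 == (q, a))).map fun r =>
    (r.2.1, match r.2.2 with
      | Sum.inl false => Turing.TM0.Stmt.move Turing.Dir.left
      | Sum.inl true => Turing.TM0.Stmt.move Turing.Dir.right
      | Sum.inr b => Turing.TM0.Stmt.write b)

/-- Started on the tape content `w`, the machine halts in the state `q`. -/
def TMTable.HaltsIn (T : TMTable) (w : List ℕ) (q : ℕ) : Prop :=
  ∃ c ∈ StateTransition.eval (Turing.TM0.step T.toMachine) (Turing.TM0.init w), c.q = q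

/-- The machine decides the set `S` of objects coded by `enc`; state `1` is the accepting and
state `2` the rejecting halting state. -/
def TMTable.Decides {X : Type} (T : TMTable) (enc : X → List ℕ) (S : Set X) : Prop :=
  ∀ x, (x ∈ S → T.HaltsIn (enc x) 1) ∧ (x ∉ S → T.HaltsIn (enc x) 2)

/-- A word over `{0,1}` on the tape: the digits `0` and `1` are the tape symbols `1` and `2`. -/
def encWord (w : List Bool) : List ℕ := w.map fun b => cond b 2 1

/-- A pair `(v, w)` of words on the tape: `v # w`, where `#` is the tape symbol `3`. -/
def encPair (x : List Bool × List Bool) : List ℕ := encWord x.1 ++ 3 :: encWord x.2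

/-- Representation of a recursive Büchi game: Turing machines for its nodes, its edges and its
subsets `Own` and `Final`, and its starting node. -/
structure GameCode where
  nodes : TMTable
  edges : TMTable
  own : TMTable
  final : TMTable
  start : List Bool

/-- A `GameCode` as a tuple. -/
def GameCode.equiv : GameCode ≃ TMTable × TMTable × TMTable × TMTable × List Bool where
  toFun d := (d.nodes, d.edges, d.own, d.final, d.start)
  invFun t := ⟨t.1, t.2.1, t.2.2.1, t.2.2.2.1, t.2.2.2.2⟩
  left_inv _ := rfl
  right_inv _ := rfl

instance : Primcodable GameCode := Primcodable.ofEquiv _ GameCode.equiv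

/-- `R` represents the game `G`; in particular, `G` is a recursive Büchi game. -/
def GameCode.Represents (R : GameCode) (G : BuchiGame) : Prop :=
  R.nodes.Decides encWord G.V ∧ R.edges.Decides encPair G.E ∧ R.own.Decides encWord G.Own ∧
    R.final.Decides encWord G.Final ∧ R.start = G.start

end MultiBuffer

/-! ### Abstract Büchi games -/

namespace MultiBuffer

/-! The buffer of Σ_1 is unbounded and acts as a queue: Spoiler appends letters and Duplicator
removes them. The buffer of Σ_2 has capacity 0, so a Σ_2-letter must be answered in its own round,
and these letters synchronise the players. In one move of a queue game, Spoiler announces the first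
letter x of the queue by c_x. Duplicator must remove x and thereby commits her automaton to a
Boolean d. Spoiler then announces d, by c or by c_x, and appends the word prescribed by the
transition, possibly after a power of a pump letter. A false announcement sends Duplicator to a
universal accepting state, so Spoiler gains nothing from it; true announcements leave her no freedom
except d and reading one letter ahead. Pumping states are not accepting, so the pumping must stop.
Hence Duplicator wins the simulation game iff the protagonist wins the queue game
(`simulated_of_win`, `win_of_simulated`).

Queue games are strong enough. A queue that holds several stacks separated by markers, up to
rotation, simulates a stack machine (`win_toQueueGame_iff`), and stack machines run all partial
recursive programs (`run_code`). Nodes are replaced by numbers j, stored in binary as 2^j with the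
lowest digit on top. Incrementing j then means pushing one 0, and a power of 0 chosen by the
antagonist names a node in one move. The protagonist has only Boolean choices and counts up to the
number she wants; counting forever visits no final position (`win_numArena_iff_player0Wins`).

A single program computes the outcomes of moves in all represented games, given the code number n of
the game as 2^n on the stack (`exists_verdict_code`, `win_codeGame_iff`). The game therefore enters
only through the initial queue, that is, through a word that Spoiler writes first. The control parts
of the automata are constants, which need not be found effectively, and the construction is
computable.

Winning is treated as a fixpoint, `Win`. It yields positional strategies (`Win.exists_positional`),
and conversely it follows from strategies with memory through `win_of_histories`. -/

/-- A Büchi game in which, in each position, the protagonist first chooses `d : D` and then the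
antagonist chooses `e : E`. The protagonist has to visit `fin` infinitely often. -/
structure Arena (V D E : Type) where
  next : V → D → E → V
  fin : V → Prop

namespace Arena

variable {V D E : Type} (G : Arena V D E)

/-- The protagonist can force a visit to `T` from `v`. -/
inductive Force (T : V → Prop) : V → Prop
  | done {v : V} (h : T v) : Force T v
  | step {v : V} (d : D) (h : ∀ e, Force T (G.next v d e)) : Force T v

/-- The protagonist wins from `v`: this is the greatest fixpoint of "she can force, in at least
one move, a visit to `fin` that stays within the set". -/
def Win (v : V) : Prop :=
  ∃ X : V → Prop, X v ∧ ∀ u, X u → ∃ d, ∀ e, G.Force (fun w => G.fin w ∧ X w) (G.next u d e)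

variable {G}

theorem Force.mono {T T' : V → Prop} (h : ∀ v, T v → T' v) {v : V} (hv : G.Force T v) :
    G.Force T' v := by
  induction hv with
  | done hv => exact .done (h _ hv)
  | step d _ ih => exact .step d ih

/-- Every witness X consists of winning positions, so `Win` itself can take the place of X. -/
theorem Win.unfold {v : V} (h : G.Win v) :
    ∃ d, ∀ e, G.Force (fun w => G.fin w ∧ G.Win w) (G.next v d e) := by
  obtain ⟨X, hv, hX⟩ := h
  obtain ⟨d, hd⟩ := hX v hv
  exact ⟨d, fun e => (hd e).mono fun w hw => ⟨hw.1, X, hw.2, hX⟩⟩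

/-- The positions from which a winning final position can be forced form a witness: where nothing
remains to be forced, the move comes from `Win.unfold`. -/
theorem Force.win {v : V} (h : G.Force (fun w => G.fin w ∧ G.Win w) v) : G.Win v := by
  refine ⟨G.Force (fun w => G.fin w ∧ G.Win w), h, fun u hu => ?_⟩
  have key : ∃ d, ∀ e, G.Force (fun w => G.fin w ∧ G.Win w) (G.next u d e) := by
    cases hu with
    | done hu => exact hu.2.unfold
    | step d hd => exact ⟨d, hd⟩
  obtain ⟨d, hd⟩ := key
  exact ⟨d, fun e => (hd e).mono fun w hw => ⟨hw.1, .done hw⟩⟩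

theorem win_of_forall {v : V} (d : D) (h : ∀ e, G.Win (G.next v d e)) : G.Win v := by
  refine Force.win (.step d fun e => ?_)
  obtain ⟨d', hd'⟩ := (h e).unfold
  exact .step d' hd'

/-- With the positional strategy `σ`, every play from `v` visits `fin`. -/
inductive Ev (G : Arena V D E) (σ : V → D) : V → Prop
  | done {v : V} (h : G.fin v) : Ev G σ v
  | step {v : V} (h : ∀ e, Ev G σ (G.next v (σ v) e)) : Ev G σ v

/-- `Force` with bounds on the number of moves. -/
inductive ForceAt (G : Arena V D E) (T : V → Prop) : Ordinal.{0} → V → Prop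
  | done {v : V} (o : Ordinal) (h : T v) : ForceAt G T o v
  | step {v : V} (o : Ordinal) (d : D) (r : E → Ordinal) (hr : ∀ e, r e < o)
      (h : ∀ e, ForceAt G T (r e) (G.next v d e)) : ForceAt G T o v

/-- The antagonist may have infinitely many moves, so the bounds are ordinals: a supremum of
successors over his moves. -/
theorem Force.exists_forceAt {T : V → Prop} {v : V} (h : G.Force T v) : ∃ o, G.ForceAt T o v := by
  induction h with
  | done h => exact ⟨0, .done 0 h⟩
  | step d _ ih =>
    choose r hr using ih
    refine ⟨⨆ e, Order.succ (r e), .step _ d r (fun e => ?_) hr⟩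
    exact lt_of_lt_of_le (Order.lt_succ _) (Ordinal.le_iSup (fun e => Order.succ (r e)) e)

/-- Positional determinacy for the protagonist. -/
theorem Win.exists_positional {v : V} (h : G.Win v) :
    ∃ (σ : V → D) (Y : V → Prop), Y v ∧
      ∀ u, Y u → ∀ e, Y (G.next u (σ u) e) ∧ G.Ev σ (G.next u (σ u) e) := by
  classical
  set T : V → Prop := fun w => G.fin w ∧ G.Win w with hT
  have hrank : ∀ u, G.Win u → ∃ o, G.ForceAt T o u := fun u hu => by
    obtain ⟨d, hd⟩ := hu.unfold
    exact (Force.step d hd).exists_forceAt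
  -- The rank is the least bound for forcing a visit to `T`. The strategy decreases it outside `T`
  -- and starts a new attempt inside `T`.
  let rank : V → Ordinal := fun u => sInf {o | G.ForceAt T o u}
  have hstep : ∀ u, G.Win u → ∃ d, ∀ e, G.Force T (G.next u d e) ∧
      (¬ T u → rank (G.next u d e) < rank u) := by
    intro u hu
    by_cases hTu : T u
    · obtain ⟨d, hd⟩ := hu.unfold
      exact ⟨d, fun e => ⟨hd e, fun h => (h hTu).elim⟩⟩
    · have hmem : G.ForceAt T (rank u) u := csInf_mem (hrank u hu)
      have toForce : ∀ {o w}, G.ForceAt T o w → G.Force T w := by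
        intro o w hw
        induction o using WellFoundedLT.induction generalizing w with
        | ind o ih =>
          cases hw with
          | done _ h => exact .done h
          | step _ d r hr h => exact .step d fun e => ih (r e) (hr e) (h e)
      generalize rank u = o at hmem
      cases hmem with
      | done _ h => exact (hTu h).elim
      | step _ d r hr h =>
        exact ⟨d, fun e => ⟨toForce (h e), fun _ => lt_of_le_of_lt (csInf_le' (h e)) (hr e)⟩⟩
  let σ : V → D := fun u =>
    -- Outside the winning region any value will do.
    if hu : G.Win u then (hstep u hu).choose else h.unfold.choose
  have hσ : ∀ u, G.Win u → ∀ e, G.Force T (G.next u (σ u) e) ∧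
      (¬ T u → rank (G.next u (σ u) e) < rank u) := by
    intro u hu
    simp only [σ, dif_pos hu]
    exact (hstep u hu).choose_spec
  have hEv : ∀ o u, rank u = o → G.Win u → G.Ev σ u := by
    intro o
    induction o using WellFoundedLT.induction with
    | ind o ih =>
      intro u hu hw
      by_cases hTu : T u
      · exact .done hTu.1
      · refine .step fun e => ?_
        obtain ⟨h1, h2⟩ := hσ u hw e
        exact ih _ (hu ▸ h2 hTu) _ rfl h1.win
  refine ⟨σ, G.Win, h, fun u hu e => ?_⟩
  have := (hσ u hu e).1.win
  exact ⟨this, hEv _ _ rfl this⟩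

/-- A winning criterion: `H` is a type of finite plays, `pos` the position reached. If every finite
play has, for some `d` and all `e`, an extension by this move, and no infinite chain of
extensions avoids `fin`, then the protagonist wins. -/
theorem win_of_histories {H : Type} (pos : H → V) (Ext : H → H → Prop)
    (hExt : ∀ m, ∃ d, ∀ e, ∃ m', Ext m m' ∧ pos m' = G.next (pos m) d e)
    (hinf : ∀ c : ℕ → H, (∀ i, Ext (c i) (c (i + 1))) → ∃ i, G.fin (pos (c (i + 1))))
    (m : H) : G.Win (pos m) := by
  refine ⟨fun v => ∃ m, pos m = v, ⟨m, rfl⟩, ?_⟩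
  rintro _ ⟨m, rfl⟩
  set T : V → Prop := fun w => G.fin w ∧ ∃ m, pos m = w with hT
  -- If the fixpoint property fails at a history, then it fails again at some extension that is not
  -- in `fin`. Dependent choice yields an infinite chain of extensions avoiding `fin`.
  by_contra hcon
  push Not at hcon
  have hbad : ∀ m : {m : H // ∀ d, ∃ e, ¬ G.Force T (G.next (pos m) d e)},
      ∃ m' : {m : H // ∀ d, ∃ e, ¬ G.Force T (G.next (pos m) d e)},
        Ext m.1 m'.1 ∧ ¬ G.fin (pos m'.1) := by
    rintro ⟨m, hm⟩
    obtain ⟨d, hd⟩ := hExt m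
    obtain ⟨e, he⟩ := hm d
    obtain ⟨m', h1, h2⟩ := hd e
    rw [← h2] at he
    refine ⟨⟨m', fun d' => ?_⟩, h1, fun hf => he (.done ⟨hf, m', rfl⟩)⟩
    by_contra hno
    push Not at hno
    exact he (.step d' hno)
  choose f hf using hbad
  let c : ℕ → {m : H // ∀ d, ∃ e, ¬ G.Force T (G.next (pos m) d e)} :=
    fun i => f^[i] ⟨m, hcon⟩
  have hc : ∀ i, c (i + 1) = f (c i) := fun i => Function.iterate_succ_apply' f i _
  obtain ⟨i, hi⟩ := hinf (fun i => (c i).1) fun i => by rw [hc]; exact (hf _).1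
  rw [hc] at hi
  exact (hf _).2 hi

/-- `Run G v w`: from `v`, through positions outside of `fin` in which the choices do not
matter, the play arrives in `w`. -/
inductive Run (G : Arena V D E) : V → V → Prop
  | refl (v : V) : Run G v v
  | step {v v' w : V} (hf : ¬ G.fin v) (hn : ∀ d e, G.next v d e = v') (h : Run G v' w) : Run G v w

theorem Run.trans {u v w : V} (h : G.Run u v) (h' : G.Run v w) : G.Run u w := by
  induction h with
  | refl => exact h'
  | step hf hn _ ih => exact .step hf hn (ih h')

theorem Run.single {v w : V} (hf : ¬ G.fin v) (hn : ∀ d e, G.next v d e = w) : G.Run v w :=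
  .step hf hn (.refl _)

theorem Run.force [Nonempty D] {T : V → Prop} {v w : V} (h : G.Run v w) (hw : G.Force T w) :
    G.Force T v := by
  induction h with
  | refl => exact hw
  | step hf hn _ ih => exact .step (Classical.arbitrary D) fun e => by rw [hn]; exact ih hw

theorem Run.win_iff [Nonempty D] [Nonempty E] {v w : V} (h : G.Run v w) : G.Win v ↔ G.Win w := by
  induction h with
  | refl => exact Iff.rfl
  | step hf hn _ ih =>
    rw [← ih]
    constructor
    · intro h
      obtain ⟨d, hd⟩ := h.unfold
      have := hd (Classical.arbitrary E)
      rw [hn] at this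
      exact this.win
    · exact fun h => win_of_forall (Classical.arbitrary D) fun e => by rwa [hn]

/-- If each move of `G` corresponds to the same move of `G'`, followed by a run, then both games
have the same winner. -/
theorem win_iff_of_simulation {V' : Type} [Nonempty D] {G' : Arena V' D E} (R : V → V' → Prop)
    (hfin : ∀ v v', R v v' → (G.fin v ↔ G'.fin v'))
    (hstep : ∀ v v', R v v' → ∀ d e, ∃ w', G'.Run (G'.next v' d e) w' ∧ R (G.next v d e) w')
    {v : V} {v' : V'} (h : R v v') : G.Win v ↔ G'.Win v' := by
  constructor
  · intro hv
    have key : ∀ u, G.Force (fun w => G.fin w ∧ G.Win w) u → ∀ u', R u u' →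
        G'.Force (fun w' => G'.fin w' ∧ ∃ w, G.Win w ∧ R w w') u' := by
      intro u hu
      induction hu with
      | @done u hu => exact fun u' hR => .done ⟨(hfin _ _ hR).1 hu.1, u, hu.2, hR⟩
      | step d _ ih =>
        intro u' hR
        refine .step d fun e => ?_
        obtain ⟨w', h1, h2⟩ := hstep _ _ hR d e
        exact h1.force (ih e _ h2)
    refine ⟨fun w' => ∃ w, G.Win w ∧ R w w', ⟨v, hv, h⟩, ?_⟩
    rintro u' ⟨u, hu, hR⟩
    obtain ⟨d, hd⟩ := hu.unfold
    refine ⟨d, fun e => ?_⟩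
    obtain ⟨w', h1, h2⟩ := hstep _ _ hR d e
    exact h1.force (key _ (hd e) _ h2)
  · intro hv
    -- A forced visit in `G'` is traced from inside the run that leads to the related position.
    -- Since positions inside a run are not in `fin`, the visit cannot happen before the run ends.
    have key : ∀ u', G'.Force (fun w' => G'.fin w' ∧ G'.Win w') u' → ∀ u w', R u w' → G'.Run u' w' →
        G.Force (fun w => G.fin w ∧ ∃ w', G'.Win w' ∧ R w w') u := by
      intro u' hu
      induction hu with
      | @done u' hu =>
        intro u w' hR hrun
        cases hrun with
        | refl => exact .done ⟨(hfin _ _ hR).2 hu.1, u', hu.2, hR⟩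
        | step hf => exact (hf hu.1).elim
      | @step u' d _ ih =>
        intro u w' hR hrun
        cases hrun with
        | refl =>
          refine .step d fun e => ?_
          obtain ⟨w', h1, h2⟩ := hstep _ _ hR d e
          exact ih e _ _ h2 h1
        | step hf hn hr =>
          by_cases hE : Nonempty E
          · obtain ⟨e⟩ := hE
            exact ih e _ _ hR (by rw [hn]; exact hr)
          · exact .step d fun e => (hE ⟨e⟩).elim
    refine ⟨fun w => ∃ w', G'.Win w' ∧ R w w', ⟨v', hv, h⟩, ?_⟩
    rintro u ⟨u', hu, hR⟩
    obtain ⟨d, hd⟩ := hu.unfold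
    refine ⟨d, fun e => ?_⟩
    obtain ⟨w', h1, h2⟩ := hstep _ _ hR d e
    exact key _ (hd e) _ _ h2 h1

end Arena

/-- Finite sequences, each extending the one before, have a common extension. -/
theorem exists_limit {X : Type} (f : ℕ → ℕ → X) (n : ℕ → ℕ) (hn : ∀ i, n i < n (i + 1))
    (h : ∀ i, ∀ j < n i, f (i + 1) j = f i j) : ∃ g : ℕ → X, ∀ i, ∀ j < n i, g j = f i j := by
  have hmono : StrictMono n := strictMono_nat_of_lt_succ hn
  have key : ∀ i k, ∀ j < n i, f (i + k) j = f i j := by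
    intro i k
    induction k with
    | zero => simp
    | succ k ih =>
      intro j hj
      rw [← add_assoc, h (i + k) j (hj.trans_le (hmono.monotone (by omega))), ih j hj]
  -- By strict monotonicity j < n (j + 1), so the entry j of the sequence f (j + 1) no longer
  -- changes.
  refine ⟨fun j => f (j + 1) j, fun i j hj => ?_⟩
  have hlt : j < n (j + 1) := lt_of_lt_of_le (Nat.lt_succ_self j) (hmono.id_le (j + 1))
  rcases le_total i (j + 1) with hle | hle
  · obtain ⟨k, hk⟩ := Nat.exists_eq_add_of_le hle
    change f (j + 1) j = _
    rw [hk]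
    exact key i k j hj
  · obtain ⟨k, hk⟩ := Nat.exists_eq_add_of_le hle
    rw [hk]
    exact (key (j + 1) k j hlt).symm

end MultiBuffer

/-! ### Büchi games on words as arenas -/

namespace MultiBuffer

theorem hist_congr {X : Type} {s s' : ℕ → X} {n : ℕ} (h : ∀ j ≤ n, s j = s' j) :
    hist s n = hist s' n :=
  List.map_congr_left fun j hj => h j (by simpa [Nat.lt_succ_iff] using hj)

theorem getLast?_hist {X : Type} (s : ℕ → X) (n : ℕ) : (hist s n).getLast? = some (s n) := by
  simp [hist, List.range_succ]

/-- Positions of the arena of a Büchi game: one before the first node, the nodes, and two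
sinks. -/
inductive WordNode
  | pre
  | node (u : List Bool)
  | sink (b : Bool)

open Classical in
/-- The arena of a Büchi game. In a preliminary move, the protagonist must choose the starting
node. A player who chooses a node that is not a successor loses. -/
noncomputable def wordArena (G : BuchiGame) : Arena WordNode (List Bool) (List Bool) where
  next
    | .pre, d, _ => if d = G.start then .node d else .sink false
    | .node u, d, e =>
      if u ∈ G.Own then (if (u, d) ∈ G.E then .node d else .sink false)
      else (if (u, e) ∈ G.E then .node e else .sink true)
    | .sink b, _, _ => .sink b
  fin
    | .pre => False
    | .node u => u ∈ G.Final
    | .sink b => b = true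

variable {G : BuchiGame}

theorem BuchiGame.PlayUpTo.mono {s : List (List Bool) → List Bool} {v : ℕ → List Bool} {m n : ℕ}
    (h : G.PlayUpTo s v n) (hmn : m ≤ n) : G.PlayUpTo s v m :=
  ⟨h.1, fun i hi => h.2 i (hi.trans_le hmn)⟩

theorem BuchiGame.PlayUpTo.congr {s : List (List Bool) → List Bool} {v v' : ℕ → List Bool} {n : ℕ}
    (h : G.PlayUpTo s v n) (hv : ∀ j ≤ n, v' j = v j) : G.PlayUpTo s v' n := by
  refine ⟨(hv 0 (Nat.zero_le _)).trans h.1, fun i hi => ?_⟩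
  rw [hv i hi.le, hv (i + 1) hi, hist_congr fun j hj => hv j (hj.trans hi.le)]
  exact h.2 i hi

theorem BuchiGame.PlayUpTo.snoc {s : List (List Bool) → List Bool} {v : ℕ → List Bool} {n : ℕ}
    (h : G.PlayUpTo s v n) {w : List Bool} (hw : (v n, w) ∈ G.E)
    (hs : v n ∈ G.Own → w = s (hist v n)) : G.PlayUpTo s (Function.update v (n + 1) w) (n + 1) := by
  have hv : ∀ j ≤ n, Function.update v (n + 1) w j = v j := fun j hj => by
    rw [Function.update_of_ne (by omega)]
  have h' := h.congr hv
  refine ⟨h'.1, fun i hi => ?_⟩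
  rcases Nat.lt_succ_iff_lt_or_eq.1 hi with hi | rfl
  · exact h'.2 i hi
  · rw [hv i le_rfl, hist_congr hv, Function.update_self]
    exact ⟨hw, hs⟩

/-- The finite plays that follow the strategy are histories for `win_of_histories`. The extra
history `none` stands for the plays that player 1 has lost by an illegal choice. -/
theorem win_of_player0Wins (h : G.Player0Wins) : (wordArena G).Win (.node G.start) := by
  obtain ⟨s, hlegal, hwin⟩ := h
  let pos : Option {p : (ℕ → List Bool) × ℕ // G.PlayUpTo s p.1 p.2} → WordNode
    | none => .sink true
    | some p => .node (p.1.1 p.1.2)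
  let Ext : Option {p : (ℕ → List Bool) × ℕ // G.PlayUpTo s p.1 p.2} →
      Option {p : (ℕ → List Bool) × ℕ // G.PlayUpTo s p.1 p.2} → Prop
    | _, none => True
    | none, some _ => False
    | some p, some p' => p'.1.2 = p.1.2 + 1 ∧ ∀ j ≤ p.1.2, p'.1.1 j = p.1.1 j
  have hExt : ∀ m, ∃ d, ∀ e, ∃ m', Ext m m' ∧ pos m' = (wordArena G).next (pos m) d e := by
    rintro (_ | ⟨⟨v, n⟩, hv⟩)
    · exact ⟨[], fun e => ⟨none, trivial, rfl⟩⟩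
    · refine ⟨s (hist v n), fun e => ?_⟩
      have hupd : ∀ w, ∀ j ≤ n, Function.update v (n + 1) w j = v j := fun w j hj => by
        rw [Function.update_of_ne (by omega)]
      by_cases hown : v n ∈ G.Own
      · refine ⟨some ⟨(_, n + 1), hv.snoc (hlegal v n hv hown) fun _ => rfl⟩, ⟨rfl, hupd _⟩, ?_⟩
        change WordNode.node (Function.update v (n + 1) _ (n + 1)) = _
        rw [Function.update_self]
        simp [pos, wordArena, hown, hlegal v n hv hown]
      · by_cases he : (v n, e) ∈ G.E
        · refine ⟨some ⟨(_, n + 1), hv.snoc he fun h => (hown h).elim⟩, ⟨rfl, hupd _⟩, ?_⟩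
          change WordNode.node (Function.update v (n + 1) _ (n + 1)) = _
          rw [Function.update_self]
          simp [pos, wordArena, hown, he]
        · exact ⟨none, trivial, by simp [pos, wordArena, hown, he]⟩
  have hinf : ∀ c : ℕ → Option {p : (ℕ → List Bool) × ℕ // G.PlayUpTo s p.1 p.2},
      (∀ i, Ext (c i) (c (i + 1))) → ∃ i, (wordArena G).fin (pos (c (i + 1))) := by
    intro c hc
    by_cases hnone : ∃ i, c (i + 1) = none
    · obtain ⟨i, hi⟩ := hnone
      exact ⟨i, by rw [hi]; rfl⟩
    · have hsome : ∀ i, ∃ p, c i = some p := by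
        intro i
        rcases hci : c i with _ | p
        · have := hc i
          rcases hci' : c (i + 1) with _ | p'
          · exact (hnone ⟨i, hci'⟩).elim
          · rw [hci, hci'] at this
            exact this.elim
        · exact ⟨p, rfl⟩
      choose p hp using hsome
      have hstep : ∀ i, (p (i + 1)).1.2 = (p i).1.2 + 1 ∧
          ∀ j ≤ (p i).1.2, (p (i + 1)).1.1 j = (p i).1.1 j := fun i => by
        have := hc i
        rwa [hp, hp] at this
      -- A play with n moves fixes n + 1 nodes.
      obtain ⟨v, hv⟩ := exists_limit (fun i => (p i).1.1) (fun i => (p i).1.2 + 1)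
        (fun i => by rw [(hstep i).1]; omega) fun i j hj => (hstep i).2 j (by omega)
      have hlen : ∀ i, (p i).1.2 = (p 0).1.2 + i := by
        intro i
        induction i with
        | zero => rfl
        | succ i ih => rw [(hstep i).1, ih]; rfl
      have hplay : ∀ n, G.PlayUpTo s v n := fun n =>
        ((p n).2.congr fun j hj => hv n j (by omega)).mono (by rw [hlen]; omega)
      obtain ⟨k, hk, hfin⟩ := (hwin v hplay).forall_exists_of_atTop ((p 0).1.2 + 1)
      refine ⟨k - (p 0).1.2 - 1, ?_⟩
      have hk' : k = (p (k - (p 0).1.2 - 1 + 1)).1.2 := by rw [hlen]; omega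
      rw [hp]
      change (p (k - (p 0).1.2 - 1 + 1)).1.1 _ ∈ G.Final
      rw [← hk', ← hv (k - (p 0).1.2 - 1 + 1) k (by omega)]
      exact hfin
  have := Arena.win_of_histories pos Ext hExt hinf
    (some ⟨(fun _ => G.start, 0), rfl, fun i hi => (Nat.not_lt_zero i hi).elim⟩)
  exact this

theorem not_ev_sink_false {σ : WordNode → List Bool} : ¬ (wordArena G).Ev σ (.sink false) := by
  intro h
  generalize hv : WordNode.sink false = v at h
  induction h with
  | done h => subst hv; exact Bool.false_ne_true h
  | step _ ih => subst hv; exact ih [] rfl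

/-- A positional strategy of the arena only needs the last node of a history. It never makes an
illegal move, because `fin` is never visited from the losing sink. -/
theorem player0Wins_of_win (h : (wordArena G).Win (.node G.start)) : G.Player0Wins := by
  obtain ⟨σ, Y, hY0, hY⟩ := h.exists_positional
  have key : ∀ u w, (u, w) ∈ G.E → (u ∈ G.Own → w = σ (.node u)) →
      (wordArena G).next (.node u) (σ (.node u)) w = .node w := by
    intro u w huw hw
    by_cases hu : u ∈ G.Own
    · rw [← hw hu]
      simp [wordArena, hu, huw]
    · simp [wordArena, hu, huw]
  let s : List (List Bool) → List Bool := fun h => σ (.node (h.getLast?.getD []))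
  have hs : ∀ v n, s (hist v n) = σ (.node (v n)) := fun v n => by simp [s, getLast?_hist]
  have hplay : ∀ v n, G.PlayUpTo s v n → Y (.node (v n)) := by
    intro v n hv
    induction n with
    | zero => rw [hv.1]; exact hY0
    | succ n ih =>
      have h1 := (hY _ (ih (hv.mono (Nat.le_succ n))) (v (n + 1))).1
      have h2 := hv.2 n (Nat.lt_succ_self n)
      rwa [key _ _ h2.1 fun h => (h2.2 h).trans (hs v n)] at h1
  refine ⟨s, fun v n hv hown => ?_, fun v hv => ?_⟩
  · rw [hs]
    by_contra hE
    have := (hY _ (hplay v n hv) []).2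
    rw [show (wordArena G).next (.node (v n)) (σ (.node (v n))) [] = .sink false by
      simp [wordArena, hown, hE]] at this
    exact not_ev_sink_false this
  · rw [Filter.frequently_atTop]
    intro N
    have hnext : ∀ n, (wordArena G).next (.node (v n)) (σ (.node (v n))) (v (n + 1)) =
        .node (v (n + 1)) := fun n =>
      key _ _ ((hv (n + 1)).2 n (Nat.lt_succ_self n)).1 fun h =>
        (((hv (n + 1)).2 n (Nat.lt_succ_self n)).2 h).trans (hs v n)
    -- `Ev` covers all moves of the antagonist; it is followed along the actual play by taking the
    -- next node as his move, which has no effect in nodes of player 0.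
    have hev : ∀ u, (wordArena G).Ev σ u → ∀ k, u = .node (v k) → ∃ n ≥ k, v n ∈ G.Final := by
      intro u hu
      induction hu with
      | done h => rintro k rfl; exact ⟨k, le_rfl, h⟩
      | step _ ih =>
        rintro k rfl
        obtain ⟨n, hn, h⟩ := ih (v (k + 1)) (k + 1) (hnext k)
        exact ⟨n, by omega, h⟩
    have := (hY _ (hplay v N (hv N)) (v (N + 1))).2
    obtain ⟨n, hn, h⟩ := hev _ this (N + 1) (hnext N)
    exact ⟨n, by omega, h⟩

theorem not_force_sink_false {T : WordNode → Prop} {v : WordNode}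
    (h : (wordArena G).Force (fun w => (wordArena G).fin w ∧ T w) v) : v ≠ .sink false := by
  induction h with
  | done h => rintro rfl; exact Bool.false_ne_true h.1
  | step d _ ih => rintro rfl; exact ih [] rfl

theorem win_pre_iff_player0Wins : (wordArena G).Win .pre ↔ G.Player0Wins := by
  constructor
  · intro h
    obtain ⟨d, hd⟩ := h.unfold
    by_cases hs : d = G.start
    · refine player0Wins_of_win ?_
      have := (hd []).win
      rwa [show (wordArena G).next .pre d [] = .node G.start by simp [wordArena, hs]] at this
    · exact (not_force_sink_false (hd []) (by simp [wordArena, hs])).elim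
  · intro h
    refine Arena.win_of_forall G.start fun e => ?_
    rw [show (wordArena G).next .pre G.start e = .node G.start by simp [wordArena]]
    exact win_of_player0Wins h

end MultiBuffer

/-! ### Choosing nodes by numbers -/

namespace MultiBuffer

/-- The outcome of a move: a player has lost (`b` tells whether player 0 wins), or a node is
reached, with the information whether it belongs to player 0 and whether it is final. -/
inductive Verdict
  | sink (b : Bool)
  | node (o f : Bool)

/-- Positions of the game in which nodes are given by numbers: player 0 choosing a successor of
`k`, with `j` as current proposal; player 1 choosing a successor of `k`; and two sinks. The flag
`f` marks positions to be visited infinitely often. -/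
inductive NumNode
  | pick (f : Bool) (k : Option ℕ) (j : ℕ)
  | spick (f : Bool) (k : Option ℕ)
  | sink (b : Bool)

/-- The position after the number `j` has been chosen. -/
def Verdict.place (j : ℕ) : Verdict → NumNode
  | .sink b => .sink b
  | .node true f => .pick f (some j) 0
  | .node false f => .spick f (some j)

/-- Player 0 chooses a number by repeated incrementation, player 1 in one step. -/
def numArena (res : Option ℕ → ℕ → Verdict) : Arena NumNode Bool ℕ where
  next
    | .pick _ k j, true, _ => .pick false k (j + 1)
    | .pick _ k j, false, _ => (res k j).place j
    | .spick _ k, _, e => (res k e).place e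
    | .sink b, _, _ => .sink b
  fin
    | .pick f _ _ => f = true
    | .spick f _ => f = true
    | .sink b => b = true

open Classical in
/-- The outcome of choosing `w` at the node `u`, or as the starting node. -/
noncomputable def wordVerdict (G : BuchiGame) : Option (List Bool) → List Bool → Verdict
  | none, w =>
    if w = G.start then .node (decide (w ∈ G.Own)) (decide (w ∈ G.Final)) else .sink false
  | some u, w =>
    if (u, w) ∈ G.E then .node (decide (w ∈ G.Own)) (decide (w ∈ G.Final))
    else .sink (decide (u ∉ G.Own))

/-- The outcome of a choice, where the number `j` stands for the node `ν j`. -/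
noncomputable def numVerdict (G : BuchiGame) (ν : ℕ → List Bool) (k : Option ℕ) (j : ℕ) : Verdict :=
  wordVerdict G (k.map ν) (ν j)

/-- The number game position `x` represents the position `v`. -/
inductive NumRel (G : BuchiGame) (ν : ℕ → List Bool) : WordNode → NumNode → Prop
  | pre : NumRel G ν .pre (.pick false none 0)
  | pick {f : Bool} {k : ℕ} (ho : ν k ∈ G.Own) (hf : f = true ↔ ν k ∈ G.Final) :
      NumRel G ν (.node (ν k)) (.pick f (some k) 0)
  | spick {f : Bool} {k : ℕ} (ho : ν k ∉ G.Own) (hf : f = true ↔ ν k ∈ G.Final) :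
      NumRel G ν (.node (ν k)) (.spick f (some k))
  | sink (b : Bool) : NumRel G ν (.sink b) (.sink b)

/-- The positions in which player 0 moves, and the numbers of their nodes. -/
inductive Picks (G : BuchiGame) (ν : ℕ → List Bool) : WordNode → Option ℕ → Prop
  | pre : Picks G ν .pre none
  | node {k : ℕ} (ho : ν k ∈ G.Own) : Picks G ν (.node (ν k)) (some k)

variable {G : BuchiGame} {ν : ℕ → List Bool}

theorem NumRel.fin {v : WordNode} {x : NumNode} (h : NumRel G ν v x) :
    (wordArena G).fin v ↔ (numArena (numVerdict G ν)).fin x := by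
  cases h with
  | pre => exact iff_of_false not_false Bool.false_ne_true
  | pick _ hf => exact hf.symm
  | spick _ hf => exact hf.symm
  | sink b => exact Iff.rfl

theorem numRel_node_place (j : ℕ) {o f : Bool} (ho : o = true ↔ ν j ∈ G.Own)
    (hf : f = true ↔ ν j ∈ G.Final) :
    NumRel G ν (.node (ν j)) (Verdict.place j (.node o f)) := by
  cases o with
  | true => exact .pick (ho.1 rfl) hf
  | false => exact .spick (fun h => Bool.false_ne_true (ho.2 h)) hf

theorem Picks.numRel_next {v : WordNode} {k : Option ℕ} (h : Picks G ν v k) (j : ℕ)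
    (e : List Bool) :
    NumRel G ν ((wordArena G).next v (ν j) e) ((numVerdict G ν k j).place j) := by
  cases h with
  | pre =>
    by_cases hs : ν j = G.start
    · simp only [wordArena, numVerdict, wordVerdict, Option.map_none, if_pos hs]
      exact numRel_node_place j (by simp) (by simp)
    · simp only [wordArena, numVerdict, wordVerdict, Option.map_none, if_neg hs]
      exact .sink _
  | @node k ho =>
    by_cases hE : (ν k, ν j) ∈ G.E
    · simp only [wordArena, numVerdict, wordVerdict, Option.map_some, if_pos hE, if_pos ho]
      exact numRel_node_place j (by simp) (by simp)
    · simp only [wordArena, numVerdict, wordVerdict, Option.map_some, if_neg hE, if_pos ho]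
      simp only [ho, not_true_eq_false, decide_false]
      exact .sink _

theorem numRel_next_of_notMem_own {k : ℕ} (ho : ν k ∉ G.Own) (d : List Bool) (j : ℕ) :
    NumRel G ν ((wordArena G).next (.node (ν k)) d (ν j))
      ((numVerdict G ν (some k) j).place j) := by
  by_cases hE : (ν k, ν j) ∈ G.E
  · simp only [wordArena, numVerdict, wordVerdict, Option.map_some, if_pos hE, if_neg ho]
    exact numRel_node_place j (by simp) (by simp)
  · simp only [wordArena, numVerdict, wordVerdict, Option.map_some, if_neg hE, if_neg ho]
    simp only [ho, not_false_eq_true, decide_true]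
    exact .sink _

/-- If player 0 can force in the word game to reach positions from which she can force `T` in the
number game, then she can do so in the number game, too. -/
theorem NumRel.exists_force (hν : Function.Surjective ν) {T : NumNode → Prop} {v : WordNode}
    {x : NumNode} (h : NumRel G ν v x) {d : List Bool}
    (hd : ∀ e x', NumRel G ν ((wordArena G).next v d e) x' →
      (numArena (numVerdict G ν)).Force T x') :
    ∃ d', ∀ e', (numArena (numVerdict G ν)).Force T ((numArena (numVerdict G ν)).next x d' e') := by
  have hpick : ∀ {v k} f, Picks G ν v k →
      (∀ e x', NumRel G ν ((wordArena G).next v d e) x' →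
        (numArena (numVerdict G ν)).Force T x') → ∃ d', ∀ e',
      (numArena (numVerdict G ν)).Force T
        ((numArena (numVerdict G ν)).next (.pick f k 0) d' e') := by
    intro v k f hv hd
    obtain ⟨j, rfl⟩ := hν d
    -- Here n is the number of increments that are still missing before the number j of the word d
    -- is confirmed.
    have key : ∀ n, n ≤ j → ∀ f, ∃ d', ∀ e', (numArena (numVerdict G ν)).Force T
        ((numArena (numVerdict G ν)).next (.pick f k (j - n)) d' e') := by
      intro n
      induction n with
      | zero => exact fun _ f => ⟨false, fun e' => hd [] _ (hv.numRel_next j [])⟩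
      | succ n ih =>
        intro hn f
        obtain ⟨d', hd'⟩ := ih (by omega) false
        refine ⟨true, fun e' => .step d' ?_⟩
        rw [show j - n = j - (n + 1) + 1 by omega] at hd'
        exact hd'
    simpa using key j le_rfl f
  cases h with
  | pre => exact hpick _ .pre hd
  | pick ho hf => exact hpick _ (.node ho) hd
  | spick ho hf =>
    exact ⟨true, fun e' => hd (ν e') _ (numRel_next_of_notMem_own ho d e')⟩
  | sink b => exact ⟨true, fun e' => hd [] _ (.sink b)⟩

theorem win_numArena_of_win (hν : Function.Surjective ν) {v : WordNode} {x : NumNode}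
    (h : NumRel G ν v x) (hv : (wordArena G).Win v) : (numArena (numVerdict G ν)).Win x := by
  have key : ∀ v, (wordArena G).Force (fun w => (wordArena G).fin w ∧ (wordArena G).Win w) v →
      ∀ x, NumRel G ν v x → (numArena (numVerdict G ν)).Force (fun y =>
        (numArena (numVerdict G ν)).fin y ∧ ∃ w, (wordArena G).Win w ∧ NumRel G ν w y) x := by
    intro v hv
    induction hv with
    | done hv => exact fun x hx => .done ⟨hx.fin.1 hv.1, _, hv.2, hx⟩
    | step d _ ih =>
      intro x hx
      obtain ⟨d', hd'⟩ := hx.exists_force hν ih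
      exact .step d' hd'
  refine ⟨fun y => ∃ w, (wordArena G).Win w ∧ NumRel G ν w y, ⟨v, hv, h⟩, ?_⟩
  rintro y ⟨w, hw, hy⟩
  obtain ⟨d, hd⟩ := hw.unfold
  exact hy.exists_force hν fun e => key _ (hd e)

/-- While player 0 is counting, the flag is false, so a forced final visit cannot end there. She
must stop at some j, and ν j is her choice in the word game. -/
theorem win_of_win_numArena (hν : Function.Surjective ν) {v : WordNode} {x : NumNode}
    (h : NumRel G ν v x) (hx : (numArena (numVerdict G ν)).Win x) : (wordArena G).Win v := by
  set X : WordNode → Prop := fun w => ∃ y, (numArena (numVerdict G ν)).Win y ∧ NumRel G ν w y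
  set T : WordNode → Prop := fun w => (wordArena G).fin w ∧ X w with hT
  have hmove : ∀ {v x d'}, NumRel G ν v x →
      (∀ e', (∀ w, NumRel G ν w ((numArena (numVerdict G ν)).next x d' e') →
        (wordArena G).Force T w) ∧
        ∀ k j w, (numArena (numVerdict G ν)).next x d' e' = .pick false k j → 0 < j →
          Picks G ν w k → ∃ d, ∀ e, (wordArena G).Force T ((wordArena G).next w d e)) →
      ∃ d, ∀ e, (wordArena G).Force T ((wordArena G).next v d e) := by
    intro v x d' h hd
    have hpick : ∀ {v k f}, Picks G ν v k → x = .pick f k 0 →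
        ∃ d, ∀ e, (wordArena G).Force T ((wordArena G).next v d e) := by
      rintro v k f hv rfl
      cases d' with
      | true => exact (hd 0).2 k 1 v rfl one_pos hv
      | false => exact ⟨ν 0, fun e => (hd 0).1 _ (hv.numRel_next 0 e)⟩
    cases h with
    | pre => exact hpick .pre rfl
    | pick ho hf => exact hpick (.node ho) rfl
    | spick ho hf =>
      refine ⟨[], fun e => ?_⟩
      obtain ⟨j, rfl⟩ := hν e
      exact (hd j).1 _ (numRel_next_of_notMem_own ho [] j)
    | sink b => exact ⟨[], fun e => (hd 0).1 _ (.sink b)⟩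
  -- The first clause concerns positions that represent a node, the second one positions reached in
  -- the middle of counting, where a word is still to be extracted.
  have key : ∀ x, (numArena (numVerdict G ν)).Force (fun y =>
      (numArena (numVerdict G ν)).fin y ∧ (numArena (numVerdict G ν)).Win y) x →
      (∀ w, NumRel G ν w x → (wordArena G).Force T w) ∧
        ∀ k j w, x = .pick false k j → 0 < j → Picks G ν w k →
          ∃ d, ∀ e, (wordArena G).Force T ((wordArena G).next w d e) := by
    intro x hx
    induction hx with
    | @done x hx =>
      refine ⟨fun w hw => .done ⟨hw.fin.2 hx.1, x, hx.2, hw⟩, ?_⟩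
      rintro k j w rfl
      exact (Bool.false_ne_true hx.1).elim
    | @step x d' _ ih =>
      refine ⟨fun w hw => ?_, ?_⟩
      · obtain ⟨d, hd⟩ := hmove hw ih
        exact .step d hd
      · rintro k j w rfl hj hw
        cases d' with
        | true => exact (ih 0).2 k (j + 1) w rfl (Nat.succ_pos j) hw
        | false => exact ⟨ν j, fun e => (ih 0).1 _ (hw.numRel_next j e)⟩
  refine ⟨X, ⟨x, hx, h⟩, ?_⟩
  rintro w ⟨y, hy, hw⟩
  obtain ⟨d', hd'⟩ := hy.unfold
  exact hmove hw fun e' => key _ (hd' e')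

theorem win_numArena_iff_player0Wins (hν : Function.Surjective ν) :
    (numArena (numVerdict G ν)).Win (.pick false none 0) ↔ G.Player0Wins := by
  rw [← win_pre_iff_player0Wins]
  exact ⟨win_of_win_numArena hν .pre, win_numArena_of_win hν .pre⟩

end MultiBuffer

/-! ### Stack games and queue games -/

namespace MultiBuffer

/-- The word `a ^ e` if `p` holds, otherwise the empty word. -/
def pumped {Γ : Type} (p : Bool) (a : Γ) (e : ℕ) : List Γ := if p then List.replicate e a else []

/-- A game with finite control and several stacks. In the state `q`, the top symbol of the stack
`key q` is replaced by a word. If the Boolean component of `act` is set, then the antagonist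
prepends a power of `pump`. -/
structure StackGame (Q K Γ : Type) where
  key : Q → K
  act : Q → Option Γ → Bool → Q × Bool × List Γ
  pump : Γ
  fin : Q → Prop

/-- The arena of a stack game. -/
def StackGame.arena {Q K Γ : Type} [DecidableEq K] (G : StackGame Q K Γ) :
    Arena (Q × (K → List Γ)) Bool ℕ where
  next v d e :=
    let r := G.act v.1 (v.2 (G.key v.1)).head? d
    (r.1, Function.update v.2 (G.key v.1)
      (pumped r.2.1 G.pump e ++ r.2.2 ++ (v.2 (G.key v.1)).tail))
  fin v := G.fin v.1

/-- A game with finite control and a queue. In each move, the first letter `x` of the queue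
is removed, and a word is appended. If the Boolean component of `δ` is set, then this word is
preceded by a power of `pump` chosen by the antagonist. -/
structure QueueGame (S : Type) (m : ℕ) where
  δ : S → Fin m → Bool → S × Bool × List (Fin m)
  pump : Fin m
  fin : S → Prop

/-- The arena of a queue game. -/
def QueueGame.arena {S : Type} {m : ℕ} (G : QueueGame S m) :
    Arena (S × List (Fin m)) Bool ℕ where
  next
    | (s, []), _, _ => (s, [])
    | (s, x :: w), d, e =>
      ((G.δ s x d).1, w ++ (pumped (G.δ s x d).2.1 G.pump e ++ (G.δ s x d).2.2))
  fin v := G.fin v.1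

/-- Control states of the queue game that implements a stack game: searching the bottom marker
in front of the current stack, and looking at its top symbol. -/
inductive QueueState (Q : Type)
  | seek (q : Q)
  | look (q : Q)

variable {Q K Γ : Type} {m : ℕ}

/-- The queue contains the stacks, each preceded by its marker, up to rotation. -/
def StackGame.toQueueGame (G : StackGame Q K Γ) (en : K ⊕ Γ ≃ Fin m) :
    QueueGame (QueueState Q) m where
  δ
    | .seek q, x, _ => (if x = en (.inl (G.key q)) then .look q else .seek q, false, [x])
    | .look q, x, d =>
      match en.symm x with
      | .inr a =>
        (.seek (G.act q (some a) d).1, (G.act q (some a) d).2.1,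
          (G.act q (some a) d).2.2.map fun b => en (.inr b))
      | .inl _ =>
        (.seek (G.act q none d).1, (G.act q none d).2.1,
          (G.act q none d).2.2.map (fun b => en (.inr b)) ++ [x])
  pump := en (.inr G.pump)
  fin
    | .seek _ => False
    | .look q => G.fin q

/-- The letters of a stack. -/
def stackWord (en : K ⊕ Γ ≃ Fin m) (l : List Γ) : List (Fin m) := l.map fun b => en (.inr b)

/-- The stacks with keys in `ks`, each preceded by its marker. -/
def blocks (en : K ⊕ Γ ≃ Fin m) (S : K → List Γ) (ks : List K) : List (Fin m) :=
  ks.flatMap fun j => en (.inl j) :: stackWord en (S j)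

variable {en : K ⊕ Γ ≃ Fin m}

theorem inl_notMem_stackWord (k : K) (l : List Γ) : en (.inl k) ∉ stackWord en l := by
  simp [stackWord]

theorem inl_notMem_blocks {k : K} {S : K → List Γ} {ks : List K} (h : k ∉ ks) :
    en (.inl k) ∉ blocks en S ks := by
  simp only [blocks, List.mem_flatMap, List.mem_cons, EmbeddingLike.apply_eq_iff_eq,
    Sum.inl.injEq, not_exists, not_and, not_or]
  exact fun j hj => ⟨fun e => h (e ▸ hj), inl_notMem_stackWord _ _⟩

theorem blocks_append (S : K → List Γ) (ks ks' : List K) :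
    blocks en S (ks ++ ks') = blocks en S ks ++ blocks en S ks' := List.flatMap_append

theorem blocks_cons (S : K → List Γ) (k : K) (ks : List K) :
    blocks en S (k :: ks) = en (.inl k) :: (stackWord en (S k) ++ blocks en S ks) := rfl

theorem blocks_congr {S S' : K → List Γ} {ks : List K} (h : ∀ k ∈ ks, S k = S' k) :
    blocks en S ks = blocks en S' ks := by
  induction ks with
  | nil => rfl
  | cons k ks ih =>
    rw [blocks_cons, blocks_cons, h k (by simp), ih fun j hj => h j (by simp [hj])]

/-- A queue game position that represents a stack game position. -/
def StackRel (G : StackGame Q K Γ) (en : K ⊕ Γ ≃ Fin m) (v : Q × (K → List Γ))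
    (w : QueueState Q × List (Fin m)) : Prop :=
  ∃ ks, (G.key v.1 :: ks).Nodup ∧ (∀ j, j ∈ G.key v.1 :: ks) ∧
    w = (.look v.1, stackWord en (v.2 (G.key v.1)) ++ (blocks en v.2 ks ++ [en (.inl (G.key v.1))]))

theorem run_seek (G : StackGame Q K Γ) (q : Q) (u t : List (Fin m))
    (hu : en (.inl (G.key q)) ∉ u) :
    (G.toQueueGame en).arena.Run (.seek q, u ++ en (.inl (G.key q)) :: t)
      (.look q, t ++ (u ++ [en (.inl (G.key q))])) := by
  induction u generalizing t with
  | nil =>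
    refine .single id fun d e => ?_
    simp [QueueGame.arena, StackGame.toQueueGame, pumped]
  | cons x u ih =>
    rw [List.mem_cons, not_or] at hu
    refine .step id (v' := (.seek q, u ++ en (.inl (G.key q)) :: (t ++ [x]))) (fun d e => ?_) ?_
    · simp [QueueGame.arena, StackGame.toQueueGame, pumped, Ne.symm hu.1]
    · simpa using ih (t ++ [x]) hu.2

/-- After a move, stack j may be cut in two: the unread part A is in front of the queue, and the new
top B is at the rear, behind the marker of j. Rotation of A to the rear restores B ++ A. The sought
marker is either that of j or lies in one of the blocks of M. -/
theorem exists_run_seek (G : StackGame Q K Γ) (q : Q) {S : K → List Γ} {j : K} {M : List K}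
    {A B : List (Fin m)} (hS : stackWord en (S j) = B ++ A) (hnd : (j :: M).Nodup)
    (hall : ∀ i, i ∈ j :: M) :
    ∃ w, (G.toQueueGame en).arena.Run (.seek q, A ++ (blocks en S M ++ en (.inl j) :: B)) w ∧
      StackRel G en (q, S) w := by
  have hA : ∀ k : K, en (.inl k) ∉ A := fun k hk =>
    inl_notMem_stackWord k (S j) (by rw [hS]; exact List.mem_append_right _ hk)
  have hk := hall (G.key q)
  rcases List.mem_cons.1 hk with hkj | hk
  · refine ⟨_, ?_, M, hkj ▸ hnd, hkj ▸ hall, rfl⟩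
    have := run_seek (en := en) G q (A ++ blocks en S M) B (by
      rw [hkj, List.mem_append, not_or]
      exact ⟨hA j, inl_notMem_blocks (List.nodup_cons.1 hnd).1⟩)
    simp only [hkj, hS] at this ⊢
    simpa using this
  · obtain ⟨M₁, M₂, rfl⟩ := List.append_of_mem hk
    have hp : (G.key q :: (M₂ ++ j :: M₁)).Perm (j :: (M₁ ++ G.key q :: M₂)) := by
      refine List.Perm.trans ?_ (List.perm_append_comm (l₁ := G.key q :: M₂) (l₂ := j :: M₁))
      exact List.Perm.refl _
    refine ⟨_, ?_, M₂ ++ j :: M₁, hp.nodup_iff.2 hnd, fun i => hp.mem_iff.2 (hall i), rfl⟩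
    have := run_seek (en := en) G q (A ++ blocks en S M₁)
      (stackWord en (S (G.key q)) ++ (blocks en S M₂ ++ en (.inl j) :: B)) (by
        rw [List.mem_append, not_or]
        refine ⟨hA _, inl_notMem_blocks fun h => ?_⟩
        have := (hp.nodup_iff.2 hnd)
        rw [List.nodup_cons] at this
        exact this.1 (by simp [h]))
    simpa [blocks_append, blocks_cons, hS] using this

/-- The marker of the current stack is at the rear, so an appended word becomes the new top of this
stack. If the stack is empty, the removed letter is the marker of the next stack j and is put back
behind the word; otherwise it is the top symbol, and the tail still has to be rotated. -/
theorem stackRel_step [DecidableEq K] [Nontrivial K] (G : StackGame Q K Γ) {v : Q × (K → List Γ)}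
    {v' : QueueState Q × List (Fin m)} (h : StackRel G en v v') (d : Bool) (e : ℕ) :
    ∃ w', (G.toQueueGame en).arena.Run ((G.toQueueGame en).arena.next v' d e) w' ∧
      StackRel G en (G.arena.next v d e) w' := by
  obtain ⟨q, S⟩ := v
  obtain ⟨ks, hnd, hall, rfl⟩ := h
  set k := G.key q with hkdef
  have hmap : ∀ (p : Bool) (l : List Γ), stackWord en (pumped p G.pump e ++ l) =
      pumped p (en (.inr G.pump)) e ++ stackWord en l := by
    intro p l
    cases p <;> simp [pumped, stackWord]
  have hupd : ∀ (l : List Γ) (js : List K), k ∉ js →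
      blocks en (Function.update S k l) js = blocks en S js := fun l js hjs =>
    blocks_congr fun i hi => Function.update_of_ne (by rintro rfl; exact hjs hi) _ _
  have hks : k ∉ ks := (List.nodup_cons.1 hnd).1
  rcases hSk : S k with _ | ⟨a, tail⟩
  · have hne : ks ≠ [] := by
      rintro rfl
      obtain ⟨j, hj⟩ := exists_ne k
      exact hj (by simpa using hall j)
    obtain ⟨j, ks, rfl⟩ := List.exists_cons_of_ne_nil hne
    have hjk : j ≠ k := fun h => hks (by simp [h])
    have hkks : k ∉ ks := fun h => hks (by simp [h])
    set r := G.act q none d with hr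
    set S' := Function.update S k (pumped r.2.1 G.pump e ++ r.2.2) with hS'
    have hp : (j :: (ks ++ [k])).Perm (k :: j :: ks) :=
      (List.perm_append_comm (l₁ := j :: ks) (l₂ := [k]))
    obtain ⟨w, hw, hrel⟩ := exists_run_seek (en := en) G r.1 (S := S') (j := j) (M := ks ++ [k])
      (A := stackWord en (S' j)) (B := []) rfl (hp.nodup_iff.2 hnd)
      (fun i => hp.mem_iff.2 (hall i))
    have e1 : (G.toQueueGame en).arena.next (.look q, stackWord en (S k) ++
        (blocks en S (j :: ks) ++ [en (.inl k)])) d e = (.seek r.1, stackWord en (S' j) ++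
        (blocks en S' (ks ++ [k]) ++ [en (.inl j)])) := by
      rw [blocks_append, hupd _ _ hkks, blocks_cons S' k, hS', Function.update_self, hmap,
        Function.update_of_ne hjk, hSk]
      simp [QueueGame.arena, StackGame.toQueueGame, ← hr, stackWord, blocks]
    have e2 : G.arena.next (q, S) d e = (r.1, S') := by
      simp [StackGame.arena, ← hkdef, hSk, ← hr, hS']
    rw [e1, e2]
    exact ⟨w, hw, hrel⟩
  · set r := G.act q (some a) d with hr
    set S' := Function.update S k (pumped r.2.1 G.pump e ++ r.2.2 ++ tail) with hS'
    obtain ⟨w, hw, hrel⟩ := exists_run_seek (en := en) G r.1 (S := S') (j := k) (M := ks)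
      (A := stackWord en tail) (B := stackWord en (pumped r.2.1 G.pump e ++ r.2.2))
      (by simp [hS', stackWord]) hnd hall
    have e1 : (G.toQueueGame en).arena.next (.look q, stackWord en (S k) ++
        (blocks en S ks ++ [en (.inl k)])) d e = (.seek r.1, stackWord en tail ++
        (blocks en S' ks ++ en (.inl k) :: stackWord en (pumped r.2.1 G.pump e ++ r.2.2))) := by
      rw [hupd _ _ hks, hSk, hmap]
      simp [QueueGame.arena, StackGame.toQueueGame, ← hr, stackWord]
    have e2 : G.arena.next (q, S) d e = (r.1, S') := by
      simp [StackGame.arena, ← hkdef, hSk, ← hr, hS']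
    rw [e1, e2]
    exact ⟨w, hw, hrel⟩

theorem win_toQueueGame_iff [DecidableEq K] [Nontrivial K] (G : StackGame Q K Γ) (q : Q) {S : K → List Γ} {j : K}
    {M : List K} (hS : S j = []) (hnd : (j :: M).Nodup) (hall : ∀ i, i ∈ j :: M) :
    (G.toQueueGame en).arena.Win (.seek q, blocks en S M ++ [en (.inl j)]) ↔ G.arena.Win (q, S) := by
  obtain ⟨w, hw, hrel⟩ := exists_run_seek (en := en) G q (S := S) (j := j) (M := M) (A := [])
    (B := []) (by simp [hS, stackWord]) hnd hall
  refine Iff.trans hw.win_iff (Arena.win_iff_of_simulation (StackRel G en) ?_ ?_ hrel).symm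
  · rintro v _ ⟨ks, -, -, rfl⟩
    exact Iff.rfl
  · exact fun v v' h d e => stackRel_step G h d e

end MultiBuffer

/-! ### The multi-buffer game that implements a queue game -/

namespace MultiBuffer

/-! ### Determinism of rounds, and strategies given by a rule for each configuration. -/

section Strategies

variable {α P Q : Type} [Finite α] [Finite P] [Finite Q] {k : ℕ}
  {σ : TraceAlphabet α k} {κ : Fin k → ℕ∞} {A : NBA α P} {B : NBA α Q}

theorem NBA.IsPath.unique {q : Q} {u : List (α × Q)} {q₁ q₂ : Q} (h₁ : B.IsPath q u q₁)
    (h₂ : B.IsPath q u q₂) : q₁ = q₂ := by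
  induction u generalizing q with
  | nil => exact (Eq.trans h₁ (Eq.symm h₂))
  | cons z u ih => exact ih h₁.2 h₂.2

theorem NBA.IsPath.exists_mem {q : Q} {u : List (α × Q)} {q' : Q} (h : B.IsPath q u q')
    (hu : u ≠ []) : ∃ z ∈ u, z.2 = q' := by
  induction u generalizing q with
  | nil => exact (hu rfl).elim
  | cons z u ih =>
    rcases u with _ | ⟨z', u⟩
    · exact ⟨z, by simp, (Eq.symm h.2)⟩
    · obtain ⟨y, hy, e⟩ := ih h.2 (List.cons_ne_nil _ _)
      exact ⟨y, List.mem_cons_of_mem _ hy, e⟩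

/-- Spoiler's move and the run `u` determine the states, and the remaining buffers result from
cancelling a common prefix. -/
theorem Round.unique {c : Config α P Q k} {m : α × P} {u : List (α × Q)} {c₁ c₂ : Config α P Q k}
    (h₁ : Round σ κ A B c m u c₁) (h₂ : Round σ κ A B c m u c₂) : c₁ = c₂ := by
  obtain ⟨p₁, b₁, q₁⟩ := c₁
  obtain ⟨p₂, b₂, q₂⟩ := c₂
  obtain ⟨-, e₁, hp₁, hb₁⟩ := h₁
  obtain ⟨-, e₂, hp₂, hb₂⟩ := h₂
  have hp : p₁ = p₂ := e₁.trans e₂.symm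
  have hq : q₁ = q₂ := hp₁.unique hp₂
  have hb : b₁ = b₂ := funext fun i =>
    List.append_cancel_left ((hb₁ i).1.symm.trans (hb₂ i).1)
  rw [hp, hq, hb]

theorem PlayUpTo.mono {θ : List (α × P) → List (α × Q)} {s : ℕ → α × P} {c : ℕ → Config α P Q k}
    {m n : ℕ} (h : PlayUpTo σ κ A B θ s c n) (hmn : m ≤ n) : PlayUpTo σ κ A B θ s c m :=
  ⟨h.1, fun i hi => h.2 i (hi.trans_le hmn)⟩

theorem PlayUpTo.congr {θ : List (α × P) → List (α × Q)} {s s' : ℕ → α × P}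
    {c c' : ℕ → Config α P Q k} {n : ℕ} (h : PlayUpTo σ κ A B θ s c n) (hs : ∀ j < n, s' j = s j)
    (hc : ∀ j ≤ n, c' j = c j) : PlayUpTo σ κ A B θ s' c' n := by
  refine ⟨(hc 0 (Nat.zero_le _)).trans h.1, fun i hi => ?_⟩
  rw [hs i hi, hc i hi.le, hc (i + 1) hi, hist_congr fun j hj => hs j (hj.trans_lt hi)]
  exact h.2 i hi

/-- A rule for answering in each configuration yields a strategy. -/
theorem exists_strategy (Inv : Config α P Q k → Prop)
    (Post : Config α P Q k → α × P → Config α P Q k → Prop)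
    (h₀ : Inv ⟨A.start, fun _ => [], B.start⟩)
    (h : ∀ c m, Inv c → m.2 ∈ A.δ c.p m.1 →
      ∃ u c', Round σ κ A B c m u c' ∧ Inv c' ∧ Post c m c') :
    ∃ θ : List (α × P) → List (α × Q),
      (∀ s c n, PlayUpTo σ κ A B θ s c n → (s n).2 ∈ A.δ (c n).p (s n).1 →
        ∃ c', Round σ κ A B (c n) (s n) (θ (hist s n)) c') ∧
      ∀ s c n, PlayUpTo σ κ A B θ s c n →
        Inv (c n) ∧ ∀ j < n, Post (c j) (s j) (c (j + 1)) := by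
  classical
  let ans : Config α P Q k → α × P → List (α × Q) × Config α P Q k := fun c m =>
    if hcm : Inv c ∧ m.2 ∈ A.δ c.p m.1 then
      ((h c m hcm.1 hcm.2).choose, (h c m hcm.1 hcm.2).choose_spec.choose)
    else ([], c)
  have hans : ∀ c m, Inv c → m.2 ∈ A.δ c.p m.1 →
      Round σ κ A B c m (ans c m).1 (ans c m).2 ∧ Inv (ans c m).2 ∧ Post c m (ans c m).2 := by
    intro c m h1 h2
    simp only [ans, dif_pos (And.intro h1 h2)]
    exact (h c m h1 h2).choose_spec.choose_spec
  -- A strategy sees only Spoiler's moves, so the current configuration is reconstructed by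
  -- replaying its own answers.
  let conf : List (α × P) → Config α P Q k := fun l =>
    l.foldl (fun c m => (ans c m).2) ⟨A.start, fun _ => [], B.start⟩
  let θ : List (α × P) → List (α × Q) := fun l =>
    (l.getLast?.map fun m => (ans (conf l.dropLast) m).1).getD []
  have hθ : ∀ s n, θ (hist s n) = (ans (conf ((List.range n).map s)) (s n)).1 := by
    intro s n
    simp only [θ, getLast?_hist]
    simp [hist, List.range_succ]
  have hconf : ∀ s n, conf ((List.range (n + 1)).map s) =
      (ans (conf ((List.range n).map s)) (s n)).2 := by
    intro s n
    simp [conf, List.range_succ]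
  have key : ∀ s c n, PlayUpTo σ κ A B θ s c n →
      Inv (c n) ∧ c n = conf ((List.range n).map s) := by
    intro s c n hp
    induction n with
    | zero => rw [hp.1]; exact ⟨h₀, rfl⟩
    | succ n ih =>
      obtain ⟨h1, h2⟩ := ih (hp.mono (Nat.le_succ n))
      have hr := hp.2 n (Nat.lt_succ_self n)
      have ha := hans (c n) (s n) h1 hr.1
      rw [hθ, ← h2] at hr
      rw [hconf, ← h2, hr.unique ha.1]
      exact ⟨ha.2.1, rfl⟩
  refine ⟨θ, fun s c n hp hm => ?_, fun s c n hp => ⟨(key s c n hp).1, fun j hj => ?_⟩⟩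
  · obtain ⟨h1, h2⟩ := key s c n hp
    exact ⟨_, by rw [hθ, ← h2]; exact (hans _ _ h1 hm).1⟩
  · obtain ⟨h1, h2⟩ := key s c j (hp.mono hj.le)
    have hr := hp.2 j hj
    have ha := hans (c j) (s j) h1 hr.1
    rw [hθ, ← h2] at hr
    rw [hr.unique ha.1]
    exact ha.2.2

end Strategies

/-! #### The two automata -/

/-- States of Spoiler's automaton: writing the word `r`, preceded by a power of the pump letter if
`p` holds; and having announced the first letter `x` of the queue. -/
inductive SpState (S : Type) (m : ℕ)
  | push (p : Bool) (s : S) (r : List (Fin m))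
  | got (s : S) (x : Fin m)

/-- States of Duplicator's automaton. -/
inductive DupState (S : Type) (m : ℕ)
  | base (s : S)
  | got (s : S) (x : Fin m)
  | chose (s : S) (x : Fin m) (d : Bool)
  | win

/-- The letter of `Σ_2` that announces Duplicator's choice `d`. -/
def announce {m : ℕ} (d : Bool) (x : Fin m) : Option (Fin m) := if d then none else some x

variable {S : Type} {m : ℕ}

/-- The transitions of Spoiler's automaton. -/
inductive SpStep (G : QueueGame S m) : SpState S m → Letter m → SpState S m → Prop
  | push (p : Bool) (s : S) (x : Fin m) (r : List (Fin m)) :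
      SpStep G (.push p s (x :: r)) (.inl x) (.push false s r)
  | pump (s : S) (r : List (Fin m)) : SpStep G (.push true s r) (.inl G.pump) (.push true s r)
  | look (p : Bool) (s : S) (x : Fin m) : SpStep G (.push p s []) (.inr (some x)) (.got s x)
  | ann (s : S) (x : Fin m) (d : Bool) : SpStep G (.got s x) (.inr (announce d x))
      (.push (G.δ s x d).2.1 (G.δ s x d).1 (G.δ s x d).2.2)

/-- Spoiler may not pump forever. -/
def SpState.Acc : SpState S m → Prop
  | .push p _ _ => p = false
  | .got _ _ => True

/-- The transitions of Duplicator's automaton. If Spoiler makes a wrong announcement, she wins. -/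
inductive DupStep (G : QueueGame S m) : DupState S m → Letter m → DupState S m → Prop
  | read (s : S) (x : Fin m) : DupStep G (.base s) (.inl x) (.got s x)
  | look (s : S) (x : Fin m) (d : Bool) : DupStep G (.got s x) (.inr (some x)) (.chose s x d)
  | look_wrong (s : S) (x : Fin m) (y : Option (Fin m)) (h : y ≠ some x) :
      DupStep G (.got s x) (.inr y) .win
  | ann (s : S) (x : Fin m) (d : Bool) :
      DupStep G (.chose s x d) (.inr (announce d x)) (.base (G.δ s x d).1)
  | ann_wrong (s : S) (x : Fin m) (d : Bool) (y : Option (Fin m)) (h : y ≠ announce d x) :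
      DupStep G (.chose s x d) (.inr y) .win
  | win (a : Letter m) : DupStep G .win a .win

/-- Accepting states of Duplicator's automaton. -/
def DupState.Acc (G : QueueGame S m) : DupState S m → Prop
  | .base s => G.fin s
  | .win => True
  | _ => False

/-- The automaton `A` implements the transition relation `step`, its states being decoded by
`dec`. -/
structure Decodes {X P : Type} [Finite P] (A : NBA (Letter m) P) (dec : P → X)
    (step : X → Letter m → X → Prop) (acc : X → Prop) : Prop where
  sound : ∀ p a p', p' ∈ A.δ p a → step (dec p) a (dec p')
  complete : ∀ p a y, step (dec p) a y → ∃ p' ∈ A.δ p a, dec p' = y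
  acc_iff : ∀ p, p ∈ A.F ↔ acc (dec p)

/-- Finite paths of Duplicator's automaton. -/
inductive DupPath (G : QueueGame S m) :
    DupState S m → List (Letter m × DupState S m) → DupState S m → Prop
  | nil (q : DupState S m) : DupPath G q [] q
  | cons {q r q' : DupState S m} {a : Letter m} {u : List (Letter m × DupState S m)}
      (h : DupStep G q a r) (t : DupPath G r u q') : DupPath G q ((a, r) :: u) q'

/-! ### Rounds in terms of the two projections. -/

/-- The letters of `Σ_1` in a word. -/
def lefts (w : List (Letter m)) : List (Fin m) := w.filterMap Sum.getLeft?

/-- The letters of `Σ_2` in a word. -/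
def rights (w : List (Letter m)) : List (Option (Fin m)) := w.filterMap Sum.getRight?

@[simp] theorem lefts_nil : lefts ([] : List (Letter m)) = [] := rfl
@[simp] theorem lefts_inl (x : Fin m) (w : List (Letter m)) :
    lefts (.inl x :: w) = x :: lefts w := rfl
@[simp] theorem lefts_inr (y : Option (Fin m)) (w : List (Letter m)) :
    lefts (.inr y :: w) = lefts w := rfl
@[simp] theorem rights_nil : rights ([] : List (Letter m)) = [] := rfl
@[simp] theorem rights_inl (x : Fin m) (w : List (Letter m)) :
    rights (.inl x :: w) = rights w := rfl
@[simp] theorem rights_inr (y : Option (Fin m)) (w : List (Letter m)) :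
    rights (.inr y :: w) = y :: rights w := rfl

theorem lefts_append (v w : List (Letter m)) : lefts (v ++ w) = lefts v ++ lefts w :=
  List.filterMap_append

theorem rights_append (v w : List (Letter m)) : rights (v ++ w) = rights v ++ rights w :=
  List.filterMap_append

theorem proj_zero (w : List (Letter m)) : (sigma12 m).proj 0 w = (lefts w).map Sum.inl := by
  induction w with
  | nil => rfl
  | cons a w ih =>
    have : ∀ a : Letter m, a ∈ (sigma12 m).alph 0 ↔ a ∈ Set.range Sum.inl := fun a => Iff.rfl
    rw [TraceAlphabet.proj] at ih ⊢
    rcases a with x | y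
    · rw [List.filter_cons_of_pos (by simp [this]), ih]
      rfl
    · rw [List.filter_cons_of_neg (by simp [this]), ih]
      rfl

theorem proj_one (w : List (Letter m)) : (sigma12 m).proj 1 w = (rights w).map Sum.inr := by
  induction w with
  | nil => rfl
  | cons a w ih =>
    have : ∀ a : Letter m, a ∈ (sigma12 m).alph 1 ↔ a ∈ Set.range Sum.inr := fun a => Iff.rfl
    rw [TraceAlphabet.proj] at ih ⊢
    rcases a with x | y
    · rw [List.filter_cons_of_neg (by simp [this]), ih]
      rfl
    · rw [List.filter_cons_of_pos (by simp [this]), ih]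
      rfl

variable {P Q : Type} [Finite P] [Finite Q] {G : QueueGame S m} {A : NBA (Letter m) P}
  {B : NBA (Letter m) Q} {decA : P → SpState S m} {decB : Q → DupState S m}

/-- The configuration `c`, decoded. -/
structure View (decA : P → SpState S m) (decB : Q → DupState S m) (c : Config (Letter m) P Q 2)
    (p : SpState S m) (w : List (Fin m)) (q : DupState S m) : Prop where
  hp : decA c.p = p
  hw : c.buf 0 = w.map Sum.inl
  hbuf : c.buf 1 = []
  hq : decB c.q = q

theorem DupPath.exists_isPath (hB : Decodes B decB (DupStep G) (DupState.Acc G)) {q : Q}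
    {u : List (Letter m × DupState S m)} {x y : DupState S m} (h : DupPath G x u y)
    (hx : decB q = x) :
    ∃ u' q', B.IsPath q u' q' ∧ decB q' = y ∧ u'.map Prod.fst = u.map Prod.fst := by
  induction h generalizing q with
  | nil => exact ⟨[], q, rfl, hx, rfl⟩
  | @cons x r y a u h _ ih =>
    obtain ⟨r', hr', e⟩ := hB.complete q a r (hx ▸ h)
    obtain ⟨u', q', h1, h2, h3⟩ := ih e
    exact ⟨(a, r') :: u', q', ⟨hr', h1⟩, h2, by simp [h3]⟩

theorem NBA.IsPath.dupPath (hB : Decodes B decB (DupStep G) (DupState.Acc G)) {q q' : Q}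
    {u : List (Letter m × Q)} (h : B.IsPath q u q') :
    DupPath G (decB q) (u.map fun z => (z.1, decB z.2)) (decB q') := by
  induction u generalizing q with
  | nil => rw [show q' = q from h]; exact .nil _
  | cons z u ih => exact .cons (hB.sound _ _ _ h.1) (ih h.2)

theorem View.exists_round (hB : Decodes B decB (DupStep G) (DupState.Acc G))
    {c : Config (Letter m) P Q 2} {p : SpState S m} {w w' : List (Fin m)} {q y : DupState S m}
    (hc : View decA decB c p w q) {mv : Letter m × P} (hmv : mv.2 ∈ A.δ c.p mv.1)
    {u : List (Letter m × DupState S m)} (hu : DupPath G q u y)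
    (hl : w ++ lefts [mv.1] = lefts (u.map Prod.fst) ++ w')
    (hr : rights [mv.1] = rights (u.map Prod.fst)) :
    ∃ u' c', Round (sigma12 m) ![⊤, 0] A B c mv u' c' ∧ View decA decB c' (decA mv.2) w' y := by
  obtain ⟨u', q', h1, h2, h3⟩ := hu.exists_isPath hB hc.hq
  refine ⟨u', ⟨mv.2, ![w'.map Sum.inl, []], q'⟩, ⟨hmv, rfl, h1, fun i => ?_⟩, rfl, rfl, rfl, h2⟩
  fin_cases i
  · simp only [Fin.zero_eta, proj_zero, h3]
    refine ⟨?_, le_top⟩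
    rw [hc.hw, ← List.map_append, hl, List.map_append]
    rfl
  · simp only [Fin.mk_one, proj_one, h3]
    refine ⟨?_, le_rfl⟩
    rw [hc.hbuf, hr]
    simp

/-- Capacity 0 keeps the Σ_2-buffer empty after each round, so the answer contains exactly the
Σ_2-letters of Spoiler's move; the Σ_1-buffer is only subject to the queue equation. -/
theorem View.of_round (hA : Decodes A decA (SpStep G) SpState.Acc)
    (hB : Decodes B decB (DupStep G) (DupState.Acc G))
    {c c' : Config (Letter m) P Q 2} {p : SpState S m} {w : List (Fin m)} {q : DupState S m}
    (hc : View decA decB c p w q) {mv : Letter m × P} {u : List (Letter m × Q)}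
    (h : Round (sigma12 m) ![⊤, 0] A B c mv u c') :
    SpStep G p mv.1 (decA mv.2) ∧ ∃ w', View decA decB c' (decA mv.2) w' (decB c'.q) ∧
      DupPath G q (u.map fun z => (z.1, decB z.2)) (decB c'.q) ∧
      w ++ lefts [mv.1] = lefts (u.map Prod.fst) ++ w' ∧
      rights [mv.1] = rights (u.map Prod.fst) := by
  obtain ⟨h1, h2, h3, h4⟩ := h
  have h40 := (h4 0).1
  have h41 := h4 1
  rw [proj_zero, proj_zero, hc.hw, ← List.map_append] at h40
  rw [proj_one, proj_one, hc.hbuf] at h41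
  have hbuf : c'.buf 1 = [] := by
    have := h41.2
    rw [show (![⊤, 0] : Fin 2 → ℕ∞) 1 = 0 from rfl] at this
    simpa using this
  obtain ⟨v, w', e1, e2, e3⟩ := List.map_eq_append_iff.1 h40
  have e4 : v = lefts (u.map Prod.fst) := List.map_injective_iff.2 Sum.inl_injective e2
  refine ⟨hc.hp ▸ hA.sound _ _ _ h1, w', ⟨by rw [h2], e3.symm, hbuf, rfl⟩, hc.hq ▸ h3.dupPath hB,
    e4 ▸ e1, ?_⟩
  have := h41.1
  rw [hbuf] at this
  exact List.map_injective_iff.2 Sum.inr_injective (by simpa using this)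

end MultiBuffer

/-! #### Duplicator wins if the queue game is won -/

namespace MultiBuffer

variable {S : Type} {m : ℕ}

/-- The invariant of Duplicator's strategy, derived from a positional strategy `σ` that is winning
on `Y`. -/
inductive DupInv (G : QueueGame S m) (g : Fin m) (σ : S × List (Fin m) → Bool)
    (Y : S × List (Fin m) → Prop) : SpState S m → List (Fin m) → DupState S m → Prop
  | win (p : SpState S m) : DupInv G g σ Y p [] .win
  | push {b : Bool} {s : S} {r w : List (Fin m)} (hg : g ∈ w ++ r)
      (hY : ∀ e, Y (s, w ++ (pumped b G.pump e ++ r))) : DupInv G g σ Y (.push b s r) w (.base s)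
  | chose {s : S} {x : Fin m} {w : List (Fin m)} (hg : g ∈ x :: w) (hY : Y (s, x :: w)) :
      DupInv G g σ Y (.got s x) w (.chose s x (σ (s, x :: w)))

/-- How Duplicator answers to a letter. -/
inductive Resp (G : QueueGame S m) (σ : S × List (Fin m) → Bool) :
    SpState S m → List (Fin m) → DupState S m → Letter m → List (Fin m) → DupState S m → Prop
  | win (p : SpState S m) (a : Letter m) : Resp G σ p [] .win a [] .win
  | push (p : SpState S m) (s : S) (w : List (Fin m)) (x : Fin m) :
      Resp G σ p w (.base s) (.inl x) (w ++ [x]) (.base s)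
  | look (b : Bool) (s : S) (w : List (Fin m)) (x : Fin m) :
      Resp G σ (.push b s []) (x :: w) (.base s) (.inr (some x)) w (.chose s x (σ (s, x :: w)))
  | look_wrong (b : Bool) (s : S) (w : List (Fin m)) (x y : Fin m) :
      Resp G σ (.push b s []) (x :: w) (.base s) (.inr (some y)) [] .win
  | ann (s : S) (w : List (Fin m)) (x : Fin m) (d : Bool) :
      Resp G σ (.got s x) w (.chose s x d) (.inr (announce d x)) w (.base (G.δ s x d).1)
  | ann_wrong (s : S) (w : List (Fin m)) (x : Fin m) (d : Bool) (y : Option (Fin m)) :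
      Resp G σ (.got s x) w (.chose s x d) (.inr y) [] .win

variable {G : QueueGame S m} {g : Fin m} {σ : S × List (Fin m) → Bool}
  {Y : S × List (Fin m) → Prop}

/-- The path in which Duplicator, in her universal state, reads `w`. -/
def flush (w : List (Fin m)) : List (Letter m × DupState S m) := w.map fun x => (.inl x, .win)

theorem dupPath_flush (w : List (Fin m)) : DupPath G .win (flush w) .win := by
  induction w with
  | nil => exact .nil _
  | cons x w ih => exact .cons (.win _) ih

theorem lefts_flush (w : List (Fin m)) :
    lefts ((flush w : List (Letter m × DupState S m)).map Prod.fst) = w := by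
  induction w with
  | nil => rfl
  | cons x w ih => exact congrArg (x :: ·) ih

theorem rights_flush (w : List (Fin m)) :
    rights ((flush w : List (Letter m × DupState S m)).map Prod.fst) = [] := by
  induction w with
  | nil => rfl
  | cons x w ih => exact ih

theorem announce_injective (x : Fin m) : Function.Injective fun d => announce d x := by
  intro d d' h
  cases d <;> cases d' <;> simp_all [announce]

theorem SpStep.of_push {b : Bool} {s : S} {r : List (Fin m)} {a : Letter m} {p' : SpState S m}
    (h : SpStep G (.push b s r) a p') :
    (∃ x r', r = x :: r' ∧ a = .inl x ∧ p' = .push false s r') ∨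
      (b = true ∧ a = .inl G.pump ∧ p' = .push true s r) ∨
      (r = [] ∧ ∃ x, a = .inr (some x) ∧ p' = .got s x) := by
  cases h <;> simp

theorem SpStep.of_got {s : S} {x : Fin m} {a : Letter m} {p' : SpState S m}
    (h : SpStep G (.got s x) a p') :
    ∃ d, a = .inr (announce d x) ∧ p' = .push (G.δ s x d).2.1 (G.δ s x d).1 (G.δ s x d).2.2 := by
  generalize hp : SpState.got s x = p at h
  cases h <;> simp at hp
  obtain ⟨rfl, rfl⟩ := hp
  exact ⟨_, rfl, rfl⟩

theorem Resp.of_win {p : SpState S m} {w w' : List (Fin m)} {a : Letter m} {q' : DupState S m}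
    (h : Resp G σ p w .win a w' q') : w = [] ∧ w' = [] ∧ q' = .win := by
  cases h; exact ⟨rfl, rfl, rfl⟩

theorem Resp.of_base {p : SpState S m} {w w' : List (Fin m)} {s : S} {a : Letter m}
    {q' : DupState S m} (h : Resp G σ p w (.base s) a w' q') :
    (∃ x, a = .inl x ∧ w' = w ++ [x] ∧ q' = .base s) ∨
      (∃ y, a = .inr (some y) ∧
        ((w = y :: w' ∧ q' = .chose s y (σ (s, y :: w'))) ∨ (w' = [] ∧ q' = .win))) := by
  cases h <;> simp

theorem Resp.of_chose {p : SpState S m} {w w' : List (Fin m)} {s : S} {x : Fin m} {d : Bool}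
    {a : Letter m} {q' : DupState S m} (h : Resp G σ p w (.chose s x d) a w' q') :
    (a = .inr (announce d x) ∧ w' = w ∧ q' = .base (G.δ s x d).1) ∨ q' = .win := by
  generalize hq : DupState.chose s x d = q at h
  cases h <;> simp at hq
  · obtain ⟨rfl, rfl, rfl⟩ := hq
    exact Or.inl ⟨rfl, rfl, rfl⟩
  · exact Or.inr rfl

theorem DupInv.cases {p : SpState S m} {w : List (Fin m)} {q : DupState S m}
    (h : DupInv G g σ Y p w q) : q = .win ∨
      (∃ b s r, p = .push b s r ∧ q = .base s ∧ ∀ e, Y (s, w ++ (pumped b G.pump e ++ r))) ∨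
      ∃ s x, p = .got s x ∧ q = .chose s x (σ (s, x :: w)) := by
  cases h with
  | win => exact Or.inl rfl
  | push _ hY => exact Or.inr (Or.inl ⟨_, _, _, rfl, rfl, hY⟩)
  | chose => exact Or.inr (Or.inr ⟨_, _, rfl, rfl⟩)

/-- Duplicator lets Σ_1-letters accumulate until Spoiler announces one. Then she reads the first
letter and commits herself to the value of σ. After a false announcement she enters her universal
state and empties the buffer. -/
theorem DupInv.exists_resp (hg : ∀ s d, g ∈ (G.δ s g d).2.2)
    (hY : ∀ v, Y v → ∀ e, Y (G.arena.next v (σ v) e)) {p p' : SpState S m} {w : List (Fin m)}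
    {q : DupState S m} {a : Letter m} (h : DupInv G g σ Y p w q) (hp : SpStep G p a p') :
    ∃ u w' q', DupPath G q u q' ∧ w ++ lefts [a] = lefts (u.map Prod.fst) ++ w' ∧
      rights [a] = rights (u.map Prod.fst) ∧ Resp G σ p w q a w' q' ∧ DupInv G g σ Y p' w' q' := by
  cases h with
  | win =>
    exact ⟨[(a, .win)], [], .win, .cons (.win a) (.nil _), by simp, rfl, .win _ _, .win _⟩
  | @push b s r w hgw hYw =>
    cases hp with
    | push b s x r =>
      refine ⟨[], w ++ [x], .base s, .nil _, by simp, rfl, .push _ _ _ _, .push ?_ fun e => ?_⟩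
      · simpa using hgw
      -- A letter of `r` ends the pumping, so no further pump letters are to be expected.
      · have := hYw 0
        cases b <;> simpa [pumped] using this
    | pump s r =>
      refine ⟨[], w ++ [G.pump], .base s, .nil _, by simp, rfl, .push _ _ _ _, .push ?_ fun e => ?_⟩
      · rw [List.mem_append] at hgw ⊢
        rcases hgw with h | h <;> simp [h]
      -- One of the e + 1 pump letters has just been written.
      · have := hYw (e + 1)
        simpa [pumped, List.replicate_succ] using this
    | look b s y =>
      rw [List.append_nil] at hgw
      -- The letter `g` is put back whenever it is removed; it guarantees that the queue has a first
      -- letter.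
      obtain ⟨x, w, rfl⟩ := List.exists_cons_of_ne_nil (List.ne_nil_of_mem hgw)
      by_cases hxy : y = x
      · subst hxy
        have hYw' : Y (s, y :: w) := by
          have := hYw 0
          cases b <;> simpa [pumped] using this
        exact ⟨[(.inl y, .got s y), (.inr (some y), .chose s y (σ (s, y :: w)))], w, _,
          .cons (.read _ _) (.cons (.look _ _ _) (.nil _)), by simp, rfl, .look _ _ _ _,
          .chose hgw hYw'⟩
      · refine ⟨(.inl x, .got s x) :: (.inr (some y), .win) :: flush w, [], .win,
          .cons (.read _ _) (.cons (.look_wrong _ _ _ (by simpa using hxy)) (dupPath_flush w)),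
          ?_, ?_, .look_wrong _ _ _ _ _, .win _⟩
        · simp [lefts_flush]
        · simp [rights_flush]
  | @chose s x w hgw hYw =>
    cases hp with
    | ann s x d =>
      by_cases hd : d = σ (s, x :: w)
      · subst hd
        refine ⟨[(.inr (announce _ x), .base (G.δ s x _).1)], w, _, .cons (.ann _ _ _) (.nil _),
          by simp, rfl, .ann _ _ _ _, .push ?_ fun e => hY _ hYw e⟩
        rw [List.mem_append]
        rcases List.mem_cons.1 hgw with rfl | h
        · exact Or.inr (hg _ _)
        · exact Or.inl h
      · refine ⟨(.inr (announce d x), .win) :: flush w, [], .win,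
          .cons (.ann_wrong _ _ _ _ ?_) (dupPath_flush w), ?_, ?_, .ann_wrong _ _ _ _ _, .win _⟩
        · intro h
          exact hd (announce_injective x h)
        · simp [lefts_flush]
        · simp [rights_flush]

/-! ### Infinite plays in which Spoiler's run is accepting. -/

section Sequences

variable {p : ℕ → SpState S m} {w : ℕ → List (Fin m)} {q : ℕ → DupState S m} {a : ℕ → Letter m}

theorem eq_win_of_le (hresp : ∀ n, Resp G σ (p n) (w n) (q n) (a n) (w (n + 1)) (q (n + 1))) {n : ℕ}
    (h : q n = .win) {n' : ℕ} (hn : n ≤ n') : q n' = .win := by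
  induction n', hn using Nat.le_induction with
  | base => exact h
  | succ n' _ ih =>
    have := hresp n'
    rw [ih] at this
    exact this.of_win.2.2

/-- Pumping states are not accepting, so an accepting run leaves them after finitely many rounds.
Every other push shortens `r`, after which only an announcement is possible. -/
theorem exists_look (hstep : ∀ n, SpStep G (p n) (a n) (p (n + 1)))
    (hresp : ∀ n, Resp G σ (p n) (w n) (q n) (a n) (w (n + 1)) (q (n + 1)))
    (hacc : ∀ N, ∃ n ≥ N, (p n).Acc) {n : ℕ} {b : Bool} {s : S} {r : List (Fin m)}
    (hp : p n = .push b s r) (hq : q n = .base s) :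
    ∃ n' ≥ n, ∃ e b', p n' = .push b' s [] ∧ w n' = w n ++ (pumped b G.pump e ++ r) ∧
      q n' = .base s ∧ ∃ x, a n' = .inr (some x) := by
  have hbase : ∀ n x, q n = .base s → a n = .inl x → w (n + 1) = w n ++ [x] ∧ q (n + 1) = .base s := by
    intro n x hq ha
    have h2 := hresp n
    rw [hq, ha] at h2
    obtain ⟨y, h, h'⟩ | ⟨y, h, -⟩ := h2.of_base
    · cases h; exact h'
    · cases h
  have push_false : ∀ (r : List (Fin m)) (n : ℕ), p n = .push false s r → q n = .base s →
      ∃ n' ≥ n, ∃ b', p n' = .push b' s [] ∧ w n' = w n ++ r ∧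
        q n' = .base s ∧ ∃ x, a n' = .inr (some x) := by
    intro r
    induction r with
    | nil =>
      intro n hp hq
      have h1 := hstep n
      rw [hp] at h1
      obtain ⟨x, r', h, -⟩ | ⟨h, -⟩ | ⟨-, x, h, -⟩ := h1.of_push
      · cases h
      · cases h
      · exact ⟨n, le_rfl, false, hp, by simp, hq, x, h⟩
    | cons x r ih =>
      intro n hp hq
      have h1 := hstep n
      rw [hp] at h1
      obtain ⟨y, r', h, ha, hp'⟩ | ⟨h, -⟩ | ⟨h, -⟩ := h1.of_push
      · cases h
        obtain ⟨hw', hq'⟩ := hbase n x hq ha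
        obtain ⟨n', hn, b', e1, e2, e3⟩ := ih (n + 1) hp' hq'
        exact ⟨n', by omega, b', e1, by rw [e2, hw']; simp, e3⟩
      · cases h
      · cases h
  cases b with
  | false =>
    obtain ⟨n', hn, b', e1, e2, e3⟩ := push_false r n hp hq
    exact ⟨n', hn, 0, b', e1, e2, e3⟩
  | true =>
    obtain ⟨t, ht, htacc⟩ := hacc n
    obtain ⟨l, rfl⟩ := Nat.exists_eq_add_of_le ht
    -- The number of rounds until an accepting state of Spoiler bounds the remaining pumping.
    induction l generalizing n with
    | zero => rw [Nat.add_zero, hp] at htacc; exact (Bool.false_ne_true htacc.symm).elim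
    | succ l ih =>
      have h1 := hstep n
      rw [hp] at h1
      obtain ⟨x, r', rfl, ha, hp'⟩ | ⟨-, ha, hp'⟩ | ⟨rfl, x, ha, -⟩ := h1.of_push
      · obtain ⟨hw', hq'⟩ := hbase n x hq ha
        obtain ⟨n', hn, b', e1, e2, e3⟩ := push_false r' (n + 1) hp' hq'
        exact ⟨n', by omega, 0, b', e1, by rw [e2, hw']; simp [pumped], e3⟩
      · obtain ⟨hw', hq'⟩ := hbase n _ hq ha
        obtain ⟨n', hn, e, b', e1, e2, e3⟩ := ih hq' hp' (by omega)
          (by rwa [show n + 1 + l = n + (l + 1) by omega])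
        refine ⟨n', by omega, e + 1, b', e1, ?_, e3⟩
        rw [e2, hw']
        simp [pumped, List.replicate_succ]
      · exact ⟨n, le_rfl, 0, true, hp, by simp [pumped], hq, x, ha⟩

/-- In round `n`, Spoiler announces the first letter of the queue in the position `v`. -/
def Looks (p : ℕ → SpState S m) (w : ℕ → List (Fin m)) (q : ℕ → DupState S m) (a : ℕ → Letter m)
    (n : ℕ) (v : S × List (Fin m)) : Prop :=
  (∃ b, p n = .push b v.1 []) ∧ w n = v.2 ∧ q n = .base v.1 ∧ ∃ y, a n = .inr (some y)

/-- A move of the queue game consists of the announcement of the first letter in round n, that of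
the choice in round n + 1, and the writing of the new word. The control state does not depend on the
pumping, so its description may use 0 pump letters. -/
theorem Looks.next (hstep : ∀ n, SpStep G (p n) (a n) (p (n + 1)))
    (hresp : ∀ n, Resp G σ (p n) (w n) (q n) (a n) (w (n + 1)) (q (n + 1)))
    (hacc : ∀ N, ∃ n ≥ N, (p n).Acc) {n : ℕ} {v : S × List (Fin m)} (h : Looks p w q a n v) :
    (w n).length = (w (n + 1)).length + 1 ∧
      (q (n + 2) = .base (G.arena.next v (σ v) 0).1 ∧ (∃ y, a (n + 1) = .inr y) ∧
        ∃ e, ∃ n' > n, Looks p w q a n' (G.arena.next v (σ v) e)) ∨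
    q (n + 2) = .win := by
  obtain ⟨⟨b, hp⟩, hw, hq, y, ha⟩ := h
  obtain ⟨s, v⟩ := v
  simp only at hp hw hq
  have h1 := hstep n
  have h2 := hresp n
  rw [hp, ha] at h1
  rw [hp, hw, hq, ha] at h2
  obtain ⟨x, h, -⟩ | ⟨z, hz, ⟨hv, hq'⟩ | ⟨-, hq'⟩⟩ := h2.of_base
  · cases h
  · cases hz
    obtain ⟨_, _, _, h, _⟩ | ⟨-, h, -⟩ | ⟨-, z, hz, hp'⟩ := h1.of_push
    · cases h
    · cases h
    cases hz
    have h1 := hstep (n + 1)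
    have h2 := hresp (n + 1)
    rw [hp'] at h1
    rw [hq'] at h2
    obtain ⟨d, had, hp''⟩ := h1.of_got
    obtain ⟨had', hw'', hq''⟩ | hq'' := h2.of_chose
    · have hd : d = σ (s, y :: w (n + 1)) :=
        announce_injective y (Sum.inr_injective (had.symm.trans had'))
      subst hd
      rw [hv]
      refine Or.inl ⟨by rw [hw, hv]; rfl, hq'', ⟨_, had⟩, ?_⟩
      obtain ⟨n', hn, e, b', e1, e2, e3, e4⟩ := exists_look hstep hresp hacc hp'' hq''
      refine ⟨e, n', by omega, ⟨b', e1⟩, ?_, e3, e4⟩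
      rw [e2, hw'']
      rfl
    · exact Or.inr hq''
  · exact Or.inr (eq_win_of_le hresp hq' (by omega))

theorem exists_looks_or_win (hstep : ∀ n, SpStep G (p n) (a n) (p (n + 1)))
    (hresp : ∀ n, Resp G σ (p n) (w n) (q n) (a n) (w (n + 1)) (q (n + 1)))
    (hinv : ∀ n, DupInv G g σ Y (p n) (w n) (q n)) (hacc : ∀ N, ∃ n ≥ N, (p n).Acc) (N : ℕ) :
    (∃ n ≥ N, ∃ v, Y v ∧ Looks p w q a n v) ∨ ∃ n, q n = .win := by
  by_cases hwin : ∃ n, q n = .win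
  · exact Or.inr hwin
  refine Or.inl ?_
  have hpush : ∀ N b s r, p N = .push b s r → q N = .base s →
      ∃ n ≥ N, ∃ v, Y v ∧ Looks p w q a n v := by
    intro N b s r hp hq
    obtain ⟨n, hn, e, b', e1, e2, e3, e4⟩ := exists_look hstep hresp hacc hp hq
    refine ⟨n, hn, (s, w n), ?_, ⟨b', e1⟩, rfl, e3, e4⟩
    obtain h | ⟨b₂, s₂, r₂, hp₂, -, hY⟩ | ⟨s₂, x, -, h⟩ := (hinv N).cases
    · exact (hwin ⟨N, h⟩).elim
    · rw [hp] at hp₂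
      cases hp₂
      rw [e2]
      exact hY e
    · rw [hq] at h
      cases h
  obtain h | ⟨b, s, r, hp, hq, -⟩ | ⟨s, x, hp, hq⟩ := (hinv N).cases
  · exact (hwin ⟨N, h⟩).elim
  · exact hpush N b s r hp hq
  · have h1 := hstep N
    have h2 := hresp N
    rw [hp] at h1
    rw [hq] at h2
    obtain ⟨d, had, hp'⟩ := h1.of_got
    obtain ⟨had', -, hq'⟩ | hq' := h2.of_chose
    · have hd := announce_injective x (Sum.inr_injective (had.symm.trans had'))
      rw [← hd] at hq'
      obtain ⟨n, hn, h⟩ := hpush (N + 1) _ _ _ hp' hq'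
      exact ⟨n, by omega, h⟩
    · exact (hwin ⟨_, hq'⟩).elim

/-- Induction on `Ev` along the moves of the queue game leads to a final state, which Duplicator
enters when her choice is announced. The last clause serves to show that her run in this round is
not empty, so that the accepting state is really visited in it. -/
theorem exists_acc (hstep : ∀ n, SpStep G (p n) (a n) (p (n + 1)))
    (hresp : ∀ n, Resp G σ (p n) (w n) (q n) (a n) (w (n + 1)) (q (n + 1)))
    (hinv : ∀ n, DupInv G g σ Y (p n) (w n) (q n)) (hacc : ∀ N, ∃ n ≥ N, (p n).Acc)
    (hY : ∀ v, Y v → ∀ e, Y (G.arena.next v (σ v) e) ∧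
    G.arena.Ev σ (G.arena.next v (σ v) e)) (N : ℕ) :
    ∃ n ≥ N, (q (n + 1)).Acc G ∧ (q n = .win ∨ ∃ y, a n = .inr y) := by
  by_cases hwin : ∃ n, q n = .win
  · obtain ⟨n, hn⟩ := hwin
    exact ⟨max n N, le_max_right _ _,
      by rw [eq_win_of_le hresp hn (by omega : n ≤ max n N + 1)]; trivial,
      Or.inl (eq_win_of_le hresp hn (le_max_left _ _))⟩
  obtain ⟨n, hn, v, hv, hl⟩ :=
    (exists_looks_or_win hstep hresp hinv hacc N).resolve_right hwin
  have hfin : ∀ u e n, q (n + 1 + 1) = .base (G.arena.next u (σ u) 0).1 →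
      G.arena.fin (G.arena.next u (σ u) e) → (q (n + 1 + 1)).Acc G := by
    intro u e n h hf
    rw [h]
    obtain ⟨s, _ | ⟨x, v⟩⟩ := u <;> exact hf
  have key : ∀ u, G.arena.Ev σ u → ∀ n, Looks p w q a n u → ¬ G.arena.fin u →
      ∃ n' ≥ n, (q (n' + 1)).Acc G ∧ ∃ y, a n' = .inr y := by
    intro u hu
    induction hu with
    | done h => exact fun n _ hf => (hf h).elim
    | @step u _ ih =>
      intro n hl _
      obtain ⟨-, h1, h2, e, n', hn', h3⟩ | h := hl.next hstep hresp hacc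
      · by_cases hf : G.arena.fin (G.arena.next u (σ u) e)
        · exact ⟨n + 1, by omega, hfin u e n h1 hf, h2⟩
        · obtain ⟨n'', hn'', h4⟩ := ih e n' h3 hf
          exact ⟨n'', by omega, h4⟩
      · exact (hwin ⟨_, h⟩).elim
  obtain ⟨-, h1, h2, e, n', hn', h3⟩ | h := hl.next hstep hresp hacc
  · by_cases hf : G.arena.fin (G.arena.next v (σ v) e)
    · exact ⟨n + 1, by omega, hfin v e n h1 hf, Or.inr h2⟩
    · obtain ⟨n'', hn'', h4, h5⟩ := key _ (hY v hv e).2 n' h3 hf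
      exact ⟨n'', by omega, h4, Or.inr h5⟩
  · exact (hwin ⟨_, h⟩).elim

/-- An announcement of a first letter removes a letter from the buffer, and Spoiler adds none in
that round. Hence every buffered letter is eventually read, as required for the letter counts. -/
theorem exists_shrink (hstep : ∀ n, SpStep G (p n) (a n) (p (n + 1)))
    (hresp : ∀ n, Resp G σ (p n) (w n) (q n) (a n) (w (n + 1)) (q (n + 1)))
    (hinv : ∀ n, DupInv G g σ Y (p n) (w n) (q n)) (hacc : ∀ N, ∃ n ≥ N, (p n).Acc) (N : ℕ) :
    (∃ n ≥ N, (w n).length = (w (n + 1)).length + 1 ∧ ∃ y, a n = .inr y) ∨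
      ∃ n, q n = .win := by
  obtain ⟨n, hn, v, -, hl⟩ | h := exists_looks_or_win hstep hresp hinv hacc N
  · obtain ⟨h, -⟩ | h := hl.next hstep hresp hacc
    · obtain ⟨y, hy⟩ := hl.2.2.2
      exact Or.inl ⟨n, hn, h, _, hy⟩
    · exact Or.inr ⟨_, h⟩
  · exact Or.inr h

end Sequences

end MultiBuffer

/-! ### Acceptance and letter counts for Duplicator's strategy. -/

namespace MultiBuffer

variable {S : Type} {m : ℕ} {G : QueueGame S m}

theorem View.unique {P Q : Type} {decA : P → SpState S m} {decB : Q → DupState S m}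
    {c : Config (Letter m) P Q 2} {p p' : SpState S m} {w w' : List (Fin m)} {q q' : DupState S m}
    (h : View decA decB c p w q) (h' : View decA decB c p' w' q') : p = p' ∧ w = w' ∧ q = q' :=
  ⟨h.hp.symm.trans h'.hp, List.map_injective_iff.2 Sum.inl_injective (h.hw.symm.trans h'.hw),
    h.hq.symm.trans h'.hq⟩

theorem count_inl [BEq (Letter m)] [LawfulBEq (Letter m)] (x : Fin m) (w : List (Letter m)) :
    w.count (.inl x) = (lefts w).count x := by
  induction w with
  | nil => rfl
  | cons a w ih => rcases a with y | y <;> simp [List.count_cons, ih, beq_iff_eq]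

theorem count_inr [BEq (Letter m)] [LawfulBEq (Letter m)] (y : Option (Fin m)) (w : List (Letter m)) :
    w.count (.inr y) = (rights w).count y := by
  induction w with
  | nil => rfl
  | cons a w ih => rcases a with z | z <;> simp [List.count_cons, ih, beq_iff_eq]

/-- Duplicator follows a positional winning strategy of the queue game. Her Σ_2-word agrees with
Spoiler's after each round, and her Σ_1-word falls short of his only by the buffer, which is a
queue. -/
theorem simulated_of_win {P Q : Type} [Finite P] [Finite Q] {A : NBA (Letter m) P}
    {B : NBA (Letter m) Q} {decA : P → SpState S m} {decB : Q → DupState S m}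
    (hA : Decodes A decA (SpStep G) SpState.Acc)
    (hB : Decodes B decB (DupStep G) (DupState.Acc G)) {s₀ : S} {w₀ : List (Fin m)}
    (hA₀ : decA A.start = .push false s₀ w₀) (hB₀ : decB B.start = .base s₀) {g : Fin m}
    (hgw : g ∈ w₀) (hg : ∀ s d, g ∈ (G.δ s g d).2.2) (hwin : G.arena.Win (s₀, w₀)) :
    Simulated (sigma12 m) ![⊤, 0] A B := by
  obtain ⟨σ, Y, hY₀, hY⟩ := hwin.exists_positional
  obtain ⟨θ, hlegal, hθ⟩ := exists_strategy (σ := sigma12 m) (κ := ![⊤, 0]) (A := A) (B := B)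
    (fun c => ∃ p w q, View decA decB c p w q ∧ DupInv G g σ Y p w q)
    (fun c mv c' => ∃ p w q w' q', View decA decB c p w q ∧ View decA decB c' (decA mv.2) w' q' ∧
      Resp G σ p w q mv.1 w' q')
    ⟨_, [], _, ⟨hA₀, rfl, rfl, hB₀⟩, .push (by simpa using hgw) fun e => by simpa [pumped] using hY₀⟩
    (by
      rintro c mv ⟨p, w, q, hv, hinv⟩ hmv
      obtain ⟨u, w', q', h1, h2, h3, h4, h5⟩ :=
        hinv.exists_resp hg (fun v hv e => (hY v hv e).1) (hv.hp ▸ hA.sound _ _ _ hmv)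
      obtain ⟨u', c', h6, h7⟩ := hv.exists_round hB hmv h1 h2 h3
      exact ⟨u', c', h6, ⟨_, _, _, h7, h5⟩, _, _, _, _, _, hv, h7, h4⟩)
  refine ⟨θ, hlegal, fun s c hplay hacc => ?_⟩
  have hround : ∀ n, Round (sigma12 m) ![⊤, 0] A B (c n) (s n) (θ (hist s n)) (c (n + 1)) :=
    fun n => (hplay (n + 1)).2 n (Nat.lt_succ_self n)
  choose p w q hv hinv using fun n => (hθ s c n (hplay n)).1
  have hpn : ∀ n, decA (s n).2 = p (n + 1) := fun n => by
    rw [← (hv (n + 1)).hp, (hround n).2.1]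
  have hstep : ∀ n, SpStep G (p n) (s n).1 (p (n + 1)) := fun n => by
    rw [← hpn]; exact ((hv n).of_round hA hB (hround n)).1
  have hresp : ∀ n, Resp G σ (p n) (w n) (q n) (s n).1 (w (n + 1)) (q (n + 1)) := fun n => by
    obtain ⟨p', w', q', w'', q'', h1, h2, h3⟩ := (hθ s c (n + 1) (hplay (n + 1))).2 n n.lt_succ_self
    obtain ⟨rfl, rfl, rfl⟩ := h1.unique (hv n)
    obtain ⟨-, rfl, rfl⟩ := h2.unique (hv (n + 1))
    exact h3
  have hletters : ∀ n, w n ++ lefts [(s n).1] = lefts ((θ (hist s n)).map Prod.fst) ++ w (n + 1) ∧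
      rights [(s n).1] = rights ((θ (hist s n)).map Prod.fst) := fun n => by
    obtain ⟨-, w', h1, -, h2, h3⟩ := (hv n).of_round hA hB (hround n)
    obtain ⟨-, rfl, -⟩ := h1.unique (hv (n + 1))
    exact ⟨h2, h3⟩
  have hacc' : ∀ N, ∃ n ≥ N, (p n).Acc := fun N => by
    obtain ⟨n, hn, h⟩ := hacc.forall_exists_of_atTop N
    exact ⟨n, hn, (hv n).hp ▸ (hA.acc_iff _).1 h⟩
  have hwinw : ∀ n, q n = .win → w n = [] := fun n h => by
    have := hresp n
    rw [h] at this
    exact this.of_win.1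
  refine ⟨?_, ?_⟩
  · rw [Filter.frequently_atTop]
    intro N
    obtain ⟨n, hn, h1, h2⟩ := exists_acc hstep hresp hinv hacc' hY N
    -- A Σ_2-letter must be consumed at once. In the universal state the buffer is empty before and
    -- after the round, so even a Σ_1-letter must have been read.
    have hne : θ (hist s n) ≠ [] := by
      intro h0
      have h3 := hletters n
      rw [h0] at h3
      rcases hs : (s n).1 with x | y
      · rw [hs] at h3
        rcases h2 with h2 | ⟨y, h2⟩
        · rw [hwinw _ h2, hwinw _ (eq_win_of_le hresp h2 n.le_succ)] at h3
          simp at h3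
        · rw [hs] at h2
          cases h2
      · rw [hs] at h3
        simp at h3
    obtain ⟨z, hz, e⟩ := (hround n).2.2.1.exists_mem hne
    exact ⟨n, hn, z, hz, by rw [e, hB.acc_iff, (hv (n + 1)).hq]; exact h1⟩
  · set sp : ℕ → List (Letter m) := fun n => (List.range n).map fun j => (s j).1 with hsp
    set du : ℕ → List (Letter m) :=
      fun n => (List.range n).flatMap fun j => (θ (hist s j)).map Prod.fst with hdu
    have hsp' : ∀ n, sp (n + 1) = sp n ++ [(s n).1] := fun n => by simp [hsp, List.range_succ]
    have hdu' : ∀ n, du (n + 1) = du n ++ (θ (hist s n)).map Prod.fst := fun n => by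
      simp [hdu, List.range_succ]
    have hr : ∀ n, rights (sp n) = rights (du n) := by
      intro n
      induction n with
      | zero => rfl
      | succ n ih => rw [hsp', hdu', rights_append, rights_append, ih, (hletters n).2]
    have hl : ∀ n, lefts (sp n) = lefts (du n) ++ w n := by
      intro n
      induction n with
      | zero =>
        have h0 : w 0 = [] := by
          have := (hv 0).hw
          rw [(hplay 0).1] at this
          exact List.map_eq_nil_iff.1 this.symm
        rw [h0]
        rfl
      | succ n ih =>
        rw [hsp', hdu', lefts_append, lefts_append, ih, List.append_assoc, (hletters n).1,
          List.append_assoc]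
    have hmono : ∀ n k, lefts (sp n) <+: lefts (sp (n + k)) ∧
        (lefts (du n)).length ≤ (lefts (du (n + k))).length := by
      intro n k
      induction k with
      | zero => exact ⟨List.prefix_refl _, le_rfl⟩
      | succ k ih =>
        rw [← add_assoc, hsp', hdu', lefts_append, lefts_append, List.length_append]
        exact ⟨ih.1.trans (List.prefix_append _ _), by omega⟩
    -- Duplicator's Σ_1-word eventually becomes as long as any prefix of Spoiler's. Being a prefix
    -- of his word, it then contains that prefix.
    have hgrow : ∀ N, ∃ n ≥ N, (lefts (sp N)).length ≤ (lefts (du n)).length := by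
      intro N
      by_cases hw : ∃ n, q n = .win
      · obtain ⟨n, hn⟩ := hw
        refine ⟨N + n, by omega, ?_⟩
        have h1 := hl (N + n)
        rw [hwinw _ (eq_win_of_le hresp hn (by omega : n ≤ N + n)), List.append_nil] at h1
        rw [← h1]
        exact (hmono N n).1.length_le
      · have : ∀ L, ∃ n ≥ N, L ≤ (lefts (du n)).length := by
          intro L
          induction L with
          | zero => exact ⟨N, le_rfl, Nat.zero_le _⟩
          | succ L ih =>
            obtain ⟨n, hn, h⟩ := ih
            obtain ⟨n', hn', h1, y, h2⟩ :=
              (exists_shrink hstep hresp hinv hacc' n).resolve_right hw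
            refine ⟨n' + 1, by omega, ?_⟩
            obtain ⟨k, rfl⟩ := Nat.exists_eq_add_of_le hn'
            have h3 := congrArg List.length (hletters (n + k)).1
            rw [h2] at h3
            simp only [lefts_inr, lefts_nil, List.append_nil, List.length_append] at h3
            rw [hdu', lefts_append, List.length_append]
            have := (hmono n k).2
            omega
        exact this _
    intro a
    -- Suprema are compared prefix by prefix. The equality test is arbitrary, to match the classical
    -- one in `occ`.
    have hocc : ∀ {u v : ℕ → List (Letter m)},
        (∀ n, ∃ n', ∀ (b : BEq (Letter m)) (_ : LawfulBEq (Letter m)),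
          @List.count _ b a (u n) ≤ @List.count _ b a (v n')) →
          occ a u ≤ occ a v := by
      intro u v h
      refine iSup_le fun n => ?_
      obtain ⟨n', hn'⟩ := h n
      refine le_trans ?_ (le_iSup _ n')
      refine Nat.cast_le.2 ?_
      refine hn' _ ?_
      infer_instance
    refine le_antisymm (hocc fun n => ?_) (hocc fun n => ⟨n, ?_⟩)
    · rcases a with x | y
      · obtain ⟨n', hn', h⟩ := hgrow n
        refine ⟨n', fun _ _ => ?_⟩
        rw [count_inl, count_inl]
        obtain ⟨k, rfl⟩ := Nat.exists_eq_add_of_le hn'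
        refine List.Sublist.count_le _ (List.IsPrefix.sublist ?_)
        refine List.prefix_of_prefix_length_le (hmono n k).1 ?_ h
        rw [hl (n + k)]
        exact List.prefix_append _ _
      · refine ⟨n, fun _ _ => ?_⟩
        rw [count_inr, count_inr]
        exact (congrArg _ (hr n)).le
    · intro _ _
      rcases a with x | y
      · rw [count_inl, count_inl]
        rw [hl n]
        exact (List.prefix_append _ _).sublist.count_le _
      · rw [count_inr, count_inr]
        exact (congrArg _ (hr n)).ge

end MultiBuffer

/-! #### The queue game is won if Duplicator wins -/

namespace MultiBuffer

variable {S : Type} {m : ℕ} {G : QueueGame S m}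

/-- In the state `s` with the queue `v`, Duplicator may already have read the first letter. -/
def Virt (s : S) (v w : List (Fin m)) (q : DupState S m) : Prop :=
  (q = .base s ∧ w = v) ∨ ∃ x, q = .got s x ∧ v = x :: w

theorem DupPath.of_got_nil {s : S} {x : Fin m} {u : List (Letter m × DupState S m)}
    {q' : DupState S m} (h : DupPath G (.got s x) u q') (hr : rights (u.map Prod.fst) = []) :
    u = [] ∧ q' = .got s x := by
  rcases h with _ | ⟨h, t⟩
  · exact ⟨rfl, rfl⟩
  · cases h <;> simp at hr

theorem DupPath.of_chose_nil {s : S} {x : Fin m} {d : Bool} {u : List (Letter m × DupState S m)}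
    {q' : DupState S m} (h : DupPath G (.chose s x d) u q')
    (hr : rights (u.map Prod.fst) = []) : u = [] ∧ q' = .chose s x d := by
  generalize hq : DupState.chose s x d = q at h
  rcases h with _ | ⟨h, t⟩
  · exact ⟨rfl, rfl⟩
  · subst hq
    cases h <;> simp at hr

/-- Only Σ_2-letters lead out of `got`. So without a Σ_2-letter, Duplicator reads ahead by at most
one letter, and she visits no accepting state. -/
theorem DupPath.of_base_nil {s : S} {u : List (Letter m × DupState S m)} {q' : DupState S m}
    (h : DupPath G (.base s) u q') (hr : rights (u.map Prod.fst) = []) :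
    (u = [] ∧ q' = .base s) ∨ ∃ x, u = [(.inl x, .got s x)] ∧ q' = .got s x := by
  rcases h with _ | ⟨h, t⟩
  · exact Or.inl ⟨rfl, rfl⟩
  · cases h with
    | read _ x =>
      obtain ⟨rfl, rfl⟩ := t.of_got_nil hr
      exact Or.inr ⟨x, rfl, rfl⟩

theorem DupPath.of_got_look {s : S} {x : Fin m} {u : List (Letter m × DupState S m)}
    {q' : DupState S m} (h : DupPath G (.got s x) u q')
    (hr : rights (u.map Prod.fst) = [some x]) :
    ∃ d, u = [(.inr (some x), .chose s x d)] ∧ q' = .chose s x d := by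
  rcases h with _ | ⟨h, t⟩
  · simp at hr
  · cases h with
    | look _ _ d =>
      obtain ⟨rfl, rfl⟩ := t.of_chose_nil (by simpa using hr)
      exact ⟨d, rfl, rfl⟩
    | look_wrong _ _ y hy =>
      simp only [List.map_cons, rights_inr, List.cons.injEq] at hr
      exact (hy hr.1).elim

theorem Virt.push {s : S} {v w w' : List (Fin m)} {q q' : DupState S m} {x : Fin m}
    {u : List (Letter m × DupState S m)} (hv : Virt s v w q) (h : DupPath G q u q')
    (hr : rights (u.map Prod.fst) = []) (hl : w ++ [x] = lefts (u.map Prod.fst) ++ w') :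
    Virt s (v ++ [x]) w' q' ∧ ∀ z ∈ u, ¬ z.2.Acc G := by
  obtain ⟨rfl, rfl⟩ | ⟨y, rfl, rfl⟩ := hv
  · obtain ⟨rfl, rfl⟩ | ⟨y, rfl, rfl⟩ := h.of_base_nil hr
    · exact ⟨Or.inl ⟨rfl, hl.symm⟩, by simp⟩
    · exact ⟨Or.inr ⟨y, rfl, hl⟩, by simp [DupState.Acc]⟩
  · obtain ⟨rfl, rfl⟩ := h.of_got_nil hr
    exact ⟨Or.inr ⟨y, rfl, congrArg (y :: ·) hl⟩, by simp⟩

/-- After a true announcement the universal state is out of reach, and the only Σ_2-letter in her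
run leads to `chose`. Duplicator must therefore fix d in this round. -/
theorem Virt.look {s : S} {v w w' : List (Fin m)} {q q' : DupState S m} {x : Fin m}
    {u : List (Letter m × DupState S m)} (hv : Virt s (x :: v) w q) (h : DupPath G q u q')
    (hr : rights (u.map Prod.fst) = [some x]) (hl : w = lefts (u.map Prod.fst) ++ w') :
    (∃ d, q' = .chose s x d ∧ w' = v) ∧ ∀ z ∈ u, ¬ z.2.Acc G := by
  obtain ⟨rfl, rfl⟩ | ⟨y, rfl, hy⟩ := hv
  · rcases h with _ | ⟨h, t⟩
    · simp at hr
    · cases h with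
      | read _ y =>
        simp only [List.map_cons, lefts_inl, List.cons_append, List.cons.injEq] at hl
        obtain ⟨rfl, hl⟩ := hl
        obtain ⟨d, rfl, rfl⟩ := t.of_got_look hr
        exact ⟨⟨d, rfl, hl.symm⟩, by simp [DupState.Acc]⟩
  · obtain ⟨rfl, rfl⟩ := List.cons.inj hy
    obtain ⟨d, rfl, rfl⟩ := h.of_got_look hr
    exact ⟨⟨d, rfl, hl.symm⟩, by simp [DupState.Acc]⟩

/-- The announced choice is the true one, so it leads to `base`, the only state on the path that may
be accepting; afterwards one letter may be read ahead. -/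
theorem DupPath.virt_of_chose {s : S} {x : Fin m} {d : Bool} {w w' : List (Fin m)}
    {q' : DupState S m} {u : List (Letter m × DupState S m)} (h : DupPath G (.chose s x d) u q')
    (hr : rights (u.map Prod.fst) = [announce d x]) (hl : w = lefts (u.map Prod.fst) ++ w') :
    Virt (G.δ s x d).1 w w' q' ∧ ∀ z ∈ u, z.2.Acc G → G.fin (G.δ s x d).1 := by
  generalize hq : DupState.chose s x d = q at h
  rcases h with _ | ⟨h, t⟩
  · simp at hr
  · cases h <;> simp only [DupState.chose.injEq, reduceCtorEq] at hq
    · obtain ⟨rfl, rfl, rfl⟩ := hq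
      simp only [List.map_cons, rights_inr, List.cons.injEq, true_and] at hr
      simp only [List.map_cons, lefts_inr] at hl
      obtain ⟨rfl, rfl⟩ | ⟨y, rfl, rfl⟩ := t.of_base_nil hr
      · exact ⟨Or.inl ⟨rfl, hl.symm⟩, by simp [DupState.Acc]⟩
      · exact ⟨Or.inr ⟨y, rfl, hl⟩, by simp [DupState.Acc]⟩
    · rename_i hy
      obtain ⟨rfl, rfl, rfl⟩ := hq
      simp only [List.map_cons, rights_inr, List.cons.injEq] at hr
      exact (hy hr.1).elim

variable {P Q : Type} [Finite P] [Finite Q] {A : NBA (Letter m) P}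
  {B : NBA (Letter m) Q} {decA : P → SpState S m} {decB : Q → DupState S m}
  {θ : List (Letter m × P) → List (Letter m × Q)}

/-! ### Spoiler's play against a fixed strategy of Duplicator. -/

/-- The play `(s', c', n')` extends `(s, c, n)`, and accepting states of `B` are visited
in the additional rounds only if `fine` holds. -/
structure Extends (A : NBA (Letter m) P) (B : NBA (Letter m) Q)
    (θ : List (Letter m × P) → List (Letter m × Q)) (fine : Prop) (s : ℕ → Letter m × P)
    (c : ℕ → Config (Letter m) P Q 2) (n : ℕ) (s' : ℕ → Letter m × P)
    (c' : ℕ → Config (Letter m) P Q 2) (n' : ℕ) : Prop where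
  play : PlayUpTo (sigma12 m) ![⊤, 0] A B θ s' c' n'
  le : n ≤ n'
  hs : ∀ j < n, s' j = s j
  hc : ∀ j ≤ n, c' j = c j
  visits : ∀ i, n ≤ i → i < n' → ∀ z ∈ θ (hist s' i), z.2 ∈ B.F → fine

variable {fine : Prop} {s s₁ s₂ : ℕ → Letter m × P} {c c₁ c₂ : ℕ → Config (Letter m) P Q 2}
  {n n₁ n₂ : ℕ}

theorem Extends.refl (h : PlayUpTo (sigma12 m) ![⊤, 0] A B θ s c n) :
    Extends A B θ fine s c n s c n :=
  ⟨h, le_rfl, fun _ _ => rfl, fun _ _ => rfl, fun i h1 h2 => by omega⟩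

theorem Extends.trans (h₁ : Extends A B θ fine s c n s₁ c₁ n₁)
    (h₂ : Extends A B θ fine s₁ c₁ n₁ s₂ c₂ n₂) : Extends A B θ fine s c n s₂ c₂ n₂ where
  play := h₂.play
  le := h₁.le.trans h₂.le
  hs j hj := (h₂.hs j (hj.trans_le h₁.le)).trans (h₁.hs j hj)
  hc j hj := (h₂.hc j (hj.trans h₁.le)).trans (h₁.hc j hj)
  visits i hi hi' z hz hzF := by
    rcases lt_or_ge i n₁ with h | h
    · rw [hist_congr fun j hj => h₂.hs j (hj.trans_lt h)] at hz
      exact h₁.visits i hi h z hz hzF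
    · exact h₂.visits i h hi' z hz hzF

/-- The first clause of `WinningForDuplicator`. -/
def Legal (A : NBA (Letter m) P) (B : NBA (Letter m) Q)
    (θ : List (Letter m × P) → List (Letter m × Q)) : Prop :=
  ∀ s c n, PlayUpTo (sigma12 m) ![⊤, 0] A B θ s c n → (s n).2 ∈ A.δ (c n).p (s n).1 →
    ∃ c', Round (sigma12 m) ![⊤, 0] A B (c n) (s n) (θ (hist s n)) c'

/-- What holds after all letter-consistent answers of Duplicator holds after the answer of her
strategy; `Z` and `fine` record what is known about them. -/
theorem Legal.exists_extends_round (hA : Decodes A decA (SpStep G) SpState.Acc)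
    (hB : Decodes B decB (DupStep G) (DupState.Acc G)) (hθ : Legal A B θ)
    (hplay : PlayUpTo (sigma12 m) ![⊤, 0] A B θ s c n) {p y : SpState S m} {w : List (Fin m)}
    {q : DupState S m} (hv : View decA decB (c n) p w q) {a : Letter m} (hstep : SpStep G p a y)
    {Z : List (Fin m) → DupState S m → Prop}
    (hZ : ∀ u w' q', DupPath G q u q' → rights [a] = rights (u.map Prod.fst) →
      w ++ lefts [a] = lefts (u.map Prod.fst) ++ w' →
      Z w' q' ∧ ∀ z ∈ u, z.2.Acc G → fine) :
    ∃ s' c', Extends A B θ fine s c n s' c' (n + 1) ∧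
      ∃ w' q', View decA decB (c' (n + 1)) y w' q' ∧ Z w' q' := by
  obtain ⟨p', hp', rfl⟩ := hA.complete (c n).p a y (hv.hp ▸ hstep)
  set s' := Function.update s n (a, p') with hs'
  have hs : ∀ j < n, s' j = s j := fun j hj => Function.update_of_ne hj.ne _ _
  have hsn : s' n = (a, p') := Function.update_self _ _ _
  have hplay' := hplay.congr hs fun _ _ => rfl
  obtain ⟨c₁, hc₁⟩ := hθ s' c n hplay' (by rw [hsn]; exact hp')
  set c' := Function.update c (n + 1) c₁ with hc'
  have hc : ∀ j ≤ n, c' j = c j := fun j hj => Function.update_of_ne (by omega) _ _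
  have hcn : c' (n + 1) = c₁ := Function.update_self _ _ _
  obtain ⟨-, w', hv', hpath, hl, hr⟩ := hv.of_round hA hB hc₁
  rw [hsn] at hv' hl hr
  have hletters : (((θ (hist s' n)).map fun z => (z.1, decB z.2)).map Prod.fst) =
      (θ (hist s' n)).map Prod.fst := by simp
  obtain ⟨h1, h2⟩ := hZ _ w' _ hpath (by rw [hletters]; exact hr) (by rw [hletters]; exact hl)
  refine ⟨s', c', ⟨⟨(hc 0 (Nat.zero_le n)).trans hplay.1, fun j hj => ?_⟩, n.le_succ, hs, hc,
    fun i hi hi' z hz hzF => ?_⟩, w', _, by rw [hcn]; exact hv', h1⟩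
  · rcases Nat.lt_succ_iff_lt_or_eq.1 hj with hj | rfl
    · rw [hc j hj.le, hc (j + 1) hj]
      exact hplay'.2 j hj
    · rw [hc j le_rfl, hcn]
      exact hc₁
  · obtain rfl : i = n := by omega
    exact h2 (z.1, decB z.2) (List.mem_map_of_mem hz) ((hB.acc_iff _).1 hzF)

/-- Spoiler pumps e times, if he may, and then writes `r`. Meanwhile Duplicator reads at most one
letter and visits no accepting state, so `fine` can be any proposition. -/
theorem Legal.exists_extends_push (hA : Decodes A decA (SpStep G) SpState.Acc)
    (hB : Decodes B decB (DupStep G) (DupState.Acc G)) (hθ : Legal A B θ)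
    (hplay : PlayUpTo (sigma12 m) ![⊤, 0] A B θ s c n) {b : Bool} {t : S} {r v w : List (Fin m)}
    {q : DupState S m} (hv : View decA decB (c n) (.push b t r) w q) (hvirt : Virt t v w q)
    (e : ℕ) :
    ∃ s' c' n', Extends A B θ fine s c n s' c' n' ∧ ∃ b' w' q',
      View decA decB (c' n') (.push b' t []) w' q' ∧
        Virt t (v ++ (pumped b G.pump e ++ r)) w' q' := by
  have key : ∀ {s c n b v w q x y}, PlayUpTo (sigma12 m) ![⊤, 0] A B θ s c n →
      View decA decB (c n) (.push b t r) w q → Virt t v w q →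
      SpStep G (.push b t r) (.inl x) y →
      ∃ s' c', Extends A B θ fine s c n s' c' (n + 1) ∧
        ∃ w' q', View decA decB (c' (n + 1)) y w' q' ∧ Virt t (v ++ [x]) w' q' := by
    intro s c n b v w q x y hplay hv hvirt hstep
    refine hθ.exists_extends_round hA hB hplay hv hstep fun u w' q' hu hr hl => ?_
    obtain ⟨h1, h2⟩ := hvirt.push hu hr.symm hl
    exact ⟨h1, fun z hz hacc => (h2 z hz hacc).elim⟩
  have push_word : ∀ {r s c n b v w q}, PlayUpTo (sigma12 m) ![⊤, 0] A B θ s c n →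
      View decA decB (c n) (.push b t r) w q → Virt t v w q →
      ∃ s' c' n', Extends A B θ fine s c n s' c' n' ∧ ∃ b' w' q',
        View decA decB (c' n') (.push b' t []) w' q' ∧ Virt t (v ++ r) w' q' := by
    intro r
    induction r with
    | nil =>
      intro s c n b v w q hplay hv hvirt
      exact ⟨s, c, n, .refl hplay, b, w, q, hv, by simpa using hvirt⟩
    | cons x r ih =>
      intro s c n b v w q hplay hv hvirt
      obtain ⟨s₁, c₁, h1, w₁, q₁, h2, h3⟩ := hθ.exists_extends_round (fine := fine)
        (Z := Virt t (v ++ [x])) hA hB hplay hv (.push b t x r) fun u w' q' hu hr hl => by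
          obtain ⟨h1, h2⟩ := hvirt.push hu hr.symm hl
          exact ⟨h1, fun z hz hacc => (h2 z hz hacc).elim⟩
      obtain ⟨s₂, c₂, n₂, h4, b₂, w₂, q₂, h5, h6⟩ := ih h1.play h2 h3
      exact ⟨s₂, c₂, n₂, h1.trans h4, b₂, w₂, q₂, h5, by simpa using h6⟩
  cases b with
  | false => simpa [pumped] using push_word hplay hv hvirt
  | true =>
    induction e generalizing s c n v w q with
    | zero => simpa [pumped] using push_word hplay hv hvirt
    | succ e ih =>
      obtain ⟨s₁, c₁, h1, w₁, q₁, h2, h3⟩ := key hplay hv hvirt (.pump t r)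
      obtain ⟨s₂, c₂, n₂, h4, b₂, w₂, q₂, h5, h6⟩ := ih h1.play h3 h2
      exact ⟨s₂, c₂, n₂, h1.trans h4, b₂, w₂, q₂, h5, by
        simpa [pumped, List.replicate_succ] using h6⟩

/-- The order of the quantifiers is essential: d is read off from the answer to Spoiler's
announcement of x, before he decides how often to pump. -/
theorem Legal.exists_extends_move (hA : Decodes A decA (SpStep G) SpState.Acc)
    (hB : Decodes B decB (DupStep G) (DupState.Acc G)) (hθ : Legal A B θ)
    (hplay : PlayUpTo (sigma12 m) ![⊤, 0] A B θ s c n) {b : Bool} {t : S} {x : Fin m}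
    {v w : List (Fin m)} {q : DupState S m} (hv : View decA decB (c n) (.push b t []) w q)
    (hvirt : Virt t (x :: v) w q) :
    ∃ d, ∀ e, ∃ s' c' n', Extends A B θ (G.fin (G.δ t x d).1) s c n s' c' n' ∧
      (∃ i, n ≤ i ∧ i < n' ∧ (c' i).p ∈ A.F) ∧ ∃ b' w' q',
        View decA decB (c' n') (.push b' (G.arena.next (t, x :: v) d e).1 []) w' q' ∧
          Virt (G.arena.next (t, x :: v) d e).1 (G.arena.next (t, x :: v) d e).2 w' q' := by
  have hlook : ∀ fine : Prop, ∀ u w' q', DupPath G q u q' →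
      rights [.inr (some x)] = rights (u.map Prod.fst) →
      w ++ lefts [.inr (some x)] = lefts (u.map Prod.fst) ++ w' →
      (∃ d, q' = .chose t x d ∧ w' = v) ∧ ∀ z ∈ u, z.2.Acc G → fine := by
    intro fine u w' q' hu hr hl
    obtain ⟨h1, h2⟩ := hvirt.look hu hr.symm (by simpa using hl)
    exact ⟨h1, fun z hz hacc => (h2 z hz hacc).elim⟩
  obtain ⟨s₁, c₁, h1, w₁, q₁, h2, d, rfl, rfl⟩ := hθ.exists_extends_round hA hB hplay hv
    (.look b t x) (hlook False)
  refine ⟨d, fun e => ?_⟩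
  have h1' : Extends A B θ (G.fin (G.δ t x d).1) s c n s₁ c₁ (n + 1) :=
    { h1 with visits := fun i h h' z hz hzF => (h1.visits i h h' z hz hzF).elim }
  obtain ⟨s₂, c₂, h3, w₂, q₂, h4, h5⟩ := hθ.exists_extends_round (fine := G.fin (G.δ t x d).1)
    (Z := Virt (G.δ t x d).1 w₁) hA hB h1.play h2 (.ann t x d) fun u w' q' hu hr hl =>
      hu.virt_of_chose hr.symm (by simpa using hl)
  obtain ⟨s₃, c₃, n₃, h6, b₃, w₃, q₃, h7, h8⟩ :=
    hθ.exists_extends_push (fine := G.fin (G.δ t x d).1) hA hB h3.play h4 h5 e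
  -- After round n, Spoiler's automaton is in the accepting state `got`.
  refine ⟨s₃, c₃, n₃, (h1'.trans h3).trans h6, ⟨n + 1, n.le_succ, h6.le, ?_⟩, b₃, w₃, q₃, h7, h8⟩
  rw [h6.hc _ (by omega), h3.hc _ le_rfl, hA.acc_iff, h2.hp]
  trivial

/-- The histories are plays against the given strategy in which Spoiler has just finished writing.
In the limit of a chain of extensions his run is accepting, so Duplicator's run must be, and each of
her accepting visits yields a final position of the queue game. -/
theorem win_of_simulated (hA : Decodes A decA (SpStep G) SpState.Acc)
    (hB : Decodes B decB (DupStep G) (DupState.Acc G)) {s₀ : S} {w₀ : List (Fin m)}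
    (hA₀ : decA A.start = .push false s₀ w₀) (hB₀ : decB B.start = .base s₀) {g : Fin m}
    (hgw : g ∈ w₀) (hg : ∀ s d, g ∈ (G.δ s g d).2.2) (hsim : Simulated (sigma12 m) ![⊤, 0] A B) :
    G.arena.Win (s₀, w₀) := by
  obtain ⟨θ, hθ, hwin⟩ := hsim
  replace hθ : Legal A B θ := hθ
  let H := {h : (ℕ → Letter m × P) × (ℕ → Config (Letter m) P Q 2) × ℕ × S × List (Fin m) //
    PlayUpTo (sigma12 m) ![⊤, 0] A B θ h.1 h.2.1 h.2.2.1 ∧ g ∈ h.2.2.2.2 ∧ ∃ b w q,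
      View decA decB (h.2.1 h.2.2.1) (.push b h.2.2.2.1 []) w q ∧ Virt h.2.2.2.1 h.2.2.2.2 w q}
  let pos : H → S × List (Fin m) := fun h => h.1.2.2.2
  let Ext : H → H → Prop := fun h h' =>
    Extends A B θ (G.fin (pos h').1) h.1.1 h.1.2.1 h.1.2.2.1 h'.1.1 h'.1.2.1 h'.1.2.2.1 ∧
      ∃ i, h.1.2.2.1 ≤ i ∧ i < h'.1.2.2.1 ∧ (h'.1.2.1 i).p ∈ A.F
  have hExt : ∀ h, ∃ d, ∀ e, ∃ h', Ext h h' ∧ pos h' = G.arena.next (pos h) d e := by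
    rintro ⟨⟨s, c, n, t, v⟩, hplay, hgv, b, w, q, hv, hvirt⟩
    simp only at hplay hgv hv hvirt
    obtain ⟨x, v, rfl⟩ := List.exists_cons_of_ne_nil (List.ne_nil_of_mem hgv)
    obtain ⟨d, hd⟩ := hθ.exists_extends_move hA hB hplay hv hvirt
    refine ⟨d, fun e => ?_⟩
    obtain ⟨s', c', n', h1, h2, h3⟩ := hd e
    refine ⟨⟨(s', c', n', G.arena.next (t, x :: v) d e), h1.play, ?_, h3⟩, ⟨h1, h2⟩, rfl⟩
    change g ∈ v ++ (pumped _ _ _ ++ _)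
    rcases List.mem_cons.1 hgv with rfl | h
    · exact List.mem_append_right _ (List.mem_append_right _ (hg _ _))
    · exact List.mem_append_left _ h
  have hinf : ∀ h : ℕ → H, (∀ i, Ext (h i) (h (i + 1))) → ∃ i, G.arena.fin (pos (h (i + 1))) := by
    intro h hh
    have hlt : ∀ i, (h i).1.2.2.1 < (h (i + 1)).1.2.2.1 := fun i => by
      obtain ⟨-, j, h1, h2, -⟩ := hh i
      omega
    obtain ⟨s, hs⟩ := exists_limit (fun i => (h i).1.1) (fun i => (h i).1.2.2.1) hlt
      fun i => (hh i).1.hs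
    obtain ⟨c, hc⟩ := exists_limit (fun i => (h i).1.2.1) (fun i => (h i).1.2.2.1 + 1)
      (fun i => Nat.succ_lt_succ (hlt i)) fun i j hj => (hh i).1.hc j (Nat.lt_succ_iff.1 hj)
    have hmono : StrictMono fun i => (h i).1.2.2.1 := strictMono_nat_of_lt_succ hlt
    have hplay : ∀ n, PlayUpTo (sigma12 m) ![⊤, 0] A B θ s c n := fun n =>
      ((h n).2.1.congr (hs n) fun j hj => hc n j (Nat.lt_succ_iff.2 hj)).mono (hmono.id_le n)
    have hacc : ∃ᶠ n in Filter.atTop, (c n).p ∈ A.F := by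
      rw [Filter.frequently_atTop]
      intro N
      obtain ⟨-, j, h1, h2, h3⟩ := hh N
      refine ⟨j, (hmono.id_le N).trans h1, ?_⟩
      rw [hc (N + 1) j (Nat.lt_succ_of_lt h2)]
      exact h3
    obtain ⟨n, hn, z, hz, hzF⟩ := (hwin s c hplay hacc).1.forall_exists_of_atTop (h 0).1.2.2.1
    -- The least such i is the index of the extension to which round n belongs.
    have hex : ∃ i, n < (h (i + 1)).1.2.2.1 := ⟨n, lt_of_lt_of_le n.lt_succ_self (hmono.id_le (n + 1))⟩
    classical
    refine ⟨Nat.find hex, (hh _).1.visits n ?_ (Nat.find_spec hex) z ?_ hzF⟩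
    · rcases hi : Nat.find hex with _ | i
      · exact hn
      · have := Nat.find_min hex (m := i) (by omega)
        omega
    · rw [← hist_congr fun j hj => hs (Nat.find hex + 1) j (hj.trans_lt (Nat.find_spec hex))]
      exact hz
  -- No round has been played, so the listed moves are arbitrary.
  have hplay₀ : PlayUpTo (sigma12 m) ![⊤, 0] A B θ (fun _ => (.inr none, A.start))
      (fun _ => ⟨A.start, fun _ => [], B.start⟩) 0 := ⟨rfl, fun j hj => (Nat.not_lt_zero j hj).elim⟩
  have hv₀ : View decA decB ⟨A.start, fun _ => [], B.start⟩ (.push false s₀ w₀) [] (.base s₀) :=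
    ⟨hA₀, rfl, rfl, hB₀⟩
  obtain ⟨s, c, n, h1, b, w, q, h2, h3⟩ := hθ.exists_extends_push (fine := True) (v := []) hA hB
    hplay₀ hv₀ (Or.inl ⟨rfl, rfl⟩) 0
  have := Arena.win_of_histories pos Ext hExt hinf
    ⟨(s, c, n, s₀, [] ++ (pumped false G.pump 0 ++ w₀)), h1.play, by simp [hgw],
      b, w, q, h2, h3⟩
  simpa [pos, pumped] using this

end MultiBuffer

/-! ### The number game as a stack game -/

namespace MultiBuffer

open Turing Turing.PartrecToTM2

/-- Control states: initialization; execution of a statement of the machine of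
`Turing.PartrecToTM2`; reading its output; the choices of the players; two sinks. -/
inductive Ctl
  | init
  | run (q : TM2.Stmt (fun _ : K' => Γ') Λ' (Option Γ')) (v : Option Γ')
  | rd (acc : List Γ')
  | pick (f : Bool)
  | spick (f : Bool)
  | sink (b : Bool)

/-- A verdict as a number, for the output of a program. -/
def Verdict.toNat : Verdict → ℕ
  | .sink b => 8 + 2 * b.toNat
  | .node o f => 9 + 2 * o.toNat + 4 * f.toNat

/-- The control state reached after the binary digits of a verdict have been read, and what is to be
pushed. -/
def afterRead : List Γ' → Ctl × List Γ'
  | [.bit0, b, _, _] => (.sink (b == .bit1), [])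
  | [.bit1, .bit1, f, _] => (.pick (f == .bit1), [.bit1, .cons])
  | [.bit1, .bit0, f, _] => (.spick (f == .bit1), [])
  | _ => (.sink false, [])

/-- The stack used in a control state. -/
def Ctl.key : Ctl → K'
  | .run (.push k _ _) _ => k
  | .run (.peek k _ _) _ => k
  | .run (.pop k _ _) _ => k
  | _ => .main

/-- Positions to be visited infinitely often. -/
def Ctl.Fin : Ctl → Prop
  | .pick f => f = true
  | .spick f => f = true
  | .sink b => b = true
  | _ => False

/-- The stack game that plays the number game with the help of a program `c` for computing
verdicts. -/
def codeGame (c : ToPartrec.Code) : StackGame Ctl K' Γ' where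
  key := Ctl.key
  act
    | .init, o, _ => (.pick false, false, .bit1 :: .cons :: o.toList)
    | .run (.push _ f q) v, o, _ => (.run q v, false, f v :: o.toList)
    | .run (.peek _ f q) v, o, _ => (.run q (f v o), false, o.toList)
    | .run (.pop _ f q) v, o, _ => (.run q (f v o), false, [])
    | .run (.load f q) v, o, _ => (.run q (f v), false, o.toList)
    | .run (.branch f q₁ q₂) v, o, _ => (.run (cond (f v) q₁ q₂) v, false, o.toList)
    | .run (.goto l) v, o, _ => (.run (tr (l v)) v, false, o.toList)
    | .run .halt _, o, _ => (.rd [], false, o.toList)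
    | .rd acc, o, _ =>
      if acc.length < 4 then (.rd (acc ++ o.toList), false, [])
      else ((afterRead acc).1, false, (afterRead acc).2)
    | .pick _, o, true => (.pick false, false, .bit0 :: o.toList)
    | .pick _, o, false => (.run (tr (trNormal c .halt)) none, false, o.toList)
    | .spick _, o, _ => (.run (tr (trNormal c .halt)) none, true, .bit1 :: .cons :: o.toList)
    | .sink b, o, _ => (.sink b, false, o.toList)
  pump := .bit0
  fin := Ctl.Fin

/-- The position of the stack game that corresponds to a configuration of the machine. -/
def ofCfg (a : TM2.Cfg (fun _ : K' => Γ') Λ' (Option Γ')) : Ctl × (K' → List Γ') :=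
  (match a.l with
    | none => .rd []
    | some l => .run (tr l) a.var, a.stk)

theorem update_head_tail {K Γ : Type} [DecidableEq K] (S : K → List Γ) (k : K) :
    Function.update S k ((S k).head?.toList ++ (S k).tail) = S := by
  have : (S k).head?.toList ++ (S k).tail = S k := by cases S k <;> rfl
  rw [this, Function.update_eq_self]

variable {c : ToPartrec.Code}

theorem next_keep {q q' : Ctl} {S : K' → List Γ'}
    (h : ∀ d, (codeGame c).act q (S q.key).head? d = (q', false, (S q.key).head?.toList)) (d : Bool)
    (e : ℕ) : (codeGame c).arena.next (q, S) d e = (q', S) := by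
  have hk : (codeGame c).key q = q.key := rfl
  simp only [StackGame.arena, hk, h, pumped]
  simp [update_head_tail]

/-- Each statement of a TM2 program touches at most one stack and costs one move of the game, in
which the choices of the players do not matter. -/
theorem run_stmt (q : TM2.Stmt (fun _ : K' => Γ') Λ' (Option Γ')) (v : Option Γ')
    (S : K' → List Γ') :
    (codeGame c).arena.Run (.run q v, S) (ofCfg (TM2.stepAux q v S)) := by
  induction q generalizing v S with
  | push k f q ih =>
    refine .step id (fun d e => ?_) (ih v _)
    simp only [StackGame.arena, codeGame, Ctl.key, pumped]
    cases S k <;> simp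
  | peek k f q ih => exact .step id (next_keep fun _ => rfl) (ih (f v (S k).head?) S)
  | pop k f q ih =>
    refine .step id (fun d e => ?_) (ih (f v (S k).head?) (Function.update S k (S k).tail))
    simp [StackGame.arena, codeGame, Ctl.key, pumped]
  | load f q ih => exact .step id (next_keep fun _ => rfl) (ih (f v) S)
  | branch f q₁ q₂ ih₁ ih₂ =>
    refine .step id (next_keep (q' := .run (cond (f v) q₁ q₂) v) fun _ => rfl) ?_
    rw [TM2.stepAux]
    cases f v
    · exact ih₂ v S
    · exact ih₁ v S
  | goto l => exact .single id (next_keep fun _ => rfl)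
  | halt => exact .single id (next_keep fun _ => rfl)

theorem run_of_reaches {a b : TM2.Cfg (fun _ : K' => Γ') Λ' (Option Γ')}
    (h : StateTransition.Reaches (TM2.step tr) a b) :
    (codeGame c).arena.Run (ofCfg a) (ofCfg b) := by
  induction h with
  | refl => exact .refl _
  | @tail a' b' _ h ih =>
    refine ih.trans ?_
    obtain ⟨_ | l, v, S⟩ := a'
    · cases h
    · cases h
      exact run_stmt (tr l) v S

/-- The stacks with main stack `l`. -/
def mainStack (l : List Γ') : K' → List Γ' := K'.elim l [] [] []

theorem run_code {v v' : List ℕ} (h : v' ∈ c.eval v) :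
    (codeGame c).arena.Run (.run (tr (trNormal c .halt)) none, mainStack (trList v))
      (.rd [], mainStack (trList v')) := by
  have h1 : halt v' ∈ StateTransition.eval (TM2.step tr) (init c v) := by
    rw [tr_eval]
    exact Part.mem_map _ h
  exact run_of_reaches (c := c) (StateTransition.mem_eval.1 h1).1

theorem next_main {q q' : Ctl} {p : Bool} {r l : List Γ'} {d : Bool} {e : ℕ}
    (hk : q.key = .main) (h : (codeGame c).act q l.head? d = (q', p, r)) :
    (codeGame c).arena.next (q, mainStack l) d e =
      (q', mainStack (pumped p .bit0 e ++ r ++ l.tail)) := by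
  have hk' : (codeGame c).key q = .main := hk
  simp only [StackGame.arena, hk', mainStack, K'.elim_main, h, K'.elim_update_main]
  rfl

/-- Four moves collect the digits and a fifth one removes the separator behind them. -/
theorem run_read {b₀ b₁ b₂ b₃ : Γ'} (x : Γ') (l : List Γ') :
    (codeGame c).arena.Run (.rd [], mainStack (b₀ :: b₁ :: b₂ :: b₃ :: x :: l))
      ((afterRead [b₀, b₁, b₂, b₃]).1, mainStack ((afterRead [b₀, b₁, b₂, b₃]).2 ++ l)) :=
  .step id (fun d e => next_main (l := b₀ :: b₁ :: b₂ :: b₃ :: x :: l) (p := false) (d := d) (e := e)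
    (q := .rd []) rfl rfl) <|
  .step id (fun d e => next_main (l := b₁ :: b₂ :: b₃ :: x :: l) (p := false) (d := d) (e := e)
    (q := .rd [b₀]) rfl rfl) <|
  .step id (fun d e => next_main (l := b₂ :: b₃ :: x :: l) (p := false) (d := d) (e := e)
    (q := .rd [b₀, b₁]) rfl rfl) <|
  .step id (fun d e => next_main (l := b₃ :: x :: l) (p := false) (d := d) (e := e)
    (q := .rd [b₀, b₁, b₂]) rfl rfl) <|
  .single id fun d e =>
    next_main (l := x :: l) (p := false) (d := d) (e := e) (q := .rd [b₀, b₁, b₂, b₃]) rfl rfl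

/-! ### Binary digits of powers of two and of verdicts. -/

theorem trNat_two_mul {n : ℕ} (hn : n ≠ 0) : trNat (2 * n) = .bit0 :: trNat n := by
  have h : ((2 * n : ℕ) : Num) = Num.bit0 (n : Num) := by
    rw [← Num.ofNat'_eq, ← Num.ofNat'_eq, ← Nat.bit_false_apply, Num.ofNat'_bit]
    rfl
  rw [trNat, trNat, h]
  rcases hm : (n : Num) with _ | p
  · exact (hn (by simpa using congrArg (fun x : Num => (x : ℕ)) hm)).elim
  · rfl

theorem trNat_two_mul_add_one (n : ℕ) : trNat (2 * n + 1) = .bit1 :: trNat n := by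
  have h : ((2 * n + 1 : ℕ) : Num) = Num.bit1 (n : Num) := by
    rw [← Num.ofNat'_eq, ← Num.ofNat'_eq, ← Nat.bit_true_apply, Num.ofNat'_bit]
    rfl
  rw [trNat, trNat, h]
  rcases (n : Num) with _ | p <;> rfl

theorem trNat_two_pow (n : ℕ) : trNat (2 ^ n) = List.replicate n .bit0 ++ [.bit1] := by
  induction n with
  | zero => simpa using trNat_two_mul_add_one 0
  | succ n ih => rw [pow_succ', trNat_two_mul (by positivity), ih]; rfl

/-- A bit as a letter. -/
def bitLetter (b : Bool) : Γ' := if b then .bit1 else .bit0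

theorem trNat_bit {n : ℕ} (hn : n ≠ 0) (b : Bool) :
    trNat (2 * n + b.toNat) = bitLetter b :: trNat n := by
  cases b
  · exact trNat_two_mul hn
  · exact trNat_two_mul_add_one n

/-- Verdicts are numbers from 8 to 15, so they have exactly four digits, and the control can read
them with bounded memory. The lowest digit, which comes first, tells sinks from nodes. -/
theorem trNat_sink (b : Bool) :
    trNat (Verdict.sink b).toNat = [.bit0, bitLetter b, .bit0, .bit1] := by
  rw [show (Verdict.sink b).toNat = 2 * (2 * (2 * 2 ^ 0) + b.toNat) by
    simp only [Verdict.toNat]; ring]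
  rw [trNat_two_mul (by positivity), trNat_bit (by norm_num), trNat_two_mul (by norm_num),
    trNat_two_pow]
  rfl

theorem trNat_node (o f : Bool) :
    trNat (Verdict.node o f).toNat = [.bit1, bitLetter o, bitLetter f, .bit1] := by
  rw [show (Verdict.node o f).toNat = 2 * (2 * (2 * 2 ^ 0 + f.toNat) + o.toNat) + 1 by
    simp only [Verdict.toNat]; ring]
  rw [trNat_two_mul_add_one, trNat_bit (by positivity), trNat_bit (by norm_num), trNat_two_pow]
  rfl

/-- The number that represents a current node on the stack. -/
def nodeNum : Option ℕ → ℕ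
  | none => 0
  | some k => 2 ^ k

/-- A position of the stack game that represents a position of the number game; the number `2 ^ n`
is kept on the stack. -/
inductive CtlRel (n : ℕ) : NumNode → Ctl × (K' → List Γ') → Prop
  | pick (f : Bool) (k : Option ℕ) (j : ℕ) :
      CtlRel n (.pick f k j) (.pick f, mainStack (trList [2 ^ j, 2 ^ n, nodeNum k]))
  | spick (f : Bool) (k : Option ℕ) :
      CtlRel n (.spick f k) (.spick f, mainStack (trList [2 ^ n, nodeNum k]))
  | sink (b : Bool) (l : List Γ') : CtlRel n (.sink b) (.sink b, mainStack l)

theorem trList_two_pow_cons (j : ℕ) (v : List ℕ) :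
    trList (2 ^ j :: v) = List.replicate j .bit0 ++ .bit1 :: .cons :: trList v := by
  simp [trList, trNat_two_pow]

/-- The output has the chosen number 2^j in the place of the current node. If player 0 moves next,
the control also pushes 1 = 2^0, her proposal 0. -/
theorem exists_run_verdict {n j : ℕ} {v : List ℕ} (V : Verdict)
    (h : [V.toNat, 2 ^ n, 2 ^ j] ∈ c.eval v) :
    ∃ w, (codeGame c).arena.Run (.run (tr (trNormal c .halt)) none, mainStack (trList v)) w ∧
      CtlRel n (V.place j) w := by
  have h1 := run_code h
  cases V with
  | sink b =>
    refine ⟨_, h1.trans ?_, .sink b (trList [2 ^ n, 2 ^ j])⟩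
    rw [trList, trNat_sink]
    have := run_read (c := c) (b₀ := .bit0) (b₁ := bitLetter b) (b₂ := .bit0) (b₃ := .bit1) .cons
      (trList [2 ^ n, 2 ^ j])
    cases b <;> exact this
  | node o f =>
    have := run_read (c := c) (b₀ := .bit1) (b₁ := bitLetter o) (b₂ := bitLetter f) (b₃ := .bit1)
      .cons (trList [2 ^ n, 2 ^ j])
    rw [trList, trNat_node] at h1
    replace h1 := h1.trans this
    cases o with
    | true =>
      refine ⟨_, h1, ?_⟩
      have := CtlRel.pick (n := n) f (some j) 0
      rw [trList_two_pow_cons] at this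
      cases f <;> exact this
    | false =>
      refine ⟨_, h1, ?_⟩
      have := CtlRel.spick (n := n) f (some j)
      cases f <;> exact this

/-- In binary, 2^(j+1) arises from 2^j by one more 0 on top, and a pumped power 0^e in front of a 1
is 2^e. So both kinds of choices are single moves of the stack game, and everything else is a run.
-/
theorem win_codeGame_iff {n : ℕ} {res : Option ℕ → ℕ → Verdict}
    (hc : ∀ k j, [(res k j).toNat, 2 ^ n, 2 ^ j] ∈ c.eval [2 ^ j, 2 ^ n, nodeNum k]) :
    (codeGame c).arena.Win (.init, mainStack (trList [2 ^ n, 0])) ↔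
      (numArena res).Win (.pick false none 0) := by
  have h₀ : (codeGame c).arena.Run (.init, mainStack (trList [2 ^ n, 0]))
      (.pick false, mainStack (trList [2 ^ 0, 2 ^ n, nodeNum none])) := by
    refine .single id fun d e => ?_
    rw [next_main (q' := .pick false) (p := false) rfl rfl]
    congr 2
    simp only [trList_two_pow_cons]
    cases n <;> rfl
  refine h₀.win_iff.trans (Arena.win_iff_of_simulation (CtlRel n) ?_ ?_ (.pick false none 0)).symm
  · rintro x _ (_ | _ | _) <;> exact Iff.rfl
  · rintro x _ (⟨f, k, j⟩ | ⟨f, k⟩ | ⟨b, l⟩) d e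
    · cases d with
      | true =>
        refine ⟨_, .refl _, ?_⟩
        rw [next_main (q' := .pick false) (p := false) rfl rfl]
        have := CtlRel.pick (n := n) false k (j + 1)
        rw [trList_two_pow_cons] at this ⊢
        cases j <;> exact this
      | false =>
        obtain ⟨w, h1, h2⟩ := exists_run_verdict (c := c) (res k j) (hc k j)
        refine ⟨w, ?_, h2⟩
        rw [next_main (q' := .run (tr (trNormal c .halt)) none) (p := false) rfl rfl]
        rw [trList_two_pow_cons] at h1 ⊢
        cases j <;> exact h1
    · obtain ⟨w, h1, h2⟩ := exists_run_verdict (c := c) (res k e) (hc k e)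
      refine ⟨w, ?_, h2⟩
      rw [next_main (q' := .run (tr (trNormal c .halt)) none) (p := true) rfl rfl]
      rw [trList_two_pow_cons] at h1
      rw [show pumped true Γ'.bit0 e = List.replicate e .bit0 from rfl]
      rw [trList_two_pow_cons] at h1 ⊢
      cases n <;> simpa [List.replicate_succ] using h1
    · refine ⟨_, .refl _, ?_⟩
      rw [next_main (q' := .sink b) (p := false) rfl rfl]
      exact .sink b _

end MultiBuffer

/-! ### A program for the verdicts of all games -/

namespace MultiBuffer

open Turing Turing.PartrecToTM2

/-- A configuration of a machine: state, tape left of the head (nearest symbol first), and tape from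
the head on. -/
abbrev TapeLists := ℕ × List ℕ × List ℕ

/-- The effect of a row of a table. -/
def applyRow (x : ℕ × (Bool ⊕ ℕ)) (L R : List ℕ) : TapeLists :=
  (x.1, Sum.casesOn x.2
    (fun d => cond d (R.headI :: L, R.tail) (L.tail, L.headI :: R)) (fun b => (L, b :: R.tail)))

/-- One step of the machine given by a table. -/
def TMTable.stepLists (T : TMTable) (c : TapeLists) : Option TapeLists :=
  (T.filter fun r => r.1 = (c.1, c.2.2.headI)).head?.map fun r => applyRow r.2 c.2.1 c.2.2

/-- `t` steps of the machine, if it does not halt before. -/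
def TMTable.iterLists (T : TMTable) (w : List ℕ) (t : ℕ) : TapeLists :=
  (fun c => (T.stepLists c).getD c)^[t] (0, [], w)

/-- Whether the machine accepts, if it halts in at most `t` steps. -/
def TMTable.answer (T : TMTable) (w : List ℕ) (t : ℕ) : Option Bool :=
  if T.stepLists (T.iterLists w t) = none then some ((T.iterLists w t).1 = 1) else none

/-- The configuration that is represented by lists. -/
def TapeLists.toCfg (c : TapeLists) : TM0.Cfg ℕ ℕ :=
  ⟨c.1, Tape.mk' (ListBlank.mk c.2.1) (ListBlank.mk c.2.2)⟩

/-- Two lists describe the half tapes up to trailing blanks; beyond their ends, `headI` returns 0,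
which is the blank. -/
theorem step_toCfg (T : TMTable) (c : TapeLists) :
    TM0.step T.toMachine c.toCfg = (T.stepLists c).map TapeLists.toCfg := by
  obtain ⟨q, L, R⟩ := c
  simp only [TM0.step, TapeLists.toCfg, TMTable.toMachine, Tape.mk'_head, ListBlank.head_mk,
    TMTable.stepLists, List.head?_filter, Option.map_map]
  have h : (fun r : (ℕ × ℕ) × ℕ × (Bool ⊕ ℕ) => r.1 == (q, R.headI)) =
      fun r => decide (r.1 = (q, R.headI)) := by
    funext r
    exact beq_eq_decide ..
  rw [h]
  congr 1
  funext ⟨_, q', x⟩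
  rcases x with (_ | _) | b
  all_goals simp [applyRow, ListBlank.cons_mk]; rfl

theorem TMTable.iterLists_succ (T : TMTable) (w : List ℕ) (t : ℕ) :
    T.iterLists w (t + 1) = (T.stepLists (T.iterLists w t)).getD (T.iterLists w t) :=
  Function.iterate_succ_apply' ..

/-- A halted configuration is not changed by further steps. -/
theorem TMTable.answer_succ {T : TMTable} {w : List ℕ} {t : ℕ} {b : Bool}
    (h : b ∈ T.answer w t) : b ∈ T.answer w (t + 1) := by
  by_cases h0 : T.stepLists (T.iterLists w t) = none
  · have : T.iterLists w (t + 1) = T.iterLists w t := by rw [iterLists_succ, h0]; rfl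
    rwa [answer, this]
  · simp [answer, h0] at h

theorem TMTable.answer_mono {T : TMTable} {w : List ℕ} {t t' : ℕ} (ht : t ≤ t') {b : Bool}
    (h : b ∈ T.answer w t) : b ∈ T.answer w t' := by
  induction ht with
  | refl => exact h
  | step _ ih => exact answer_succ ih

theorem TMTable.HaltsIn.exists_answer {T : TMTable} {w : List ℕ} {q : ℕ} (h : T.HaltsIn w q) :
    ∃ t, decide (q = 1) ∈ T.answer w t := by
  obtain ⟨c, hc, rfl⟩ := h
  rw [StateTransition.mem_eval] at hc
  have key : ∃ t, (T.iterLists w t).toCfg = c := by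
    have h1 := hc.1
    clear hc
    induction h1 with
    | refl => exact ⟨0, rfl⟩
    | tail _ h ih =>
      obtain ⟨t, rfl⟩ := ih
      rw [step_toCfg] at h
      obtain ⟨c', h1, h2⟩ := Option.map_eq_some_iff.1 h
      exact ⟨t + 1, by rw [iterLists_succ, h1]; exact h2⟩
  obtain ⟨t, rfl⟩ := key
  refine ⟨t, ?_⟩
  have h2 := hc.2
  rw [step_toCfg, Option.map_eq_none_iff] at h2
  rw [answer, if_pos h2]
  rfl

open Classical in
theorem TMTable.Decides.exists_answer {X : Type} {T : TMTable} {enc : X → List ℕ} {S : Set X}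
    (h : T.Decides enc S) (x : X) : ∃ t, decide (x ∈ S) ∈ T.answer (enc x) t := by
  by_cases hx : x ∈ S
  · simpa [hx] using ((h x).1 hx).exists_answer
  · simpa [hx] using ((h x).2 hx).exists_answer

/-- The verdict on arriving at `w`, as far as it is known after `t` steps. -/
def GameCode.nodeAnswer (R : GameCode) (w : List Bool) (t : ℕ) : Option ℕ :=
  (R.own.answer (encWord w) t).bind fun o =>
    (R.final.answer (encWord w) t).map fun f => 9 + 2 * o.toNat + 4 * f.toNat

/-- The verdict on an illegal move from `u`, as far as it is known after `t` steps. -/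
def GameCode.lostAnswer (R : GameCode) (u : List Bool) (t : ℕ) : Option ℕ :=
  (R.own.answer (encWord u) t).map fun o => 8 + 2 * (!o).toNat

/-- The verdict on a move from `u` to `w`, as far as it is known after `t` steps. -/
def GameCode.moveAnswer (R : GameCode) (u w : List Bool) (t : ℕ) : Option ℕ :=
  (R.edges.answer (encPair (u, w)) t).bind fun e => cond e (R.nodeAnswer w t) (R.lostAnswer u t)

/-- The verdict on the choice of `w`, as far as it is known after `t` steps. -/
def GameCode.verdictAnswer (R : GameCode) (k : Option (List Bool)) (w : List Bool) (t : ℕ) :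
    Option ℕ :=
  Option.casesOn k (if w = R.start then R.nodeAnswer w t else some 8) fun u => R.moveAnswer u w t

theorem GameCode.nodeAnswer_mono {R : GameCode} {w : List Bool} {t t' : ℕ} (ht : t ≤ t') {x : ℕ}
    (h : x ∈ R.nodeAnswer w t) : x ∈ R.nodeAnswer w t' := by
  simp only [nodeAnswer, Option.mem_def, Option.bind_eq_some_iff, Option.map_eq_some_iff] at h ⊢
  obtain ⟨o, ho, f, hf, rfl⟩ := h
  exact ⟨o, TMTable.answer_mono ht ho, f, TMTable.answer_mono ht hf, rfl⟩

theorem GameCode.verdictAnswer_mono {R : GameCode} {k : Option (List Bool)} {w : List Bool}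
    {t t' : ℕ} (ht : t ≤ t') {x : ℕ} (h : x ∈ R.verdictAnswer k w t) :
    x ∈ R.verdictAnswer k w t' := by
  rcases k with _ | u
  · simp only [verdictAnswer] at h ⊢
    split_ifs at h ⊢
    · exact nodeAnswer_mono ht h
    · exact h
  · simp only [verdictAnswer, moveAnswer, Option.mem_def, Option.bind_eq_some_iff] at h ⊢
    obtain ⟨e, he, h⟩ := h
    refine ⟨e, TMTable.answer_mono ht he, ?_⟩
    cases e
    · simp only [cond_false, lostAnswer, Option.map_eq_some_iff] at h ⊢
      obtain ⟨o, ho, rfl⟩ := h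
      exact ⟨o, TMTable.answer_mono ht ho, rfl⟩
    · exact nodeAnswer_mono ht h

open Classical in
theorem GameCode.Represents.exists_nodeAnswer {R : GameCode} {G : BuchiGame} (h : R.Represents G)
    (w : List Bool) : ∃ t,
      (Verdict.node (decide (w ∈ G.Own)) (decide (w ∈ G.Final))).toNat ∈ R.nodeAnswer w t := by
  obtain ⟨t₁, h1⟩ := h.2.2.1.exists_answer w
  obtain ⟨t₂, h2⟩ := h.2.2.2.1.exists_answer w
  refine ⟨max t₁ t₂, ?_⟩
  simp only [nodeAnswer, Option.mem_def, Option.bind_eq_some_iff, Option.map_eq_some_iff]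
  exact ⟨_, TMTable.answer_mono (le_max_left ..) h1, _, TMTable.answer_mono (le_max_right ..) h2,
    rfl⟩

/-- The deciders involved all halt, and by monotonicity the maximum of their running times suffices.
-/
theorem GameCode.Represents.exists_verdictAnswer {R : GameCode} {G : BuchiGame}
    (h : R.Represents G) (k : Option (List Bool)) (w : List Bool) :
    ∃ t, (wordVerdict G k w).toNat ∈ R.verdictAnswer k w t := by
  classical
  obtain ⟨t₁, h1⟩ := h.exists_nodeAnswer w
  rcases k with _ | u
  · by_cases hw : w = G.start
    · refine ⟨t₁, ?_⟩
      simpa only [wordVerdict, if_pos hw, verdictAnswer, h.2.2.2.2] using h1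
    · refine ⟨0, ?_⟩
      simp only [wordVerdict, if_neg hw, verdictAnswer, h.2.2.2.2]
      rfl
  · obtain ⟨t₂, h2⟩ := h.2.1.exists_answer (u, w)
    obtain ⟨t₃, h3⟩ := h.2.2.1.exists_answer u
    refine ⟨max t₂ (max t₁ t₃), ?_⟩
    simp only [verdictAnswer, moveAnswer, Option.mem_def, Option.bind_eq_some_iff]
    refine ⟨_, TMTable.answer_mono (le_max_left ..) h2, ?_⟩
    by_cases he : (u, w) ∈ G.E
    · rw [decide_eq_true he]
      simp only [wordVerdict, if_pos he]
      exact nodeAnswer_mono (by omega) h1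
    · rw [decide_eq_false he]
      simp only [wordVerdict, if_neg he, cond_false, lostAnswer, Option.map_eq_some_iff]
      refine ⟨_, TMTable.answer_mono (by omega) h3, ?_⟩
      simp [Verdict.toNat]

/-! ### Primitive recursiveness of the verdicts after t steps. -/

section Computability

theorem primrec_pow : Primrec₂ ((· ^ ·) : ℕ → ℕ → ℕ) :=
  Primrec₂.unpaired'.1 Nat.Primrec.pow

theorem primrec_toNat : Primrec Bool.toNat := Primrec.dom_finite _

theorem primrec_applyRow : Primrec fun x : (ℕ × (Bool ⊕ ℕ)) × List ℕ × List ℕ =>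
    applyRow x.1 x.2.1 x.2.2 := by
  have hL : Primrec fun x : (ℕ × (Bool ⊕ ℕ)) × List ℕ × List ℕ => x.2.1 := .comp .fst .snd
  have hR : Primrec fun x : (ℕ × (Bool ⊕ ℕ)) × List ℕ × List ℕ => x.2.2 := .comp .snd .snd
  refine .pair (.comp .fst .fst) (.sumCasesOn (.comp .snd .fst) ?_ ?_)
  · exact .cond .snd
      (.pair (Primrec.list_cons.comp (Primrec.list_headI.comp (hR.comp .fst)) (hL.comp .fst))
        (Primrec.list_tail.comp (hR.comp .fst)))
      (.pair (Primrec.list_tail.comp (hL.comp .fst))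
        (Primrec.list_cons.comp (Primrec.list_headI.comp (hL.comp .fst)) (hR.comp .fst)))
  · exact Primrec.pair (hL.comp .fst)
      (Primrec.list_cons.comp .snd (Primrec.list_tail.comp (hR.comp .fst)))

/-- The filter condition depends on the parameter x; written as a `flatMap`, it is primitive
recursive in both arguments. -/
theorem primrec_filter_key : Primrec₂ fun (T : TMTable) (x : ℕ × ℕ) =>
    T.filter fun r => r.1 = x := by
  have : (fun (p : TMTable × (ℕ × ℕ)) => p.1.filter fun r => r.1 = p.2) = fun p =>
      p.1.flatMap fun r => if r.1 = p.2 then [r] else [] := by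
    funext p
    induction p.1 with
    | nil => rfl
    | cons r T ih =>
      rw [List.flatMap_cons, ← ih]
      by_cases h : r.1 = p.2 <;> simp [h]
  show Primrec _
  refine Primrec.of_eq ?_ fun p => (congrFun this p).symm
  refine Primrec.list_flatMap .fst ?_
  refine Primrec.ite (Primrec.eq.comp (.comp .fst .snd) (.comp .snd .fst)) ?_ (.const [])
  exact Primrec.list_cons.comp .snd (.const [])

theorem primrec_stepLists : Primrec₂ TMTable.stepLists := by
  have hc : Primrec fun x : TMTable × TapeLists => x.2.2 := .comp .snd .snd
  refine Primrec.option_map (Primrec.list_head?.comp (primrec_filter_key.comp .fst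
    (.pair (.comp .fst .snd) (Primrec.list_headI.comp (.comp .snd hc))))) ?_
  exact primrec_applyRow.comp (.pair (.comp .snd .snd) (.comp hc .fst))

theorem primrec_iterLists :
    Primrec fun x : (TMTable × List ℕ) × ℕ => x.1.1.iterLists x.1.2 x.2 :=
  .nat_iterate .snd (.pair (.const 0) (.pair (.const []) (.comp .snd .fst)))
    (Primrec.option_getD.comp
      (primrec_stepLists.comp (.comp .fst (.comp .fst .fst)) .snd) .snd)

theorem primrec_answer : Primrec fun x : (TMTable × List ℕ) × ℕ => x.1.1.answer x.1.2 x.2 :=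
  .ite (Primrec.eq.comp (primrec_stepLists.comp (.comp .fst .fst) primrec_iterLists) (.const none))
    (.comp .option_some
      (PrimrecPred.decide (Primrec.eq.comp (.comp .fst primrec_iterLists) (.const 1))))
    (.const none)

theorem primrec_gameCode : Primrec GameCode.equiv := Primrec.of_equiv

theorem primrec_edges : Primrec GameCode.edges :=
  Primrec.fst.comp (Primrec.snd.comp primrec_gameCode)

theorem primrec_own : Primrec GameCode.own :=
  Primrec.fst.comp (Primrec.snd.comp (Primrec.snd.comp primrec_gameCode))

theorem primrec_final : Primrec GameCode.final :=
  Primrec.fst.comp (Primrec.snd.comp (Primrec.snd.comp (Primrec.snd.comp primrec_gameCode)))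

theorem primrec_start : Primrec GameCode.start :=
  Primrec.snd.comp (Primrec.snd.comp (Primrec.snd.comp (Primrec.snd.comp primrec_gameCode)))

theorem primrec_encWord : Primrec encWord :=
  .list_map .id (.cond .snd (.const 2) (.const 1))

theorem primrec_encPair : Primrec encPair :=
  Primrec.list_append.comp (primrec_encWord.comp .fst)
    (Primrec.list_cons.comp (.const 3) (primrec_encWord.comp .snd))

attribute [irreducible] TMTable.answer

theorem primrec_nodeAnswer :
    Primrec fun x : (GameCode × List Bool) × ℕ => x.1.1.nodeAnswer x.1.2 x.2 := by
  have hR : Primrec fun x : (GameCode × List Bool) × ℕ => x.1.1 := .comp .fst .fst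
  have hw : Primrec fun x : (GameCode × List Bool) × ℕ => encWord x.1.2 :=
    primrec_encWord.comp (.comp .snd .fst)
  refine Primrec.option_bind
    (primrec_answer.comp (.pair (.pair (primrec_own.comp hR) hw) .snd)) ?_
  refine Primrec.option_map (primrec_answer.comp
    (.pair (.pair (primrec_final.comp (hR.comp .fst)) (hw.comp .fst)) (.comp .snd .fst))) ?_
  exact Primrec.nat_add.comp (Primrec.nat_add.comp (.const 9) (Primrec.nat_mul.comp (.const 2)
    (primrec_toNat.comp (.comp .snd .fst))))
    (Primrec.nat_mul.comp (.const 4) (primrec_toNat.comp .snd))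

attribute [irreducible] GameCode.nodeAnswer

theorem primrec_edges_answer :
    Primrec fun x : (GameCode × List Bool × List Bool) × ℕ =>
      x.1.1.edges.answer (encPair x.1.2) x.2 := by
  have hw : Primrec fun x : (GameCode × List Bool × List Bool) × ℕ => encPair x.1.2 :=
    primrec_encPair.comp (.comp .snd .fst)
  exact primrec_answer.comp (.pair (.pair (primrec_edges.comp (.comp .fst .fst)) hw) .snd)

theorem primrec_lostAnswer :
    Primrec fun x : (GameCode × List Bool) × ℕ => x.1.1.lostAnswer x.1.2 x.2 := by
  have hw : Primrec fun x : (GameCode × List Bool) × ℕ => encWord x.1.2 :=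
    primrec_encWord.comp (.comp .snd .fst)
  refine Primrec.option_map
    (primrec_answer.comp (.pair (.pair (primrec_own.comp (.comp .fst .fst)) hw) .snd)) ?_
  exact Primrec.nat_add.comp (.const 8) (Primrec.nat_mul.comp (.const 2)
    (primrec_toNat.comp (Primrec.not.comp .snd)))

attribute [irreducible] GameCode.lostAnswer

theorem primrec_moveAnswer :
    Primrec fun x : (GameCode × List Bool × List Bool) × ℕ =>
      x.1.1.moveAnswer x.1.2.1 x.1.2.2 x.2 := by
  have hR : Primrec fun x : (GameCode × List Bool × List Bool) × ℕ => x.1.1 := .comp .fst .fst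
  have hw : Primrec fun x : (GameCode × List Bool × List Bool) × ℕ => x.1.2.2 :=
    .comp .snd (.comp .snd .fst)
  have hu : Primrec fun x : (GameCode × List Bool × List Bool) × ℕ => x.1.2.1 :=
    .comp .fst (.comp .snd .fst)
  have hn : Primrec fun x : (GameCode × List Bool × List Bool) × ℕ =>
      x.1.1.nodeAnswer x.1.2.2 x.2 := primrec_nodeAnswer.comp (.pair (.pair hR hw) .snd)
  have hl : Primrec fun x : (GameCode × List Bool × List Bool) × ℕ =>
      x.1.1.lostAnswer x.1.2.1 x.2 := primrec_lostAnswer.comp (.pair (.pair hR hu) .snd)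
  exact Primrec.option_bind primrec_edges_answer (.cond .snd (hn.comp .fst) (hl.comp .fst))

attribute [irreducible] GameCode.moveAnswer

theorem primrec_verdictAnswer :
    Primrec fun x : (GameCode × Option (List Bool) × List Bool) × ℕ =>
      x.1.1.verdictAnswer x.1.2.1 x.1.2.2 x.2 := by
  have hR : Primrec fun x : (GameCode × Option (List Bool) × List Bool) × ℕ => x.1.1 :=
    .comp .fst .fst
  have hw : Primrec fun x : (GameCode × Option (List Bool) × List Bool) × ℕ => x.1.2.2 :=
    .comp .snd (.comp .snd .fst)
  have hn : Primrec fun x : (GameCode × Option (List Bool) × List Bool) × ℕ =>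
      x.1.1.nodeAnswer x.1.2.2 x.2 := primrec_nodeAnswer.comp (.pair (.pair hR hw) .snd)
  refine Primrec.option_casesOn (.comp .fst (.comp .snd .fst))
    (.ite (Primrec.eq.comp hw (primrec_start.comp hR)) hn (.const (some 8))) ?_
  exact primrec_moveAnswer.comp
    (.pair (.pair (hR.comp .fst) (.pair .snd (hw.comp .fst))) (.comp .snd .fst))

end Computability

attribute [irreducible] GameCode.verdictAnswer

/-! ### One program for all games. -/

/-- The exponent of a power of two. -/
def exponent (x : ℕ) : ℕ := Nat.findGreatest (fun k => 2 ^ k ≤ x) x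

theorem exponent_two_pow (k : ℕ) : exponent (2 ^ k) = k := by
  refine Nat.findGreatest_eq_iff.2 ⟨Nat.lt_two_pow_self.le, fun _ => le_rfl, fun n hn _ h => ?_⟩
  exact absurd (Nat.pow_lt_pow_right (a := 2) (by norm_num) hn) (by omega)

theorem primrec_exponent : Primrec exponent :=
  .nat_findGreatest .id (Primrec.nat_le.comp (primrec_pow.comp (.const 2) .snd) .fst)

/-- The word with a given number. -/
def wordOf (j : ℕ) : List Bool := (Encodable.decode (α := List Bool) j).getD []

theorem wordOf_surjective : Function.Surjective wordOf := fun w =>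
  ⟨Encodable.encode w, by simp [wordOf]⟩

theorem primrec_wordOf : Primrec wordOf := Primrec.option_getD.comp .decode (.const [])

/-- The verdict on a move, as far as it is known after `t` steps, for numbers that represent the
target, the game and the source. -/
def vectorVerdict (v : List.Vector ℕ 3) (t : ℕ) : Option ℕ :=
  (Encodable.decode (α := GameCode) (exponent (v.get 1))).bind fun R =>
    R.verdictAnswer (if v.get 2 = 0 then none else some (wordOf (exponent (v.get 2))))
      (wordOf (exponent (v.get 0))) t

theorem primrec_vectorVerdict : Primrec₂ vectorVerdict := by
  have hv (i : Fin 3) : Primrec fun x : List.Vector ℕ 3 × ℕ => x.1.get i :=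
    Primrec.vector_get.comp .fst (.const i)
  refine Primrec.option_bind (Primrec.decode.comp (primrec_exponent.comp (hv 1))) ?_
  refine primrec_verdictAnswer.comp (.pair (.pair .snd (.pair (.ite (Primrec.eq.comp
    ((hv 2).comp .fst) (.const 0)) (.const none) (.comp .option_some (primrec_wordOf.comp
      (primrec_exponent.comp ((hv 2).comp .fst))))) (primrec_wordOf.comp
      (primrec_exponent.comp ((hv 0).comp .fst))))) (.comp .snd .fst))

/-- An unbounded search for t thus returns the correct verdict, whichever t it finds first. -/
theorem vectorVerdict_mono {v : List.Vector ℕ 3} {t t' : ℕ} (ht : t ≤ t') {x : ℕ}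
    (h : x ∈ vectorVerdict v t) : x ∈ vectorVerdict v t' := by
  simp only [vectorVerdict, Option.mem_def, Option.bind_eq_some_iff] at h ⊢
  obtain ⟨R, hR, h⟩ := h
  exact ⟨R, hR, GameCode.verdictAnswer_mono ht h⟩

/-- The program decodes the game from its input and searches for a number of steps after which the
verdict is known. The search terminates because the game is represented by deciders. -/
theorem exists_verdict_code : ∃ c : ToPartrec.Code, ∀ (R : GameCode) (G : BuchiGame),
    R.Represents G → ∀ k j, [(numVerdict G wordOf k j).toNat, 2 ^ Encodable.encode R, 2 ^ j] ∈
      c.eval [2 ^ j, 2 ^ Encodable.encode R, nodeNum k] := by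
  have h1 : Partrec fun v : List.Vector ℕ 3 => Nat.rfindOpt (vectorVerdict v) :=
    Partrec.rfindOpt primrec_vectorVerdict.to_comp
  obtain ⟨c, hc⟩ := ToPartrec.Code.exists_code (Nat.Partrec'.part_iff.2 h1)
  -- The output consists of the verdict, the second input (the game) and the first input (the
  -- target, which becomes the current node).
  refine ⟨.cons c (.cons (.comp .head .tail) .head), fun R G h k j => ?_⟩
  have h2 : (numVerdict G wordOf k j).toNat ∈
      Nat.rfindOpt (vectorVerdict ⟨[2 ^ j, 2 ^ Encodable.encode R, nodeNum k], rfl⟩) := by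
    refine (Nat.rfindOpt_mono fun ht hx => vectorVerdict_mono ht hx).2 ?_
    obtain ⟨t, ht⟩ := h.exists_verdictAnswer (k.map wordOf) (wordOf j)
    refine ⟨t, ?_⟩
    simp only [vectorVerdict, Option.mem_def, Option.bind_eq_some_iff]
    refine ⟨R, ?_, ?_⟩
    · show Encodable.decode (exponent (2 ^ Encodable.encode R)) = some R
      rw [exponent_two_pow, Encodable.encodek]
    · have h3 : (if nodeNum k = 0 then none else some (wordOf (exponent (nodeNum k)))) =
          k.map wordOf := by
        cases k <;> simp [nodeNum, exponent_two_pow]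
      show R.verdictAnswer (if nodeNum k = 0 then none else some (wordOf (exponent (nodeNum k))))
        (wordOf (exponent (2 ^ j))) t = _
      rw [h3, exponent_two_pow]
      exact ht
  have h3 := hc ⟨[2 ^ j, 2 ^ Encodable.encode R, nodeNum k], rfl⟩
  simp only at h3
  rw [Part.eq_some_iff.2 h2] at h3
  have h4 : (ToPartrec.Code.comp .head .tail).eval
      [2 ^ j, 2 ^ Encodable.encode R, nodeNum k] = pure [2 ^ Encodable.encode R] := by
    rw [ToPartrec.Code.comp_eval, ToPartrec.Code.tail_eval]
    refine (Part.bind_some ..).trans ?_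
    rw [ToPartrec.Code.head_eval]
    rfl
  simp [ToPartrec.Code.cons_eval, h3, h4]


end MultiBuffer

/-! ### Codes of automata -/

namespace MultiBuffer

theorem letter_val_injective (m : ℕ) : Function.Injective
    (Sum.map Fin.val (Option.map Fin.val) : Letter m → ℕ ⊕ Option ℕ) :=
  Sum.map_injective.2 ⟨Fin.val_injective, Option.map_injective Fin.val_injective⟩

/-- A finite set of states closed under the steps is enumerated. This is a pure existence statement;
it will be applied only to automata that do not depend on the game. -/
theorem exists_nbaCode {X : Type} {m : ℕ} (step : X → Letter m → X → Prop) (acc : X → Prop)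
    {D : Set X} (hD : D.Finite) (hcl : ∀ x ∈ D, ∀ a y, step x a y → y ∈ D) {x₀ : X} (h₀ : x₀ ∈ D) :
    ∃ (d : NBACode) (dec : Fin (d.lastState + 1) → X), dec 0 = x₀ ∧
      Decodes (d.toNBA m) dec step acc := by
  classical
  have := hD.fintype
  have : Nonempty D := ⟨⟨x₀, h₀⟩⟩
  obtain ⟨N, hN⟩ : ∃ N, Fintype.card D = N + 1 :=
    Nat.exists_eq_succ_of_ne_zero Fintype.card_ne_zero
  -- The transposition gives the initial state the number 0.
  let e := (Fintype.equivFinOfCardEq hN).trans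
    (Equiv.swap (Fintype.equivFinOfCardEq hN ⟨x₀, h₀⟩) 0)
  have he : e ⟨x₀, h₀⟩ = 0 := by simp [e]
  let dec : Fin (N + 1) → X := fun i => e.symm i
  let t : Finset (Fin (N + 1) × Letter m × Fin (N + 1)) :=
    Finset.univ.filter fun r => step (dec r.1) r.2.1 (dec r.2.2)
  let f : Finset (Fin (N + 1)) := Finset.univ.filter fun i => acc (dec i)
  refine ⟨⟨N, t.toList.map fun r => (r.1, Sum.map Fin.val (Option.map Fin.val) r.2.1, r.2.2),
    f.toList.map Fin.val⟩, dec, ?_, ?_⟩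
  · show ((e.symm 0 : D) : X) = x₀
    rw [← he, Equiv.symm_apply_apply]
  · have key : ∀ (p : Fin (N + 1)) (a : Letter m) (q : Fin (N + 1)),
        ((p : ℕ), Sum.map Fin.val (Option.map Fin.val) a, (q : ℕ)) ∈
          (t.toList.map fun r => ((r.1 : ℕ), Sum.map Fin.val (Option.map Fin.val) r.2.1,
            (r.2.2 : ℕ))) ↔ step (dec p) a (dec q) := by
      intro p a q
      simp only [List.mem_map, Finset.mem_toList, Prod.mk.injEq]
      constructor
      · rintro ⟨⟨p', a', q'⟩, h, h1, h2, h3⟩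
        obtain rfl := Fin.val_injective h1
        obtain rfl := letter_val_injective m h2
        obtain rfl := Fin.val_injective h3
        simpa [t] using h
      · intro h
        exact ⟨(p, a, q), by simpa [t] using h, rfl, rfl, rfl⟩
    refine ⟨fun p a q h => (key p a q).1 h, fun p a y h => ?_, fun p => ?_⟩
    · have hy : y ∈ D := hcl _ (e.symm p).2 a y h
      have hd : dec (e ⟨y, hy⟩) = y := by simp [dec]
      exact ⟨e ⟨y, hy⟩, (key p a _).2 (hd.symm ▸ h), hd⟩
    · show (p : ℕ) ∈ f.toList.map Fin.val ↔ _
      rw [List.mem_map_of_injective Fin.val_injective]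
      simp [f]

/-- The automaton that first reads the word `w` and then behaves like `d`. -/
def prefixCode (w : List ℕ) (d : NBACode) : NBACode where
  lastState := w.length + d.lastState
  trans := ((List.range w.length).map fun i => (i, Sum.inl (w.getD i 0), i + 1)) ++
    d.trans.map fun r => (r.1 + w.length, r.2.1, r.2.2 + w.length)
  acc := List.range w.length ++ d.acc.map fun i => i + w.length

variable {S : Type} {m : ℕ} {G : QueueGame S m}

/-- State i < |w| stands for having to write the remaining letters of w from index i on; state |w|
is the initial state of `d`, with nothing left to write. -/
theorem exists_decodes_prefixCode {d : NBACode} {dec : Fin (d.lastState + 1) → SpState S m}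
    {s₀ : S} (hd : Decodes (d.toNBA m) dec (SpStep G) SpState.Acc)
    (h₀ : dec 0 = .push false s₀ []) (w : List (Fin m)) :
    ∃ dec', Decodes ((prefixCode (w.map Fin.val) d).toNBA m) dec' (SpStep G) SpState.Acc ∧
      dec' 0 = .push false s₀ w := by
  have hlen : (w.map Fin.val).length = w.length := List.length_map ..
  have hlast : (prefixCode (w.map Fin.val) d).lastState = w.length + d.lastState := by
    simp [prefixCode]
  let dec' : Fin ((prefixCode (w.map Fin.val) d).lastState + 1) → SpState S m := fun i =>
    if (i : ℕ) < w.length then .push false s₀ (w.drop i)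
    else dec ⟨i - w.length, by have := i.2; omega⟩
  have hlt {i : Fin (_ + 1)} (h : (i : ℕ) < w.length) : dec' i = .push false s₀ (w.drop i) := if_pos h
  have hge {i : Fin (_ + 1)} (j : Fin (d.lastState + 1)) (h : (i : ℕ) = j + w.length) : dec' i = dec j := by
    refine (if_neg (by omega)).trans (congrArg dec (Fin.ext ?_))
    simp [h]
  -- At i = |w| both descriptions of the state agree, which joins the prefix to `d`.
  have hle {i : Fin (_ + 1)} (h : (i : ℕ) ≤ w.length) : dec' i = .push false s₀ (w.drop i) := by
    rcases h.lt_or_eq with h | h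
    · exact hlt h
    · rw [hge 0 (by simp [h]), h₀, h, List.drop_length]
  have hget {i : ℕ} (h : i < w.length) : (w.map Fin.val).getD i 0 = w[i] := by
    simp [List.getD_eq_getElem?_getD, h]
  have hmem (i j : Fin ((prefixCode (w.map Fin.val) d).lastState + 1)) (a : Letter m) :
      j ∈ ((prefixCode (w.map Fin.val) d).toNBA m).δ i a ↔
        (∃ h : (i : ℕ) < w.length, a = .inl w[i] ∧ (j : ℕ) = i + 1) ∨
        ∃ i' j' : Fin (d.lastState + 1), (i : ℕ) = i' + w.length ∧ (j : ℕ) = j' + w.length ∧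
          j' ∈ (d.toNBA m).δ i' a := by
    show (_, _, _) ∈ (prefixCode (w.map Fin.val) d).trans ↔ _
    simp only [prefixCode, List.mem_append, List.mem_map, List.mem_range, hlen, Prod.mk.injEq]
    refine or_congr ⟨?_, ?_⟩ ⟨?_, ?_⟩
    · rintro ⟨k, hk, rfl, h1, h2⟩
      refine ⟨hk, letter_val_injective m ?_, h2.symm⟩
      rw [← h1, hget hk]
      rfl
    · rintro ⟨h, rfl, h2⟩
      exact ⟨i, h, rfl, by rw [hget h]; rfl, h2.symm⟩
    · rintro ⟨⟨p, b, q⟩, h, h1, h2, h3⟩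
      have := i.2
      have := j.2
      simp only at h1 h2 h3
      subst h2
      exact ⟨⟨p, by omega⟩, ⟨q, by omega⟩, h1.symm, h3.symm, h⟩
    · rintro ⟨i', j', h1, h2, h⟩
      exact ⟨_, h, h1.symm, rfl, h2.symm⟩
  refine ⟨dec', ⟨fun p a p' h => ?_, fun p a y h => ?_, fun p => ?_⟩, ?_⟩
  · obtain ⟨hp, rfl, hj⟩ | ⟨i', j', h1, h2, h3⟩ := (hmem _ _ _).1 h
    · rw [hlt hp, hle (by omega), hj, List.drop_eq_getElem_cons hp]
      exact .push ..
    · rw [hge i' h1, hge j' h2]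
      exact hd.sound _ _ _ h3
  · by_cases hp : (p : ℕ) < w.length
    · rw [hlt hp, List.drop_eq_getElem_cons hp] at h
      cases h
      refine ⟨⟨p + 1, by omega⟩, (hmem _ _ _).2 (.inl ⟨hp, rfl, rfl⟩), hle hp⟩
    · have := p.2
      let i' : Fin (d.lastState + 1) := ⟨p - w.length, by omega⟩
      have hi : (p : ℕ) = i' + w.length := by simp only [i']; omega
      rw [hge i' hi] at h
      obtain ⟨j', h1, h2⟩ := hd.complete _ _ _ h
      have := j'.2
      exact ⟨⟨j' + w.length, by omega⟩, (hmem _ _ _).2 (.inr ⟨i', j', hi, rfl, h1⟩),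
        (hge j' rfl).trans h2⟩
  · show (p : ℕ) ∈ (prefixCode (w.map Fin.val) d).acc ↔ _
    simp only [prefixCode, List.mem_append, List.mem_map, List.mem_range, hlen]
    by_cases hp : (p : ℕ) < w.length
    · simp [hlt hp, hp, SpState.Acc]
    · have := p.2
      let i' : Fin (d.lastState + 1) := ⟨p - w.length, by omega⟩
      have hi : (p : ℕ) = i' + w.length := by simp only [i']; omega
      rw [hge i' hi, ← hd.acc_iff]
      show _ ↔ (i' : ℕ) ∈ d.acc
      constructor
      · rintro (h | ⟨k, hk, h⟩)
        · exact absurd h hp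
        · rwa [show (i' : ℕ) = k by omega]
      · exact fun h => .inr ⟨_, h, hi.symm⟩
  · exact (hle (Nat.zero_le _)).trans rfl

theorem primrec_nbaCode_mk {α : Type} [Primcodable α] {f : α → ℕ}
    {g : α → List (ℕ × (ℕ ⊕ Option ℕ) × ℕ)} {h : α → List ℕ} (hf : Primrec f) (hg : Primrec g)
    (hh : Primrec h) : Primrec fun a => NBACode.mk (f a) (g a) (h a) :=
  (Primrec.of_equiv_symm (e := NBACode.equiv)).comp (hf.pair (hg.pair hh))

theorem primrec_prefixCode (d : NBACode) : Primrec fun w => prefixCode w d := by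
  have hl : Primrec (List.length : List ℕ → ℕ) := .list_length
  refine primrec_nbaCode_mk (Primrec.nat_add.comp hl (.const _)) ?_ ?_
  · refine Primrec.list_append.comp (.list_map (Primrec.list_range.comp hl) ?_)
      (.list_map (.const _) ?_)
    · exact Primrec.pair .snd (.pair (Primrec.sumInl.comp ((Primrec.list_getD 0).comp .fst .snd))
        (Primrec.succ.comp .snd))
    · exact Primrec.pair (Primrec.nat_add.comp (.comp .fst .snd) (hl.comp .fst))
        (.pair (.comp .fst (.comp .snd .snd))
          (Primrec.nat_add.comp (.comp .snd (.comp .snd .snd)) (hl.comp .fst)))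
  · exact Primrec.list_append.comp (Primrec.list_range.comp hl)
      (.list_map (.const _) (Primrec.nat_add.comp .snd (hl.comp .fst)))

/-- If finitely many states are closed under `δ`, then there are automata for the queue game. -/
theorem QueueGame.exists_codes (G : QueueGame S m) {T : Set S} (hT : T.Finite)
    (hcl : ∀ s ∈ T, ∀ x d, (G.δ s x d).1 ∈ T) {s₀ : S} (h₀ : s₀ ∈ T) :
    ∃ (dA dB : NBACode) (decA : Fin (dA.lastState + 1) → SpState S m)
      (decB : Fin (dB.lastState + 1) → DupState S m),
      Decodes (dA.toNBA m) decA (SpStep G) SpState.Acc ∧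
      Decodes (dB.toNBA m) decB (DupStep G) (DupState.Acc G) ∧
      decA 0 = .push false s₀ [] ∧ decB 0 = .base s₀ := by
  -- On the finite set `T`, the transition function produces finitely many words; their maximal
  -- length bounds what Spoiler has to remember.
  obtain ⟨L, hL⟩ : ∃ L, ∀ s ∈ T, ∀ x d, (G.δ s x d).2.2.length ≤ L := by
    obtain ⟨L, hL⟩ := ((hT.prod (Set.finite_univ (α := Fin m × Bool))).image
      fun z => (G.δ z.1 z.2.1 z.2.2).2.2.length).bddAbove
    exact ⟨L, fun s hs x d => hL ⟨(s, x, d), ⟨hs, trivial⟩, rfl⟩⟩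
  let DA : Set (SpState S m) := (fun z : Bool × S × List (Fin m) => .push z.1 z.2.1 z.2.2) ''
      (Set.univ ×ˢ T ×ˢ {r | r.length ≤ L}) ∪
    (fun z : S × Fin m => .got z.1 z.2) '' (T ×ˢ Set.univ)
  have hDA : DA.Finite := ((Set.finite_univ.prod (hT.prod (List.finite_length_le _ L))).image _).union
    ((hT.prod Set.finite_univ).image _)
  have mem_push {p s r} : SpState.push p s r ∈ DA ↔ s ∈ T ∧ r.length ≤ L := by simp [DA]
  have mem_got {s x} : SpState.got s x ∈ DA ↔ s ∈ T := by simp [DA]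
  let DB : Set (DupState S m) := (DupState.base '' T) ∪
    (fun z : S × Fin m => .got z.1 z.2) '' (T ×ˢ Set.univ) ∪
    (fun z : S × Fin m × Bool => .chose z.1 z.2.1 z.2.2) '' (T ×ˢ Set.univ) ∪ {.win}
  have hDB : DB.Finite := (((hT.image _).union ((hT.prod Set.finite_univ).image _)).union
    ((hT.prod Set.finite_univ).image _)).union (Set.finite_singleton _)
  have mem_base {s} : DupState.base s ∈ DB ↔ s ∈ T := by simp [DB]
  have mem_got' {s x} : DupState.got s x ∈ DB ↔ s ∈ T := by simp [DB]
  have mem_chose {s x d} : DupState.chose s x d ∈ DB ↔ s ∈ T := by simp [DB]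
  have mem_win : DupState.win ∈ DB := by simp [DB]
  obtain ⟨dA, decA, hA₀, hA⟩ := exists_nbaCode (SpStep G) SpState.Acc hDA (by
    rintro x hx a y (⟨p, s, x, r⟩ | ⟨s, r⟩ | ⟨p, s, x⟩ | ⟨s, x, d⟩)
    · have := mem_push.1 hx
      exact mem_push.2 ⟨this.1, by simp at this; omega⟩
    · exact hx
    · exact mem_got.2 (mem_push.1 hx).1
    · exact mem_push.2 ⟨hcl _ (mem_got.1 hx) x d, hL _ (mem_got.1 hx) x d⟩)
    (x₀ := .push false s₀ []) (mem_push.2 ⟨h₀, Nat.zero_le _⟩)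
  obtain ⟨dB, decB, hB₀, hB⟩ := exists_nbaCode (DupStep G) (DupState.Acc G) hDB (by
    rintro x hx a y (⟨s, x⟩ | ⟨s, x, d⟩ | ⟨s, x, z, h⟩ | ⟨s, x, d⟩ | ⟨s, x, d, z, h⟩ | ⟨a⟩)
    · exact mem_got'.2 (mem_base.1 hx)
    · exact mem_chose.2 (mem_got'.1 hx)
    · exact mem_win
    · exact mem_base.2 (hcl _ (mem_chose.1 hx) x d)
    · exact mem_win
    · exact hx)
    (x₀ := .base s₀) (mem_base.2 h₀)
  exact ⟨dA, dB, decA, decB, hA, hB, hA₀, hB₀⟩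

end MultiBuffer

/-! ### The control states of the stack game -/

namespace MultiBuffer

open Turing Turing.PartrecToTM2

/-- The control states that can occur. -/
inductive Ctl.Occurs (c : ToPartrec.Code) : Ctl → Prop
  | init : Occurs c .init
  | run {q : TM2.Stmt (fun _ : K' => Γ') Λ' (Option Γ')} (v : Option Γ')
      (h : some q ∈ TM2.stmts tr (codeSupp c .halt)) : Occurs c (.run q v)
  | rd {acc : List Γ'} (h : acc.length ≤ 4) : Occurs c (.rd acc)
  | pick (f : Bool) : Occurs c (.pick f)
  | spick (f : Bool) : Occurs c (.spick f)
  | sink (b : Bool) : Occurs c (.sink b)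

variable {c : ToPartrec.Code}

theorem finite_occurs (c : ToPartrec.Code) : {q | Ctl.Occurs c q}.Finite := by
  have h1 : {z : TM2.Stmt (fun _ : K' => Γ') Λ' (Option Γ') × Option Γ' |
      some z.1 ∈ TM2.stmts tr (codeSupp c .halt)}.Finite :=
    ((((TM2.stmts tr (codeSupp c .halt)).finite_toSet.preimage
      (Option.some_injective _).injOn).prod (Set.finite_univ (α := Option Γ'))).subset
        fun z hz => ⟨hz, trivial⟩)
  refine (((((Set.finite_singleton Ctl.init).union (h1.image fun z => Ctl.run z.1 z.2)).union
    ((List.finite_length_le Γ' 4).image Ctl.rd)).union (Set.finite_range Ctl.pick)).union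
    ((Set.finite_range Ctl.spick).union (Set.finite_range Ctl.sink))).subset ?_
  rintro q (_ | ⟨v, h⟩ | h | f | f | b)
  · simp
  · exact .inl (.inl (.inl (.inr ⟨(_, v), h, rfl⟩)))
  · exact .inl (.inl (.inr ⟨_, h, rfl⟩))
  · simp
  · simp
  · simp

theorem occurs_afterRead (l : List Γ') : Ctl.Occurs c (afterRead l).1 := by
  unfold afterRead
  split <;> constructor

theorem occurs_tr {l : Λ'} (h : l ∈ codeSupp c .halt) (v : Option Γ') :
    Ctl.Occurs c (.run (tr l) v) := by
  classical
  exact .run v (Finset.some_mem_insertNone.2 (Finset.mem_biUnion.2 ⟨l, h, TM2.stmts₁_self⟩))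

/-- The finite set `codeSupp` supports the machine: the jumps of its statements stay inside. This
restricts the infinite type `Ctl` to finitely many control states. -/
theorem occurs_act {q : Ctl} (hq : Ctl.Occurs c q) (o : Option Γ') (d : Bool) :
    Ctl.Occurs c ((codeGame c).act q o d).1 := by
  have hstart : Ctl.Occurs c (.run (tr (trNormal c .halt)) none) :=
    occurs_tr (tr_supports c .halt).1 none
  cases hq with
  | init => exact .pick _
  | @run q v h =>
    have hs := @TM2.stmts_supportsStmt _ _ _ _ ⟨trNormal c .halt⟩ _ _ _ (tr_supports c .halt) h
    have sub {q'} (h' : q' ∈ TM2.stmts₁ q) (v' : Option Γ') : Ctl.Occurs c (.run q' v') :=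
      .run v' (TM2.stmts_trans h' h)
    cases q with
    | push k f q => exact sub (by simp [TM2.stmts₁, TM2.stmts₁_self]) _
    | peek k f q => exact sub (by simp [TM2.stmts₁, TM2.stmts₁_self]) _
    | pop k f q => exact sub (by simp [TM2.stmts₁, TM2.stmts₁_self]) _
    | load f q => exact sub (by simp [TM2.stmts₁, TM2.stmts₁_self]) _
    | branch f q₁ q₂ =>
      refine sub ?_ _
      cases f v <;> simp [TM2.stmts₁, TM2.stmts₁_self]
    | goto l => exact occurs_tr (hs v) v
    | halt => exact .rd (Nat.zero_le _)
  | @rd acc h =>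
    simp only [codeGame]
    split_ifs with h1
    · refine .rd ?_
      have : o.toList.length ≤ 1 := by cases o <;> simp
      simp only [List.length_append]
      omega
    · exact occurs_afterRead acc
  | pick f =>
    cases d
    · exact hstart
    · exact .pick _
  | spick f => exact hstart
  | sink b => exact .sink b

theorem nonempty_equiv_fin : Nonempty (K' ⊕ Γ' ≃ Fin 8) := by
  have : Fintype K' := ⟨{.main, .rev, .aux, .stack}, fun x => by cases x <;> simp⟩
  refine ⟨Fintype.equivFinOfCardEq ?_⟩
  have h : Fintype.card K' = 4 := by
    rw [← Finset.card_univ, show (Finset.univ : Finset K') = {.main, .rev, .aux, .stack} from ?_]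
    · rfl
    · ext x
      cases x <;> simp
  rw [Fintype.card_sum, h]
  rfl

/-- The initial queue for the game with number `n`. -/
def initialQueue (en : K' ⊕ Γ' ≃ Fin 8) (n : ℕ) : List (Fin 8) :=
  blocks en (mainStack (trList [2 ^ n, 0])) [.main, .aux, .stack] ++ [en (.inl .rev)]

/-- Only the block of n letters for the zeros of 2^n varies with n; the other parts are constants.
-/
theorem primrec_initialQueue (en : K' ⊕ Γ' ≃ Fin 8) :
    Primrec fun n => (initialQueue en n).map Fin.val := by
  have h : Primrec fun n : ℕ => [(en (.inl .main)).val] ++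
      ((List.range n).map (fun _ => (en (.inr .bit0)).val) ++
        (([Γ'.bit1, .cons, .cons].map fun a => (en (.inr a)).val) ++
          ([K'.aux, .stack, .rev].map fun k => (en (.inl k)).val))) :=
    Primrec.list_append.comp (.const _) (Primrec.list_append.comp
      (.list_map .list_range (Primrec.const _).to₂) (.const _))
  refine h.of_eq fun n => ?_
  simp [initialQueue, blocks, stackWord, mainStack, trNat_two_pow, trList]

theorem win_initialQueue_iff (en : K' ⊕ Γ' ≃ Fin 8) (c : ToPartrec.Code) (n : ℕ) :
    ((codeGame c).toQueueGame en).arena.Win (.seek .init, initialQueue en n) ↔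
      (codeGame c).arena.Win (.init, mainStack (trList [2 ^ n, 0])) := by
  have : Nontrivial K' := ⟨.main, .rev, by simp⟩
  refine win_toQueueGame_iff (codeGame c) .init rfl (by simp) fun i => ?_
  cases i <;> simp

/-- Markers are always put back, so a marker can play the role of the letter `g` that keeps the
queue from becoming empty. -/
theorem mem_marker {Q K Γ : Type} [DecidableEq K] {m : ℕ} (G : StackGame Q K Γ)
    (en : K ⊕ Γ ≃ Fin m) (k : K) (s : QueueState Q) (d : Bool) :
    en (.inl k) ∈ ((G.toQueueGame en).δ s (en (.inl k)) d).2.2 := by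
  cases s with
  | seek q => exact List.mem_singleton.2 rfl
  | look q => simp [StackGame.toQueueGame]

/-- The automata depend on the program only; n enters solely through the word that Spoiler writes
first. -/
theorem exists_automata (c : ToPartrec.Code) : ∃ (m : ℕ) (w : ℕ → List ℕ) (dA dB : NBACode),
    Primrec w ∧ ∀ n, Simulated (sigma12 m) ![⊤, 0] ((prefixCode (w n) dA).toNBA m) (dB.toNBA m) ↔
      (codeGame c).arena.Win (.init, mainStack (trList [2 ^ n, 0])) := by
  obtain ⟨en⟩ := nonempty_equiv_fin
  have hfin : ({q | ∃ q', Ctl.Occurs c q' ∧ (q = .seek q' ∨ q = .look q')} :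
      Set (QueueState Ctl)).Finite :=
    (((finite_occurs c).image .seek).union ((finite_occurs c).image .look)).subset <| by
      rintro _ ⟨q, h, rfl | rfl⟩
      · exact .inl ⟨q, h, rfl⟩
      · exact .inr ⟨q, h, rfl⟩
  obtain ⟨dA, dB, decA, decB, hA, hB, hA₀, hB₀⟩ := ((codeGame c).toQueueGame en).exists_codes hfin
    (by
      rintro _ ⟨q, h, rfl | rfl⟩ x d
      · refine ⟨q, h, ?_⟩
        simp only [StackGame.toQueueGame]
        split_ifs
        · exact .inr rfl
        · exact .inl rfl
      · simp only [StackGame.toQueueGame]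
        cases en.symm x with
        | inl k => exact ⟨_, occurs_act h none d, .inl rfl⟩
        | inr a => exact ⟨_, occurs_act h (some a) d, .inl rfl⟩)
    (s₀ := .seek .init) ⟨_, .init, .inl rfl⟩
  refine ⟨8, fun n => (initialQueue en n).map Fin.val, dA, dB, primrec_initialQueue en, fun n => ?_⟩
  obtain ⟨decA', hA', hA₀'⟩ := exists_decodes_prefixCode hA hA₀ (initialQueue en n)
  have hg : en (.inl .main) ∈ initialQueue en n := by simp [initialQueue, blocks]
  rw [← win_initialQueue_iff en]
  exact ⟨win_of_simulated hA' hB hA₀' hB₀ hg (mem_marker _ en .main),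
    simulated_of_win hA' hB hA₀' hB₀ hg (mem_marker _ en .main)⟩

end MultiBuffer

/-! ### The main theorem. -/

theorem mainTheorem2 :
    ∃ construct : MultiBuffer.GameCode → ℕ × MultiBuffer.NBACode × MultiBuffer.NBACode,
      Computable construct ∧
      ∀ (R : MultiBuffer.GameCode) (G : MultiBuffer.BuchiGame), R.Represents G →
        let m := (construct R).1
        let A := (construct R).2.1.toNBA m
        let B := (construct R).2.2.toNBA m
        (MultiBuffer.Simulated (MultiBuffer.sigma12 m) ![⊤, 0] A B ↔ G.Player0Wins) := by
  obtain ⟨c, hc⟩ := MultiBuffer.exists_verdict_code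
  obtain ⟨m, w, dA, dB, hw, h⟩ := MultiBuffer.exists_automata c
  -- For a fixed universal program, `m`, `dA` and `dB` are constants, so computability concerns only
  -- the prefix word for the code number of R.
  refine ⟨fun R => (m, MultiBuffer.prefixCode (w (Encodable.encode R)) dA, dB), ?_, fun R G hR => ?_⟩
  · exact ((Primrec.const m).pair (((MultiBuffer.primrec_prefixCode dA).comp
      (hw.comp Primrec.encode)).pair (Primrec.const dB))).to_comp
  · exact (h (Encodable.encode R)).trans ((MultiBuffer.win_codeGame_iff (hc R G hR)).trans
      (MultiBuffer.win_numArena_iff_player0Wins MultiBuffer.wordOf_surjective))
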